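/- Let $K$ be an imaginary quadratic number field of class number $1$ with ring of integers $\mathcal{O}$, let $w_K$ be the number of units of $\mathcal{O}$, and let $d_K$ be the square root of the absolute value of the discriminant of $K$. Let $S\subset\mathbb{P}^3$ be the cubic surface $x_0^3=x_1x_2x_3$, and let $U$ be the complement in $S$ of the three lines $\{x_0=x_j=0\}$, $j=1,2,3$. For $\mathbf{x}=(x_0:\dots:x_3)\in\mathbb{P}^3(K)$ let $H(\mathbf{x})=\prod_{\nu}\max_{0\le j\le 3}\|x_j\|_\nu$ be the Weil height, where $\nu$ runs over all places of $K$ and $\|\cdot\|_\nu$ is the normalized norm: $\|x\|_\nu=|\sigma(x)|^2$ at the complex place given by the pair of embeddings $\sigma,\bar\sigma:K\to\mathbb{C}$, and $\|x\|_\nu=|N_{K_\nu/\mathbb{Q}_p}(x)|_p$ at a finite place $\nu$ above a prime number $p$. Then, for every real $B$, the number $N_{U,K,H}(B)=\#\{\mathbf{x}\in U(K)\mid H(\mathbf{x})\le B\}$ is finite, and $$N_{U,K,H}(B)=c_{S,K,H}\,B(\log B)^6+O\big(B(\log B)^5\big)\qquad\text{as } B\to\infty,$$ where the implied constant may depend on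 $K$ and $$c_{S,K,H}=\frac{2^7\pi^9}{6!\,w_K^7\,d_K^9}\prod_{\mathfrak p}\left(1-\frac{1}{N\mathfrak p}\right)^7\left(1+\frac{7}{N\mathfrak p}+\frac{1}{(N\mathfrak p)^2}\right)>0 .$$ Here the product runs over all nonzero prime ideals $\mathfrak p$ of $\mathcal{O}$ (equivalently, over all prime elements $p$ of $\mathcal{O}$ up to units, with $N\mathfrak p=|p|^2$ for $\mathfrak p=(p)$), and it converges unconditionally. -/

import Mathlib

open scoped LinearAlgebra.Projectivization

namespace ToricCubic

/-- The `K`-rational points of the cubic surface `S ⊂ ℙ³` with equation `x₀³ = x₁x₂x₃`.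
The equation is homogeneous, so it may be tested on any representative
(see `mk_mem_surface_iff`). -/
def surface (K : Type*) [Field K] : Set (ℙ K (Fin 4 → K)) :=
  {x | x.rep 0 ^ 3 = x.rep 1 * x.rep 2 * x.rep 3}

/-- The `K`-rational points of the line `x₀ = x_j = 0` in `ℙ³`. For `j = 1, 2, 3` these are
the three lines contained in `S`. -/
def line (K : Type*) [Field K] (j : Fin 4) : Set (ℙ K (Fin 4 → K)) :=
  {x | x.rep 0 = 0 ∧ x.rep j = 0}

/-- The `K`-rational points of the complement `U` of the three lines on `S`. -/
def openPart (K : Type*) [Field K] : Set (ℙ K (Fin 4 → K)) :=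
  surface K \ (line K 1 ∪ line K 2 ∪ line K 3)

theorem mk_mem_surface_iff {K : Type*} [Field K] (v : Fin 4 → K) (hv : v ≠ 0) :
    Projectivization.mk K v hv ∈ surface K ↔ v 0 ^ 3 = v 1 * v 2 * v 3 := by
  obtain ⟨a, ha⟩ := Projectivization.exists_smul_eq_mk_rep K v hv
  have h3 : ((a : K) ^ 3) ≠ 0 := pow_ne_zero _ a.ne_zero
  simp only [surface, Set.mem_ofPred_eq, ← ha, Pi.smul_apply, Units.smul_def, smul_eq_mul]
  constructor
  · intro h
    exact mul_left_cancel₀ h3 (by linear_combination h)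
  · intro h
    linear_combination (a : K) ^ 3 * h

theorem mk_mem_line_iff {K : Type*} [Field K] (j : Fin 4) (v : Fin 4 → K) (hv : v ≠ 0) :
    Projectivization.mk K v hv ∈ line K j ↔ v 0 = 0 ∧ v j = 0 := by
  obtain ⟨a, ha⟩ := Projectivization.exists_smul_eq_mk_rep K v hv
  simp [line, ← ha, Units.smul_def]

/-- The `K`-rational points of `U` of Weil height at most `B`. The height of
`(x₀ : x₁ : x₂ : x₃)` is the product over all places `ν` of `K` of `max_j ‖x_j‖_ν`, with the
normalized `ν`-adic norms (so `‖x‖_ν = |σ x| ^ 2` at a complex place). -/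
def pointsOfHeightLE (K : Type*) [Field K] [NumberField K] (B : ℝ) :
    Set (ℙ K (Fin 4 → K)) :=
  {x | x ∈ openPart K ∧ x.mulHeight ≤ B}

/-- The counting function `N(B)`, the number of `K`-rational points of `U` of height at most
`B`. -/
noncomputable def pointCount (K : Type*) [Field K] [NumberField K] (B : ℝ) : ℕ :=
  (pointsOfHeightLE K B).ncard

/-- The number of units in the ring of integers of `K`. -/
noncomputable def numUnits (K : Type*) [Field K] [NumberField K] : ℕ :=
  Nat.card (NumberField.RingOfIntegers K)ˣ

/-- The square root of the absolute value of the discriminant of `K`. -/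
noncomputable def sqrtDisc (K : Type*) [Field K] [NumberField K] : ℝ :=
  Real.sqrt |(NumberField.discr K : ℝ)|

/-- The factor `(1 - 1/N𝔭)⁷ (1 + 7/N𝔭 + 1/N𝔭²)` at a nonzero prime ideal `𝔭` of the ring of
integers. -/
noncomputable def eulerFactor (K : Type*) [Field K] [NumberField K]
    (p : IsDedekindDomain.HeightOneSpectrum (NumberField.RingOfIntegers K)) : ℝ :=
  (1 - 1 / (Ideal.absNorm p.asIdeal : ℝ)) ^ 7 *
    (1 + 7 / (Ideal.absNorm p.asIdeal : ℝ) + 1 / (Ideal.absNorm p.asIdeal : ℝ) ^ 2)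

/-- The constant `2⁷π⁹ / (6! w⁷ d⁹) ∏_𝔭 (1 - 1/N𝔭)⁷ (1 + 7/N𝔭 + 1/N𝔭²)`. -/
noncomputable def leadingConstant (K : Type*) [Field K] [NumberField K] : ℝ :=
  2 ^ 7 * Real.pi ^ 9 / ((Nat.factorial 6 : ℝ) * (numUnits K : ℝ) ^ 7 * sqrtDisc K ^ 9) *
    ∏' p : IsDedekindDomain.HeightOneSpectrum (NumberField.RingOfIntegers K), eulerFactor K p

end ToricCubic

namespace ToricCubic

/-! ### Powers of nearly equal measures on down-closed sets -/

section Comparison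

open MeasureTheory Set
open scoped ENNReal

/-! The count is lifted to nine-tuples of ideals (a universal torsor over the minimal
desingularization of the surface), and these are counted by a lattice-point estimate, a polytope
volume and a Möbius inversion.

Since `𝓞 K` is principal, a point of U is a primitive integral quadruple with x₀ ≠ 0, unique up to a
unit. By unique factorization it is the same as three ideals without a common prime factor whose
product is a cube, together with two free units. Its height is the largest of the three norms,
because the norm of x₀ is their geometric mean. So the count is w_K² times the number of such
triples (`bijOn_pointOf`).

At each prime, the exponents of a triple form a vector with a vanishing coordinate and with
coordinate sum divisible by 3. The nine rays 3eᵢ and 2eᵢ + eₖ cut the set of these vectors into nine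
unimodular cones. Hence triples correspond to nine-tuples of ideals whose support at every prime is
contained in a cone (`bijOn_rayMonomial`). Möbius inversion on supports replaces this condition by
divisibility by a squarefree nine-tuple (`ncard_coneTuples`), which rescales the three height
conditions by factors Dᵢ.

There remain unrestricted tuples (x, y) with Dᵢ N(xᵢ)³ mᵢ(y) ≤ B, where mᵢ are monomials in six
variables. For fixed y the three xᵢ are independent, and the number of ideals of norm at most X is
κX + O(√X) with κ = 2π/(w_K d_K). Each yⱼ has total exponent 3 in m₀m₁m₂, so the product of the main
terms is κ³ B (∏ Dᵢ)^(-1/3) ∏ N(yⱼ)⁻¹. In the coordinates log N(yⱼ), the sum over y compares a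
product measure with κ⁶ times Lebesgue measure on a polytope of volume about (log B)⁶/2880
(`exists_sum_prod_inv_bound`, `orthant_polytope_one`). The result is `exists_solutionSet_bound`,
uniform in D.

In the Möbius sum the main terms multiply up to the Euler product. The inversion has no linear term
at any prime, so the product converges and the accumulated error stays O(B (log B)⁵). The constant
is w_K² κ⁹/2880 times the Euler product (`leadingConstant_eq`). -/

theorem piFinSuccAbove_zero_symm_apply {α : Type*} [MeasurableSpace α] {n : ℕ} (a : α)
    (y : Fin n → α) :
    (MeasurableEquiv.piFinSuccAbove (fun _ : Fin (n + 1) => α) 0).symm (a, y) = Fin.cons a y := by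
  simp [MeasurableEquiv.piFinSuccAbove, Fin.insertNthEquiv]

theorem lintegral_pi_succ {α : Type*} [MeasurableSpace α] {n : ℕ} (μ : Measure α) [SigmaFinite μ]
    (f : (Fin (n + 1) → α) → ℝ≥0∞) (hf : Measurable f) :
    ∫⁻ x, f x ∂(Measure.pi fun _ => μ) =
      ∫⁻ a, ∫⁻ y, f (Fin.cons a y) ∂(Measure.pi fun _ : Fin n => μ) ∂μ := by
  have h := (measurePreserving_piFinSuccAbove (fun _ : Fin (n + 1) => μ) 0).symm
  rw [← h.lintegral_comp hf, lintegral_prod]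
  · simp only [piFinSuccAbove_zero_symm_apply]
  · exact (hf.comp h.measurable).aemeasurable

theorem lintegral_pi_succ_symm {α : Type*} [MeasurableSpace α] {n : ℕ} (μ : Measure α)
    [SigmaFinite μ] (f : (Fin (n + 1) → α) → ℝ≥0∞) (hf : Measurable f) :
    ∫⁻ x, f x ∂(Measure.pi fun _ => μ) =
      ∫⁻ y, ∫⁻ a, f (Fin.cons a y) ∂μ ∂(Measure.pi fun _ : Fin n => μ) := by
  have h := (measurePreserving_piFinSuccAbove (fun _ : Fin (n + 1) => μ) 0).symm
  rw [← h.lintegral_comp hf, lintegral_prod_symm]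
  · simp only [piFinSuccAbove_zero_symm_apply]
  · exact (hf.comp h.measurable).aemeasurable

theorem measurable_cons {α : Type*} [MeasurableSpace α] {n : ℕ} :
    Measurable fun q : α × (Fin n → α) => (Fin.cons q.1 q.2 : Fin (n + 1) → α) := by
  rw [measurable_pi_iff]
  intro i
  refine Fin.cases ?_ (fun j => ?_) i
  · simpa using measurable_fst
  · simpa using! (measurable_pi_apply j).comp measurable_snd

/-- A closed subset of the cube `[0, T]ⁿ` that is closed under decreasing coordinates. -/
structure IsDownClosed {n : ℕ} (T : ℝ) (P : Set (Fin n → ℝ)) : Prop where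
  isClosed : IsClosed P
  nonneg : ∀ x ∈ P, ∀ i, 0 ≤ x i
  le : ∀ x ∈ P, ∀ i, x i ≤ T
  down : ∀ x ∈ P, ∀ y : Fin n → ℝ, (∀ i, 0 ≤ y i) → (∀ i, y i ≤ x i) → y ∈ P

theorem IsDownClosed.tail {n : ℕ} {T : ℝ} {P : Set (Fin (n + 1) → ℝ)} (h : IsDownClosed T P)
    (a : ℝ) : IsDownClosed T {y : Fin n → ℝ | (Fin.cons a y : Fin (n + 1) → ℝ) ∈ P} where
  isClosed := h.isClosed.preimage (by fun_prop)
  nonneg y hy i := by simpa using h.nonneg _ hy i.succ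
  le y hy i := by simpa using h.le _ hy i.succ
  down y hy z h0 hz := by
    refine h.down _ hy _ ?_ ?_
    · refine Fin.cases ?_ (fun j => ?_)
      · simpa using h.nonneg _ hy 0
      · simpa using h0 j
    · refine Fin.cases ?_ (fun j => ?_)
      · simp
      · simpa using hz j

/-- A nonempty slice is closed and bounded, so it contains its supremum and then everything below
it. Thus intervals `[0, l]` are the only sets on which the two one-dimensional measures have to be
compared. -/
theorem IsDownClosed.slice {n : ℕ} {T : ℝ} {P : Set (Fin (n + 1) → ℝ)} (h : IsDownClosed T P)
    (y : Fin n → ℝ) : {a : ℝ | (Fin.cons a y : Fin (n + 1) → ℝ) ∈ P} = ∅ ∨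
      ∃ l, 0 ≤ l ∧ {a : ℝ | (Fin.cons a y : Fin (n + 1) → ℝ) ∈ P} = Icc 0 l := by
  set S := {a : ℝ | (Fin.cons a y : Fin (n + 1) → ℝ) ∈ P} with hS
  rcases S.eq_empty_or_nonempty with h0 | hne
  · exact Or.inl h0
  right
  have hnn : ∀ a ∈ S, 0 ≤ a := fun a ha => by simpa using h.nonneg _ ha 0
  have hbdd : BddAbove S := ⟨T, fun a ha => by simpa using h.le _ ha 0⟩
  have hcl : IsClosed S := h.isClosed.preimage (by fun_prop)
  have hmem := hcl.csSup_mem hne hbdd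
  refine ⟨sSup S, hnn _ hmem, Set.ext fun a => ⟨fun ha => ⟨hnn a ha, le_csSup hbdd ha⟩,
    fun ha => ?_⟩⟩
  refine h.down _ hmem _ ?_ ?_
  · refine Fin.cases ?_ (fun j => ?_)
    · simpa using ha.1
    · simpa using h.nonneg _ hmem j.succ
  · refine Fin.cases ?_ (fun j => ?_)
    · simpa using ha.2
    · simp

theorem IsDownClosed.subset {n : ℕ} {T : ℝ} {P : Set (Fin n → ℝ)} (h : IsDownClosed T P) :
    P ⊆ Set.pi univ fun _ => Icc 0 T := fun x hx i _ => ⟨h.nonneg x hx i, h.le x hx i⟩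

/-- If two measures nearly agree on the intervals `[0, l]`, their powers nearly agree on
down-closed sets. -/
theorem pi_le_pi_add (μ ν : Measure ℝ) [SigmaFinite μ] [SigmaFinite ν] (C L : ℝ≥0∞) (T : ℝ)
    (hC : ∀ l, 0 ≤ l → μ (Icc 0 l) ≤ ν (Icc 0 l) + C) (hμ : μ (Icc 0 T) ≤ L)
    (hν : ν (Icc 0 T) ≤ L) (n : ℕ) (P : Set (Fin n → ℝ)) (hP : IsDownClosed T P) :
    (Measure.pi fun _ => μ) P ≤ (Measure.pi fun _ => ν) P + n * C * L ^ (n - 1) := by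
  induction n with
  | zero =>
    rcases P.eq_empty_or_nonempty with rfl | ⟨x, hx⟩
    · simp
    · have : P = univ := by
        ext y
        simp [Subsingleton.elim y x, hx]
      subst this
      simp
  -- The factors are exchanged one at a time: all but the first by induction on slices (`h1`), then
  -- the first one after swapping the integrals (`h2`).
  | succ n ih =>
    have hPm := hP.isClosed.measurableSet
    have hind : Measurable (P.indicator (1 : (Fin (n + 1) → ℝ) → ℝ≥0∞)) :=
      measurable_one.indicator hPm
    have hsec : ∀ (a : ℝ) (ρ : Measure (Fin n → ℝ)),
        ∫⁻ y, P.indicator 1 (Fin.cons a y : Fin (n + 1) → ℝ) ∂ρ =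
          ρ {y | (Fin.cons a y : Fin (n + 1) → ℝ) ∈ P} := by
      intro a ρ
      rw [← lintegral_indicator_one (hP.tail a).isClosed.measurableSet]
      rfl
    have hsec' : ∀ (y : Fin n → ℝ) (ρ : Measure ℝ),
        ∫⁻ a, P.indicator 1 (Fin.cons a y : Fin (n + 1) → ℝ) ∂ρ =
          ρ {a | (Fin.cons a y : Fin (n + 1) → ℝ) ∈ P} := by
      intro y ρ
      rw [← lintegral_indicator_one]
      · rfl
      · exact (hP.isClosed.preimage (by fun_prop :
          Continuous fun a : ℝ => (Fin.cons a y : Fin (n + 1) → ℝ))).measurableSet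
    -- Slices at `a` outside `[0, T]` are empty, so the inductive error is integrated over a set of
    -- `μ`-measure at most `L`.
    have h1 : (Measure.pi fun _ => μ) P ≤
        ∫⁻ a, ∫⁻ y, P.indicator 1 (Fin.cons a y : Fin (n + 1) → ℝ)
          ∂(Measure.pi fun _ : Fin n => ν) ∂μ + n * C * L ^ (n - 1) * L := by
      rw [← lintegral_indicator_one hPm, lintegral_pi_succ μ _ hind]
      calc _ ≤ ∫⁻ a, (∫⁻ y, P.indicator 1 (Fin.cons a y : Fin (n + 1) → ℝ)
          ∂(Measure.pi fun _ : Fin n => ν)) +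
            (Icc 0 T).indicator (fun _ => n * C * L ^ (n - 1)) a ∂μ := by
            refine lintegral_mono fun a => ?_
            simp only [hsec]
            by_cases ha : a ∈ Icc 0 T
            · rw [indicator_of_mem ha]
              exact ih _ (hP.tail a)
            · have : {y | (Fin.cons a y : Fin (n + 1) → ℝ) ∈ P} = ∅ := by
                rw [eq_empty_iff_forall_notMem]
                intro y hy
                exact ha ⟨by simpa using hP.nonneg _ hy 0, by simpa using hP.le _ hy 0⟩
              simp [this]
        _ ≤ _ := by
            rw [lintegral_add_right _ (measurable_const.indicator measurableSet_Icc),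
              lintegral_indicator_const measurableSet_Icc]
            gcongr
    have h2 : ∫⁻ a, ∫⁻ y, P.indicator 1 (Fin.cons a y : Fin (n + 1) → ℝ)
          ∂(Measure.pi fun _ : Fin n => ν) ∂μ ≤ (Measure.pi fun _ => ν) P + C * L ^ n := by
      rw [lintegral_lintegral_swap (f := fun a y => P.indicator 1 (Fin.cons a y : Fin (n + 1) → ℝ))
        (hind.comp measurable_cons).aemeasurable,
        ← lintegral_indicator_one hPm, lintegral_pi_succ_symm ν _ hind]
      calc _ ≤ ∫⁻ y, (∫⁻ a, P.indicator 1 (Fin.cons a y : Fin (n + 1) → ℝ) ∂ν) +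
            (Set.pi univ fun _ => Icc 0 T).indicator (fun _ => C) y
              ∂(Measure.pi fun _ : Fin n => ν) := by
            refine lintegral_mono fun y => ?_
            simp only [hsec']
            by_cases hy : y ∈ (Set.pi univ fun _ : Fin n => Icc 0 T)
            · rw [indicator_of_mem hy]
              rcases hP.slice y with h0 | ⟨l, hl, h0⟩
              · simp [h0]
              · rw [h0]
                exact hC l hl
            · have : {a | (Fin.cons a y : Fin (n + 1) → ℝ) ∈ P} = ∅ := by
                rw [eq_empty_iff_forall_notMem]
                intro a ha
                exact hy fun i _ => ⟨by simpa using hP.nonneg _ ha i.succ,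
                  by simpa using hP.le _ ha i.succ⟩
              simp [this]
        _ ≤ _ := by
            have hm : MeasurableSet (Set.pi univ fun _ : Fin n => Icc 0 T) :=
              MeasurableSet.univ_pi fun _ => measurableSet_Icc
            rw [lintegral_add_right _ (measurable_const.indicator hm),
              lintegral_indicator_const hm, Measure.pi_pi]
            gcongr
            simpa using pow_le_pow_left' hν n
    refine (h1.trans (add_le_add_left h2 _)).trans_eq ?_
    -- The exponent `n - 1` is truncated at `n = 0`, where the factor `n` removes the term.
    rcases n with _ | n
    · simp
    · simp only [Nat.add_sub_cancel]
      push_cast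
      ring

end Comparison

end ToricCubic

namespace ToricCubic

/-! ### Elementary integrals in one and two variables -/

section Volume

open MeasureTheory Set Filter Topology
open scoped ENNReal

/-- The nonnegativity of the value is kept beside it, since `ENNReal.ofReal` forgets signs and
iterated integrals need them. -/
theorem lintegral_Ioi_of_hasDerivAt {F f : ℝ → ℝ} {a l : ℝ} (hd : ∀ x ∈ Ici a, HasDerivAt F (f x) x)
    (h0 : ∀ x ∈ Ioi a, 0 ≤ f x) (hl : Tendsto F atTop (𝓝 l)) :
    ∫⁻ x in Ioi a, ENNReal.ofReal (f x) = ENNReal.ofReal (l - F a) ∧ 0 ≤ l - F a := by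
  have hi := integrableOn_Ioi_deriv_of_nonneg' hd h0 hl
  have he := integral_Ioi_of_hasDerivAt_of_nonneg' hd h0 hl
  have hae : 0 ≤ᵐ[volume.restrict (Ioi a)] f :=
    (ae_restrict_mem measurableSet_Ioi).mono fun x hx => h0 x hx
  rw [← ofReal_integral_eq_lintegral_ofReal hi hae, he]
  exact ⟨rfl, he ▸ integral_nonneg_of_ae hae⟩

theorem lintegral_Ioc_of_hasDerivAt {F f : ℝ → ℝ} {a b : ℝ} (hab : a ≤ b)
    (hd : ∀ x, HasDerivAt F (f x) x) (hf : Continuous f) (h0 : ∀ x ∈ Ioc a b, 0 ≤ f x) :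
    ∫⁻ x in Ioc a b, ENNReal.ofReal (f x) = ENNReal.ofReal (F b - F a) ∧ 0 ≤ F b - F a := by
  have hi : IntegrableOn f (Ioc a b) := (hf.intervalIntegrable a b).1
  have hae : 0 ≤ᵐ[volume.restrict (Ioc a b)] f :=
    (ae_restrict_mem measurableSet_Ioc).mono fun x hx => h0 x hx
  have he : ∫ x in Ioc a b, f x = F b - F a := by
    rw [← intervalIntegral.integral_of_le hab]
    exact intervalIntegral.integral_eq_sub_of_hasDerivAt (fun x _ => hd x)
      (hf.intervalIntegrable a b)
  rw [← ofReal_integral_eq_lintegral_ofReal hi hae, he]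
  exact ⟨rfl, he ▸ integral_nonneg_of_ae hae⟩

theorem lintegral_Ioi_split {a b : ℝ} (hab : a ≤ b) (f : ℝ → ℝ≥0∞) :
    ∫⁻ x in Ioi a, f x = (∫⁻ x in Ioc a b, f x) + ∫⁻ x in Ioi b, f x := by
  rw [← Ioc_union_Ioi_eq_Ioi hab, lintegral_union measurableSet_Ioi]
  exact Set.disjoint_left.2 fun x hx hx' => not_lt_of_ge hx.2 hx'

theorem tendsto_pow_mul_exp_neg_mul {k : ℝ} (hk : 0 < k) (n : ℕ) :
    Tendsto (fun x : ℝ => x ^ n * Real.exp (-(k * x))) atTop (𝓝 0) := by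
  have h := (Real.tendsto_pow_mul_exp_neg_atTop_nhds_zero n).comp
    (tendsto_id.const_mul_atTop hk)
  have h2 := h.const_mul ((k ^ n)⁻¹)
  rw [mul_zero] at h2
  refine h2.congr fun x => ?_
  have : k ^ n ≠ 0 := by positivity
  simp only [Function.comp, id, mul_pow]
  field_simp

theorem lintegral_Ioi_sub_mul {α c k : ℝ} (hk : 0 < k) :
    ∫⁻ x in Ioi α, ENNReal.ofReal (c - k * x) =
      ENNReal.ofReal ((max (c - k * α) 0) ^ 2 / (2 * k)) := by
  rcases le_total (c - k * α) 0 with h | h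
  · rw [max_eq_right h, setLIntegral_congr_fun (g := fun _ => 0) measurableSet_Ioi]
    · simp
    · intro x hx
      have : k * α < k * x := mul_lt_mul_of_pos_left hx hk
      exact ENNReal.ofReal_of_nonpos (by linarith)
  · rw [max_eq_left h]
    have hα : α ≤ c / k := by rw [le_div_iff₀ hk]; linarith
    rw [lintegral_Ioi_split hα, setLIntegral_congr_fun (s := Ioi (c / k)) (g := fun _ => 0)
      measurableSet_Ioi]
    · rw [(lintegral_Ioc_of_hasDerivAt (F := fun x => c * x - k * (x ^ 2 / 2)) hα (fun x => ((hasDerivAt_id' x).const_mul c).sub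
          ((((hasDerivAt_id' x).pow 2).div_const 2).const_mul k) |>.congr_deriv (by simp))
        (by fun_prop) ?_).1]
      · simp only [lintegral_zero, add_zero]
        congr 1
        field_simp
        ring
      · intro x hx
        have := (le_div_iff₀ hk).1 hx.2
        linarith
    · intro x hx
      have := (div_lt_iff₀ hk).1 hx
      exact ENNReal.ofReal_of_nonpos (by linarith)

/-- The area of the polygon `p, r ≥ 0`, `2p + r ≤ u`, `p + 2r ≤ v`. -/
noncomputable def quadArea (u v : ℝ) : ℝ :=
  ((max u 0) ^ 2 + 3 * (max ((u - 2 * v) / 3) 0) ^ 2) / 4 -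
    (3 * (max ((2 * u - v) / 3) 0) ^ 2 + (max (-v) 0) ^ 2) / 4

/-- Either one constraint makes the other redundant, or the two boundary lines meet at `p = (2u -
v)/3`. The form of `quadArea`, a signed sum of squares of positive parts, covers all three cases; `0
≤ u + v` is what makes it correct where a single constraint is active. This form is chosen because
every square can then be integrated by the same formula. -/
theorem lintegral_quadrilateral {u v : ℝ} (huv : 0 ≤ u + v) :
    ∫⁻ p in Ioi (0 : ℝ), ∫⁻ r in Ioi (0 : ℝ),
      {q : ℝ × ℝ | 2 * q.1 + q.2 ≤ u ∧ q.1 + 2 * q.2 ≤ v}.indicator 1 (p, r) =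
        ENNReal.ofReal (quadArea u v) ∧ 0 ≤ quadArea u v := by
  have hin : ∀ p : ℝ, ∫⁻ r in Ioi (0 : ℝ),
      {q : ℝ × ℝ | 2 * q.1 + q.2 ≤ u ∧ q.1 + 2 * q.2 ≤ v}.indicator (1 : ℝ × ℝ → ℝ≥0∞) (p, r) =
        ENNReal.ofReal (min (u - 2 * p) (v / 2 - 1 / 2 * p)) := by
    intro p
    have : ∀ r : ℝ, {q : ℝ × ℝ | 2 * q.1 + q.2 ≤ u ∧ q.1 + 2 * q.2 ≤ v}.indicator
        (1 : ℝ × ℝ → ℝ≥0∞) (p, r) =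
        (Iic (min (u - 2 * p) (v / 2 - 1 / 2 * p))).indicator 1 r := by
      intro r
      simp only [indicator_apply, mem_Iic, le_min_iff, mem_ofPred_eq, Pi.one_apply]
      congr 1
      exact propext ⟨fun h => ⟨by linarith [h.1], by linarith [h.2]⟩,
        fun h => ⟨by linarith [h.1], by linarith [h.2]⟩⟩
    simp only [this]
    rw [lintegral_indicator_one measurableSet_Iic, Measure.restrict_apply measurableSet_Iic,
      Iic_inter_Ioi, Real.volume_Ioc, sub_zero]
  simp only [hin]
  rcases le_total (2 * u) v with h1 | h1
  · have e1 : ∀ p ∈ Ioi (0 : ℝ), ENNReal.ofReal (min (u - 2 * p) (v / 2 - 1 / 2 * p)) =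
        ENNReal.ofReal (u - 2 * p) := by
      intro p hp
      rw [min_eq_left]
      have : 0 < p := hp
      linarith
    have h2 : quadArea u v = (max u 0) ^ 2 / 4 := by
      rw [quadArea, max_eq_right (by linarith : (u - 2 * v) / 3 ≤ 0),
        max_eq_right (by linarith : (2 * u - v) / 3 ≤ 0), max_eq_right (by linarith : -v ≤ 0)]
      ring
    rw [setLIntegral_congr_fun measurableSet_Ioi e1, lintegral_Ioi_sub_mul two_pos, h2]
    norm_num
    positivity
  rcases le_total (2 * v) u with h2 | h2
  · have e1 : ∀ p ∈ Ioi (0 : ℝ), ENNReal.ofReal (min (u - 2 * p) (v / 2 - 1 / 2 * p)) =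
        ENNReal.ofReal (v / 2 - 1 / 2 * p) := by
      intro p hp
      have : 0 < p := hp
      rcases le_total (v / 2 - 1 / 2 * p) (u - 2 * p) with h | h
      · rw [min_eq_right h]
      · rw [min_eq_left h, ENNReal.ofReal_of_nonpos, ENNReal.ofReal_of_nonpos] <;> linarith
    have h3 : quadArea u v = (max v 0) ^ 2 / 4 := by
      rw [quadArea, max_eq_left (by linarith : 0 ≤ (u - 2 * v) / 3),
        max_eq_left (by linarith : 0 ≤ (2 * u - v) / 3), max_eq_left (by linarith : 0 ≤ u)]
      rcases le_total v 0 with hv | hv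
      · rw [max_eq_left (by linarith), max_eq_right hv]; ring
      · rw [max_eq_right (by linarith), max_eq_left hv]; ring
    rw [setLIntegral_congr_fun measurableSet_Ioi e1, lintegral_Ioi_sub_mul (by norm_num), h3]
    refine ⟨?_, by positivity⟩
    congr 1
    rcases le_total v 0 with hv | hv
    · rw [max_eq_right hv, max_eq_right (by linarith)]
      norm_num
    · rw [max_eq_left hv, max_eq_left (by linarith)]
      ring
  · have hp0 : 0 ≤ (2 * u - v) / 3 := by linarith
    rw [lintegral_Ioi_split hp0]
    have e1 : ∀ p ∈ Ioc (0 : ℝ) ((2 * u - v) / 3),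
        ENNReal.ofReal (min (u - 2 * p) (v / 2 - 1 / 2 * p)) =
        ENNReal.ofReal (v / 2 - 1 / 2 * p) := by
      intro p hp
      rw [min_eq_right]
      linarith [hp.2]
    have e2 : ∀ p ∈ Ioi ((2 * u - v) / 3),
        ENNReal.ofReal (min (u - 2 * p) (v / 2 - 1 / 2 * p)) =
        ENNReal.ofReal (u - 2 * p) := by
      intro p hp
      rw [min_eq_left]
      have : (2 * u - v) / 3 < p := hp
      linarith
    have e3 := lintegral_Ioc_of_hasDerivAt (F := fun x => v / 2 * x - 1 / 2 * (x ^ 2 / 2))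
      (f := fun x => v / 2 - 1 / 2 * x) hp0 (fun x => ((hasDerivAt_id' x).const_mul (v / 2)).sub
          ((((hasDerivAt_id' x).pow 2).div_const 2).const_mul (1 / 2)) |>.congr_deriv (by simp))
      (by fun_prop) (fun x hx => by linarith [hx.2])
    rw [setLIntegral_congr_fun measurableSet_Ioc e1, setLIntegral_congr_fun measurableSet_Ioi e2,
      lintegral_Ioi_sub_mul two_pos, e3.1, ← ENNReal.ofReal_add e3.2 (by positivity)]
    have h3 : quadArea u v = (4 * u * v - u ^ 2 - v ^ 2) / 12 := by
      rw [quadArea, max_eq_right (by linarith : (u - 2 * v) / 3 ≤ 0),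
        max_eq_left (by linarith : 0 ≤ (2 * u - v) / 3), max_eq_right (by linarith : -v ≤ 0),
        max_eq_left (by linarith : 0 ≤ u)]
      ring
    rw [h3, max_eq_left (by linarith)]
    refine ⟨?_, by nlinarith⟩
    congr 1
    ring

theorem lintegral_exp_mul_sq_max_inner (s : ℝ) :
    ∫⁻ d in Ioi (0 : ℝ), ENNReal.ofReal (Real.exp (-d) * (max (d + s) 0) ^ 2) =
      ENNReal.ofReal (if s ≤ 0 then 2 * Real.exp s else s ^ 2 + 2 * s + 2) := by
  have hd : ∀ x : ℝ, HasDerivAt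
      (fun d : ℝ => -(Real.exp (-d) * ((d + s) ^ 2 + 2 * (d + s) + 2)))
      (Real.exp (-x) * (x + s) ^ 2) x := by
    intro x
    have h1 : HasDerivAt (fun d : ℝ => Real.exp (-d)) (-Real.exp (-x)) x := by
      simpa using (hasDerivAt_neg x).exp
    have h2 : HasDerivAt (fun d : ℝ => (d + s) ^ 2 + 2 * (d + s) + 2) (2 * (x + s) + 2) x := by
      have h3 := (hasDerivAt_id' x).add_const s
      exact (((h3.pow 2).add (h3.const_mul 2)).add_const 2).congr_deriv (by simp)
    exact (h1.mul h2).neg.congr_deriv (by ring)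
  have hl : Tendsto (fun d : ℝ => -(Real.exp (-d) * ((d + s) ^ 2 + 2 * (d + s) + 2)))
      atTop (𝓝 0) := by
    have h0 := tendsto_pow_mul_exp_neg_mul one_pos 0
    have h1 := tendsto_pow_mul_exp_neg_mul one_pos 1
    have h2 := tendsto_pow_mul_exp_neg_mul one_pos 2
    have := ((h2.add (h1.mul_const (2 * s + 2))).add (h0.mul_const (s ^ 2 + 2 * s + 2))).neg
    simp only [zero_mul, add_zero, neg_zero] at this
    refine this.congr fun x => ?_
    simp only [one_mul]
    ring
  split_ifs with hs
  · have hs' : 0 ≤ -s := by linarith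
    rw [lintegral_Ioi_split hs', setLIntegral_congr_fun (s := Ioc 0 (-s)) (g := fun _ => 0)
      measurableSet_Ioc, setLIntegral_congr_fun (s := Ioi (-s))
      (g := fun d => ENNReal.ofReal (Real.exp (-d) * (d + s) ^ 2)) measurableSet_Ioi,
      (lintegral_Ioi_of_hasDerivAt (fun x _ => hd x) (fun x _ => by positivity) hl).1]
    · simp [mul_comm]
    · intro x hx
      have : -s < x := hx
      simp only [max_eq_left (by linarith : 0 ≤ x + s)]
    · intro x hx
      simp only [max_eq_right (by linarith [hx.2] : x + s ≤ 0)]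
      simp
  · rw [setLIntegral_congr_fun (s := Ioi 0)
      (g := fun d => ENNReal.ofReal (Real.exp (-d) * (d + s) ^ 2)) measurableSet_Ioi,
      (lintegral_Ioi_of_hasDerivAt (fun x _ => hd x) (fun x _ => by positivity) hl).1]
    · simp
    · intro x hx
      have : 0 < x := hx
      simp only [max_eq_left (by linarith : 0 ≤ x + s)]

theorem hasDerivAt_exp_neg_mul (k x : ℝ) :
    HasDerivAt (fun x : ℝ => Real.exp (-(k * x))) (-(k * Real.exp (-(k * x)))) x := by
  exact (((hasDerivAt_id' x).const_mul k).fun_neg).exp.congr_deriv (by simp; ring)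

/-- The value of `∫∫ e^{-c-d} max(d - c + s, 0)² dc dd` over the positive quadrant. -/
noncomputable def sqMaxIntegral (s : ℝ) : ℝ :=
  if s ≤ 0 then Real.exp s else s ^ 2 + 2 - Real.exp (-s)

theorem lintegral_exp_mul_sq_max (s : ℝ) :
    ∫⁻ c in Ioi (0 : ℝ), ∫⁻ d in Ioi (0 : ℝ),
      ENNReal.ofReal (Real.exp (-c - d) * (max (d - c + s) 0) ^ 2) =
        ENNReal.ofReal (sqMaxIntegral s) ∧ 0 ≤ sqMaxIntegral s := by
  have hin : ∀ c : ℝ, ∫⁻ d in Ioi (0 : ℝ),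
      ENNReal.ofReal (Real.exp (-c - d) * (max (d - c + s) 0) ^ 2) =
      ENNReal.ofReal (Real.exp (-c) *
        (if s - c ≤ 0 then 2 * Real.exp (s - c) else (s - c) ^ 2 + 2 * (s - c) + 2)) := by
    intro c
    rw [ENNReal.ofReal_mul (Real.exp_pos _).le, ← lintegral_exp_mul_sq_max_inner,
      ← lintegral_const_mul' _ _ ENNReal.ofReal_ne_top]
    refine lintegral_congr fun d => ?_
    rw [← ENNReal.ofReal_mul (Real.exp_pos _).le, ← mul_assoc, ← Real.exp_add]
    congr 3
    · congr 1
      ring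
  simp only [hin, sqMaxIntegral]
  have hd1 : ∀ x : ℝ, HasDerivAt (fun x : ℝ => -(Real.exp s * Real.exp (-(2 * x))))
      (Real.exp (-x) * (2 * Real.exp (s - x))) x := by
    intro x
    refine ((hasDerivAt_exp_neg_mul 2 x).const_mul (Real.exp s)).neg.congr_deriv ?_
    rw [show s - x = s + -x by ring, show -(2 * x) = -x + -x by ring, Real.exp_add, Real.exp_add]
    ring
  have hl1 : Tendsto (fun x : ℝ => -(Real.exp s * Real.exp (-(2 * x)))) atTop (𝓝 0) := by
    simpa using ((tendsto_pow_mul_exp_neg_mul two_pos 0).const_mul (Real.exp s)).neg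
  have key : ∀ t : ℝ, s ≤ t → ∫⁻ c in Ioi t, ENNReal.ofReal (Real.exp (-c) *
        (if s - c ≤ 0 then 2 * Real.exp (s - c) else (s - c) ^ 2 + 2 * (s - c) + 2)) =
        ENNReal.ofReal (Real.exp s * Real.exp (-(2 * t))) := by
    intro t hst
    rw [setLIntegral_congr_fun (s := Ioi t)
      (g := fun c => ENNReal.ofReal (Real.exp (-c) * (2 * Real.exp (s - c)))) measurableSet_Ioi,
      (lintegral_Ioi_of_hasDerivAt (fun x _ => hd1 x) (fun x _ => by positivity) hl1).1]
    · simp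
    · intro x hx
      have : t < x := hx
      simp only [if_pos (by linarith : s - x ≤ 0)]
  split_ifs with hs
  · rw [key 0 hs]
    simp [(Real.exp_pos s).le]
  · have hs' : 0 ≤ s := by linarith
    have hd2 : ∀ x : ℝ, HasDerivAt (fun x : ℝ => -(Real.exp (-(1 * x)) * ((s - x) ^ 2 + 2)))
        (Real.exp (-x) * ((s - x) ^ 2 + 2 * (s - x) + 2)) x := by
      intro x
      have h2 : HasDerivAt (fun x : ℝ => (s - x) ^ 2 + 2) (-(2 * (s - x))) x := by
        exact ((((hasDerivAt_id' x).const_sub s).pow 2).add_const 2).congr_deriv (by simp)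
      refine ((hasDerivAt_exp_neg_mul 1 x).mul h2).neg.congr_deriv ?_
      simp only [one_mul]
      ring
    have h3 := lintegral_Ioc_of_hasDerivAt hs' hd2 (by fun_prop)
      (fun x hx => by
        have : 0 ≤ s - x := by linarith [hx.2]
        positivity)
    rw [lintegral_Ioi_split hs', key s le_rfl, setLIntegral_congr_fun (s := Ioc 0 s)
      (g := fun x => ENNReal.ofReal (Real.exp (-x) * ((s - x) ^ 2 + 2 * (s - x) + 2)))
      measurableSet_Ioc, h3.1, ← ENNReal.ofReal_add h3.2 (by positivity)]
    · have e : -(Real.exp (-(1 * s)) * ((s - s) ^ 2 + 2)) -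
          -(Real.exp (-(1 * 0)) * ((s - 0) ^ 2 + 2)) + Real.exp s * Real.exp (-(2 * s)) =
          s ^ 2 + 2 - Real.exp (-s) := by
        rw [← Real.exp_add, show s + -(2 * s) = -s by ring]
        simp
        ring
      rw [e]
      refine ⟨rfl, ?_⟩
      have := Real.exp_le_one_iff.2 (by linarith : -s ≤ 0)
      nlinarith
    · intro x hx
      rcases hx.2.lt_or_eq with h | h
      · simp only [if_neg (by linarith : ¬ s - x ≤ 0)]
      · subst h
        simp

end Volume

end ToricCubic

namespace ToricCubic

/-! ### Exponential integrals over the remaining four variables -/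

section Volume

open MeasureTheory Set Filter Topology
open scoped ENNReal

/-- Lebesgue measure on the positive half-line. -/
noncomputable abbrev halfLine : Measure ℝ := volume.restrict (Ioi 0)

/-- At these arguments the four forms squared in `quadArea` are `d - c` plus `a + 2b`, `-a`, `b` and
`-2a - b` respectively, so `lintegral_exp_mul_sq_max` evaluates each term. -/
theorem lintegral_exp_mul_quadArea {a b : ℝ} (ha : 0 < a) (hb : 0 < b) :
    ∫⁻ c in Ioi (0 : ℝ), ∫⁻ d in Ioi (0 : ℝ), ENNReal.ofReal (Real.exp (-c - d) *
      quadArea (a + 2 * b + (d - c)) (2 * a + b - (d - c))) =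
    ENNReal.ofReal ((b ^ 2 + 4 * a * b + a ^ 2 - 4 + 3 * Real.exp (-a) + 3 * Real.exp (-b)
      - Real.exp (-a) * Real.exp (-(2 * b)) - Real.exp (-(2 * a)) * Real.exp (-b)) / 4) ∧
    0 ≤ (b ^ 2 + 4 * a * b + a ^ 2 - 4 + 3 * Real.exp (-a) + 3 * Real.exp (-b)
      - Real.exp (-a) * Real.exp (-(2 * b)) - Real.exp (-(2 * a)) * Real.exp (-b)) / 4 := by
  set S : ℝ → ℝ → ℝ → ℝ := fun s c d => Real.exp (-c - d) * (max (d - c + s) 0) ^ 2 with hS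
  have hS0 : ∀ s c d, 0 ≤ S s c d := fun s c d => by simp only [hS]; positivity
  have hSc : ∀ s, Measurable fun q : ℝ × ℝ => ENNReal.ofReal (S s q.1 q.2) := fun s => by
    simp only [hS]
    fun_prop
  have hSc1 : ∀ s c, Measurable fun d : ℝ => ENNReal.ofReal (S s c d) := fun s c =>
    (hSc s).comp measurable_prodMk_left
  have hSc2 : ∀ s, Measurable fun c : ℝ => ∫⁻ d in Ioi (0 : ℝ), ENNReal.ofReal (S s c d) :=
    fun s => (hSc s).lintegral_prod_right'
  have hSc3 : Measurable fun c : ℝ =>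
      (ENNReal.ofReal 3 * ∫⁻ d in Ioi (0 : ℝ), ENNReal.ofReal (S b c d)) +
        ∫⁻ d in Ioi (0 : ℝ), ENNReal.ofReal (S (-(2 * a) - b) c d) :=
    ((hSc2 _).const_mul _).add (hSc2 _)
  have hSc4 : ∀ c, Measurable fun d : ℝ =>
      ENNReal.ofReal 3 * ENNReal.ofReal (S b c d) + ENNReal.ofReal (S (-(2 * a) - b) c d) :=
    fun c => ((hSc1 _ _).const_mul _).add (hSc1 _ _)
  have hS1 : ∀ s, ∫⁻ c in Ioi (0 : ℝ), ∫⁻ d in Ioi (0 : ℝ), ENNReal.ofReal (S s c d) =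
      ENNReal.ofReal (sqMaxIntegral s) := fun s => (lintegral_exp_mul_sq_max s).1
  have hpos := fun s => (lintegral_exp_mul_sq_max s).2
  have h3 : ENNReal.ofReal 3 ≠ ∞ := ENNReal.ofReal_ne_top
  have hQ0 : ∀ c d : ℝ, 0 ≤ quadArea (a + 2 * b + (d - c)) (2 * a + b - (d - c)) := fun c d =>
    (lintegral_quadrilateral (by linarith)).2
  -- Subtraction in `ℝ≥0∞` is truncated, so the negative squares are carried to the other side
  -- before integrating.
  have e1 : ∀ c d : ℝ, ENNReal.ofReal (4 * (Real.exp (-c - d) *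
        quadArea (a + 2 * b + (d - c)) (2 * a + b - (d - c)))) +
      (ENNReal.ofReal 3 * ENNReal.ofReal (S b c d) + ENNReal.ofReal (S (-(2 * a) - b) c d)) =
      ENNReal.ofReal (S (a + 2 * b) c d) + ENNReal.ofReal 3 * ENNReal.ofReal (S (-a) c d) := by
    intro c d
    have := hQ0 c d
    simp only [← ENNReal.ofReal_mul (by norm_num : (0 : ℝ) ≤ 3)]
    rw [← ENNReal.ofReal_add (mul_nonneg zero_le_three (hS0 _ _ _)) (hS0 _ _ _),
      ← ENNReal.ofReal_add (hS0 _ _ _) (mul_nonneg zero_le_three (hS0 _ _ _)),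
      ← ENNReal.ofReal_add (by positivity)
        (add_nonneg (mul_nonneg zero_le_three (hS0 _ _ _)) (hS0 _ _ _))]
    congr 1
    simp only [hS, quadArea]
    rw [show (2 * (a + 2 * b + (d - c)) - (2 * a + b - (d - c))) / 3 = d - c + b by ring,
      show (a + 2 * b + (d - c) - 2 * (2 * a + b - (d - c))) / 3 = d - c + -a by ring,
      show -(2 * a + b - (d - c)) = d - c + (-(2 * a) - b) by ring,
      show a + 2 * b + (d - c) = d - c + (a + 2 * b) by ring]
    ring
  have e2 : (∫⁻ c in Ioi (0 : ℝ), ∫⁻ d in Ioi (0 : ℝ), ENNReal.ofReal (4 * (Real.exp (-c - d) *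
      quadArea (a + 2 * b + (d - c)) (2 * a + b - (d - c))))) +
      ENNReal.ofReal (3 * sqMaxIntegral b + sqMaxIntegral (-(2 * a) - b)) =
      ENNReal.ofReal (sqMaxIntegral (a + 2 * b) + 3 * sqMaxIntegral (-a)) := by
    rw [ENNReal.ofReal_add (mul_nonneg zero_le_three (hpos _)) (hpos _),
      ENNReal.ofReal_add (hpos _) (mul_nonneg zero_le_three (hpos _)),
      ENNReal.ofReal_mul zero_le_three, ENNReal.ofReal_mul zero_le_three]
    simp only [← hS1]
    rw [← lintegral_const_mul' _ _ h3, ← lintegral_const_mul' _ _ h3,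
      ← lintegral_add_right _ (hSc2 _), ← lintegral_add_left (hSc2 _), ← lintegral_add_right _
        (hSc3)]
    refine lintegral_congr fun c => ?_
    rw [← lintegral_const_mul' _ _ h3, ← lintegral_const_mul' _ _ h3,
      ← lintegral_add_right _ (hSc1 _ _), ← lintegral_add_left (hSc1 _ _), ← lintegral_add_right _
        (hSc4 _)]
    exact lintegral_congr fun d => e1 c d
  have hv : sqMaxIntegral (a + 2 * b) + 3 * sqMaxIntegral (-a) -
      (3 * sqMaxIntegral b + sqMaxIntegral (-(2 * a) - b)) =
      b ^ 2 + 4 * a * b + a ^ 2 - 4 + 3 * Real.exp (-a) + 3 * Real.exp (-b)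
      - Real.exp (-a) * Real.exp (-(2 * b)) - Real.exp (-(2 * a)) * Real.exp (-b) := by
    simp only [sqMaxIntegral]
    rw [if_neg (by linarith), if_pos (by linarith), if_neg (by linarith), if_pos (by linarith),
      ← Real.exp_add, ← Real.exp_add, show -(a + 2 * b) = -a + -(2 * b) by ring,
      show -(2 * a) - b = -(2 * a) + -b by ring]
    ring
  rw [← hv]
  have hB := add_nonneg (mul_nonneg zero_le_three (hpos b)) (hpos (-(2 * a) - b))
  have hA := add_nonneg (hpos (a + 2 * b)) (mul_nonneg zero_le_three (hpos (-a)))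
  have hle : 0 ≤ sqMaxIntegral (a + 2 * b) + 3 * sqMaxIntegral (-a) -
      (3 * sqMaxIntegral b + sqMaxIntegral (-(2 * a) - b)) := by
    have : ENNReal.ofReal (3 * sqMaxIntegral b + sqMaxIntegral (-(2 * a) - b)) ≤
        ENNReal.ofReal (sqMaxIntegral (a + 2 * b) + 3 * sqMaxIntegral (-a)) := by
      rw [← e2]
      exact le_add_self
    rw [ENNReal.ofReal_le_ofReal_iff hA] at this
    linarith
  refine ⟨?_, by linarith⟩
  have e3 := ENNReal.eq_sub_of_add_eq ENNReal.ofReal_ne_top e2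
  rw [← ENNReal.ofReal_sub _ hB] at e3
  have e4 : ∀ c d : ℝ, ENNReal.ofReal (Real.exp (-c - d) *
      quadArea (a + 2 * b + (d - c)) (2 * a + b - (d - c))) = ENNReal.ofReal (1 / 4) *
      ENNReal.ofReal (4 * (Real.exp (-c - d) *
      quadArea (a + 2 * b + (d - c)) (2 * a + b - (d - c)))) := by
    intro c d
    rw [← ENNReal.ofReal_mul (by norm_num)]
    congr 1
    ring
  simp only [e4]
  simp only [lintegral_const_mul' _ _ (ENNReal.ofReal_ne_top (r := 1 / 4))]
  rw [e3, ← ENNReal.ofReal_mul (by norm_num)]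
  congr 1
  ring

theorem lintegral_exp_outer : ∫⁻ a in Ioi (0 : ℝ), ∫⁻ b in Ioi (0 : ℝ),
    ENNReal.ofReal (Real.exp (-(2 * a)) * Real.exp (-(2 * b)) *
      ((b ^ 2 + 4 * a * b + a ^ 2 - 4 + 3 * Real.exp (-a) + 3 * Real.exp (-b)
      - Real.exp (-a) * Real.exp (-(2 * b)) - Real.exp (-(2 * a)) * Real.exp (-b)) / 4)) =
    ENNReal.ofReal (1 / 12) := by
  have hexp2 : ∀ x : ℝ, Real.exp (-(2 * x)) = Real.exp (-x) ^ 2 := fun x => by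
    rw [← Real.exp_nat_mul]
    congr 1
    push_cast
    ring
  have hexpn : ∀ (n : ℕ) (x : ℝ), Real.exp (-(n * x)) = Real.exp (-x) ^ n := fun n x => by
    rw [← Real.exp_nat_mul]
    congr 1
    ring
  have hexp3 : ∀ x : ℝ, Real.exp (-(3 * x)) = Real.exp (-x) ^ 3 := fun x => by
    simpa using hexpn 3 x
  have hexp4 : ∀ x : ℝ, Real.exp (-(4 * x)) = Real.exp (-x) ^ 4 := fun x => by
    simpa using hexpn 4 x
  have hE : ∀ x : ℝ, HasDerivAt (fun x : ℝ => Real.exp (-x)) (-Real.exp (-x)) x := fun x => by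
    simpa using (hasDerivAt_neg x).exp
  have hin : ∀ a ∈ Ioi (0 : ℝ), ∫⁻ b in Ioi (0 : ℝ),
      ENNReal.ofReal (Real.exp (-(2 * a)) * Real.exp (-(2 * b)) *
      ((b ^ 2 + 4 * a * b + a ^ 2 - 4 + 3 * Real.exp (-a) + 3 * Real.exp (-b)
      - Real.exp (-a) * Real.exp (-(2 * b)) - Real.exp (-(2 * a)) * Real.exp (-b)) / 4)) =
      ENNReal.ofReal (Real.exp (-(2 * a)) / 4 * (a ^ 2 / 2 + a - 3 / 4 + 5 / 4 * Real.exp (-a) -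
        Real.exp (-(2 * a)) / 3)) ∧ 0 ≤ Real.exp (-(2 * a)) / 4 * (a ^ 2 / 2 + a - 3 / 4 +
          5 / 4 * Real.exp (-a) - Real.exp (-(2 * a)) / 3) := by
    intro a ha
    set A := Real.exp (-a) with hA
    set k := a ^ 2 - 4 + 3 * A with hk
    -- An antiderivative in `b`: the integrand has terms decaying at rates 2, 3 and 4, and only
    -- those of rate 2 carry a polynomial factor, which is integrated by parts.
    set F : ℝ → ℝ := fun b => A ^ 2 / 4 * (-(Real.exp (-b) ^ 2 * (b ^ 2 / 2 + (4 * a + 1) / 2 * b +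
      (k + (4 * a + 1) / 2) / 2)) + A / 4 * Real.exp (-b) ^ 4 - Real.exp (-b) ^ 3
      + A ^ 2 / 3 * Real.exp (-b) ^ 3) with hF
    have hd : ∀ x ∈ Ici (0 : ℝ), HasDerivAt F (Real.exp (-(2 * a)) * Real.exp (-(2 * x)) *
      ((x ^ 2 + 4 * a * x + a ^ 2 - 4 + 3 * A + 3 * Real.exp (-x)
      - A * Real.exp (-(2 * x)) - Real.exp (-(2 * a)) * Real.exp (-x)) / 4)) x := by
      intro x _
      have h1 : HasDerivAt (fun b : ℝ => b ^ 2 / 2 + (4 * a + 1) / 2 * b +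
        (k + (4 * a + 1) / 2) / 2) (x + (4 * a + 1) / 2) x := by
        refine (((((hasDerivAt_id' x).pow 2).div_const 2).add
          ((hasDerivAt_id' x).const_mul ((4 * a + 1) / 2))).add_const _).congr_deriv ?_
        simp
      refine ((((((hE x).fun_pow 2).mul h1).neg.add (((hE x).fun_pow 4).const_mul (A / 4))).sub
        ((hE x).fun_pow 3)).add (((hE x).fun_pow 3).const_mul (A ^ 2 / 3))).const_mul
        (A ^ 2 / 4) |>.congr_deriv ?_
      simp only [hexp2, ← hA, hk]
      push_cast
      ring
    have hl : Tendsto F atTop (𝓝 0) := by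
      have l20 := tendsto_pow_mul_exp_neg_mul two_pos 0
      have l21 := tendsto_pow_mul_exp_neg_mul two_pos 1
      have l22 := tendsto_pow_mul_exp_neg_mul two_pos 2
      have l3 := tendsto_pow_mul_exp_neg_mul three_pos 0
      have l4 := tendsto_pow_mul_exp_neg_mul four_pos 0
      simp only [hexp2, hexp3, hexp4] at l20 l21 l22 l3 l4
      have := (((((l22.div_const 2).add (l21.const_mul ((4 * a + 1) / 2))).add
        (l20.const_mul ((k + (4 * a + 1) / 2) / 2))).neg.add (l4.const_mul (A / 4))).sub l3).add
        (l3.const_mul (A ^ 2 / 3)) |>.const_mul (A ^ 2 / 4)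
      simp only [zero_div, mul_zero, add_zero, neg_zero, sub_zero] at this
      refine this.congr fun x => ?_
      simp only [hF]
      ring
    have hpos : ∀ x ∈ Ioi (0 : ℝ), 0 ≤ Real.exp (-(2 * a)) * Real.exp (-(2 * x)) *
      ((x ^ 2 + 4 * a * x + a ^ 2 - 4 + 3 * A + 3 * Real.exp (-x)
      - A * Real.exp (-(2 * x)) - Real.exp (-(2 * a)) * Real.exp (-x)) / 4) := fun x hx =>
      mul_nonneg (by positivity) (lintegral_exp_mul_quadArea ha hx).2
    have h := lintegral_Ioi_of_hasDerivAt hd hpos hl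
    have hv : 0 - F 0 = Real.exp (-(2 * a)) / 4 * (a ^ 2 / 2 + a - 3 / 4 +
          5 / 4 * A - Real.exp (-(2 * a)) / 3) := by
      simp only [hF, hexp2, ← hA, hk]
      simp
      ring
    rwa [hv] at h
  rw [setLIntegral_congr_fun measurableSet_Ioi fun a ha => (hin a ha).1]
  set F : ℝ → ℝ := fun a => -(Real.exp (-a) ^ 2 * (a ^ 2 + 3 * a)) / 16 -
    5 / 48 * Real.exp (-a) ^ 3 + Real.exp (-a) ^ 4 / 48 with hF
  have hd : ∀ x ∈ Ici (0 : ℝ), HasDerivAt F (Real.exp (-(2 * x)) / 4 * (x ^ 2 / 2 + x - 3 / 4 +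
      5 / 4 * Real.exp (-x) - Real.exp (-(2 * x)) / 3)) x := by
    intro x _
    have h1 : HasDerivAt (fun a : ℝ => a ^ 2 + 3 * a) (2 * x + 3) x := by
      refine (((hasDerivAt_id' x).pow 2).add ((hasDerivAt_id' x).const_mul 3)).congr_deriv ?_
      simp
    refine ((((((hE x).fun_pow 2).mul h1).neg.div_const 16).sub (((hE x).fun_pow 3).const_mul (5 / 48))).add
      (((hE x).fun_pow 4).div_const 48)).congr_deriv ?_
    simp only [hexp2]
    push_cast
    ring
  have hl : Tendsto F atTop (𝓝 0) := by
    have l21 := tendsto_pow_mul_exp_neg_mul two_pos 1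
    have l22 := tendsto_pow_mul_exp_neg_mul two_pos 2
    have l3 := tendsto_pow_mul_exp_neg_mul three_pos 0
    have l4 := tendsto_pow_mul_exp_neg_mul four_pos 0
    simp only [hexp2, hexp3, hexp4] at l21 l22 l3 l4
    have := (((l22.add (l21.const_mul 3)).neg.div_const 16).sub (l3.const_mul (5 / 48))).add
      (l4.div_const 48)
    simp only [zero_div, mul_zero, add_zero, neg_zero, sub_zero] at this
    refine this.congr fun x => ?_
    simp only [hF]
    ring
  rw [(lintegral_Ioi_of_hasDerivAt hd (fun x hx => (hin x hx).2) hl).1]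
  congr 1
  simp only [hF]
  norm_num

end Volume

end ToricCubic

namespace ToricCubic

/-! ### The volume of the polytope -/

section Volume

open MeasureTheory Set Filter Topology
open scoped ENNReal Pointwise

/-- The exponents of the six mixed variables in the three monomials. -/
def expo : Fin 3 → Fin 6 → ℕ := ![![2, 2, 1, 1, 0, 0], ![1, 0, 2, 0, 2, 1], ![0, 1, 0, 2, 1, 2]]

/-- The linear form given by the exponents of the `i`-th monomial. -/
def expoForm (i : Fin 3) (t : Fin 6 → ℝ) : ℝ := ∑ j, (expo i j : ℝ) * t j

/-- The polytope `∑ j, expo i j * t j ≤ β i` in the orthant. -/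
def polytope (β : Fin 3 → ℝ) : Set (Fin 6 → ℝ) :=
  {t | (∀ j, 0 ≤ t j) ∧ ∀ i, expoForm i t ≤ β i}

/-- Lebesgue measure on the positive orthant of `ℝ⁶`. -/
noncomputable abbrev orthant : Measure (Fin 6 → ℝ) := Measure.pi fun _ => halfLine

theorem orthant_eq_restrict :
    orthant = volume.restrict (Set.pi univ fun _ : Fin 6 => Ioi (0 : ℝ)) := by
  rw [orthant, volume_pi, Measure.restrict_pi_pi]

theorem continuous_expoForm (i : Fin 3) : Continuous (expoForm i) := by
  unfold expoForm
  fun_prop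

theorem expoForm_smul (i : Fin 3) (s : ℝ) (t : Fin 6 → ℝ) :
    expoForm i (s • t) = s * expoForm i t := by
  simp only [expoForm, Pi.smul_apply, smul_eq_mul, Finset.mul_sum]
  exact Finset.sum_congr rfl fun j _ => by ring

theorem expoForm_nonneg (i : Fin 3) {t : Fin 6 → ℝ} (ht : ∀ j, 0 ≤ t j) : 0 ≤ expoForm i t :=
  Finset.sum_nonneg fun j _ => mul_nonneg (Nat.cast_nonneg _) (ht j)

theorem ae_orthant_pos : ∀ᵐ t ∂orthant, ∀ j, 0 < t j := by
  rw [orthant_eq_restrict]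
  filter_upwards [ae_restrict_mem (MeasurableSet.univ_pi fun _ => measurableSet_Ioi)] with t ht j
  exact ht j (mem_univ j)

theorem isClosed_polytope (β : Fin 3 → ℝ) : IsClosed (polytope β) := by
  have h : polytope β = (⋂ j, {t : Fin 6 → ℝ | 0 ≤ t j}) ∩ ⋂ i, {t | expoForm i t ≤ β i} := by
    ext t
    simp [polytope]
  rw [h]
  exact (isClosed_iInter fun j => isClosed_le continuous_const (continuous_apply j)).inter
    (isClosed_iInter fun i => isClosed_le (continuous_expoForm i) continuous_const)

/-- The region of `ℝ⁶` where the `i`-th form is the largest. -/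
def maxRegion (i : Fin 3) : Set (Fin 6 → ℝ) := {t | ∀ k, expoForm k t ≤ expoForm i t}

theorem measurableSet_maxRegion (i : Fin 3) : MeasurableSet (maxRegion i) := by
  have h : maxRegion i = ⋂ k, {t | expoForm k t ≤ expoForm i t} := by
    ext t
    simp [maxRegion]
  rw [h]
  exact MeasurableSet.iInter fun k =>
    (isClosed_le (continuous_expoForm k) (continuous_expoForm i)).measurableSet

/-- Two regions meet inside a hyperplane on which two distinct linear forms agree. -/
theorem aedisjoint_maxRegion : Pairwise (Function.onFun (AEDisjoint orthant) maxRegion) := by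
  intro i k hik
  have hsub : maxRegion i ∩ maxRegion k ⊆
      (LinearMap.ker (∑ j, ((expo i j : ℝ) - expo k j) • LinearMap.proj j :
        (Fin 6 → ℝ) →ₗ[ℝ] ℝ) : Set (Fin 6 → ℝ)) := by
    intro t ht
    have h := le_antisymm (ht.2 i) (ht.1 k)
    simp only [expoForm] at h
    simp [sub_mul, h]
  have hne : LinearMap.ker (∑ j, ((expo i j : ℝ) - expo k j) • LinearMap.proj j :
        (Fin 6 → ℝ) →ₗ[ℝ] ℝ) ≠ ⊤ := by
    intro h
    have hall : ∀ j, expo i j = expo k j := by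
      intro j
      have : (Pi.single j 1 : Fin 6 → ℝ) ∈ LinearMap.ker
        (∑ j, ((expo i j : ℝ) - expo k j) • LinearMap.proj j : (Fin 6 → ℝ) →ₗ[ℝ] ℝ) := by
        rw [h]; trivial
      simp [Pi.single_apply, sub_eq_zero] at this
      exact_mod_cast this
    have hdec : ∀ i k : Fin 3, i ≠ k → ¬ ∀ j, expo i j = expo k j := by decide
    exact hdec i k hik hall
  have h0 := Measure.addHaar_submodule (volume : Measure (Fin 6 → ℝ)) _ hne
  have h1 : orthant (maxRegion i ∩ maxRegion k) ≤ volume (maxRegion i ∩ maxRegion k) := by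
    rw [orthant_eq_restrict]
    exact Measure.restrict_apply_le _ _
  exact le_antisymm (h1.trans ((measure_mono hsub).trans h0.le)) bot_le

/-- The cyclic permutation of the coordinates that permutes the three forms. -/
def cyclicPerm : Equiv.Perm (Fin 6) where
  toFun := ![4, 2, 5, 0, 3, 1]
  invFun := ![3, 5, 1, 4, 0, 2]
  left_inv := by decide
  right_inv := by decide

theorem expoForm_comp_cyclicPerm (i : Fin 3) (t : Fin 6 → ℝ) :
    expoForm i (fun j => t (cyclicPerm j)) = expoForm (i + 1) t := by
  unfold expoForm
  rw [← Equiv.sum_comp cyclicPerm fun j => (expo (i + 1) j : ℝ) * t j]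
  have hdec : ∀ i j, expo i j = expo (i + 1) (cyclicPerm j) := by decide
  exact Finset.sum_congr rfl fun j _ => by rw [hdec i j]

theorem measurePreserving_cyclicPerm :
    MeasurePreserving (fun (t : Fin 6 → ℝ) j => t (cyclicPerm j)) orthant orthant := by
  have := measurePreserving_piCongrLeft (fun _ : Fin 6 => halfLine) cyclicPerm.symm
  have h : (fun (t : Fin 6 → ℝ) j => t (cyclicPerm j)) =
      MeasurableEquiv.piCongrLeft (fun _ => ℝ) cyclicPerm.symm := by
    ext t j
    rw [MeasurableEquiv.coe_piCongrLeft, Equiv.piCongrLeft_apply, eq_rec_constant,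
      Equiv.symm_symm]
  rw [h]
  exact this

/-- The cyclic permutation preserves the measure and moves each form to the next, so the three
regions contribute equally. -/
theorem lintegral_maxRegion_succ (i : Fin 3) :
    ∫⁻ t in maxRegion (i + 1), ENNReal.ofReal (Real.exp (-expoForm (i + 1) t)) ∂orthant =
      ∫⁻ t in maxRegion i, ENNReal.ofReal (Real.exp (-expoForm i t)) ∂orthant := by
  have hm : Measurable fun t => ENNReal.ofReal (Real.exp (-expoForm i t)) :=
    ((Real.continuous_exp.comp (continuous_expoForm i).neg).measurable).ennreal_ofReal
  rw [← lintegral_indicator (measurableSet_maxRegion _),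
    ← lintegral_indicator (measurableSet_maxRegion _),
    ← measurePreserving_cyclicPerm.lintegral_comp (hm.indicator (measurableSet_maxRegion i))]
  refine lintegral_congr fun t => ?_
  have hmem : (fun j => t (cyclicPerm j)) ∈ maxRegion i ↔ t ∈ maxRegion (i + 1) := by
    simp only [maxRegion, mem_ofPred_eq, expoForm_comp_cyclicPerm]
    exact ⟨fun h k => by simpa using h (k - 1), fun h k => h (k + 1)⟩
  by_cases ht : t ∈ maxRegion (i + 1)
  · rw [indicator_of_mem ht, indicator_of_mem (hmem.2 ht), expoForm_comp_cyclicPerm]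
  · rw [indicator_of_notMem ht, indicator_of_notMem (fun h => ht (hmem.1 h))]

/-- Call the coordinates a, b, c, d, p, r. The weight is `exp (-(2a + 2b + c + d))` and does not
involve p and r, which range over the quadrilateral of `lintegral_quadrilateral`. The six integrals
are therefore done in pairs: an area, then the integral over c and d, then the one over a and b. -/
theorem lintegral_maxRegion_zero :
    ∫⁻ t in maxRegion 0, ENNReal.ofReal (Real.exp (-expoForm 0 t)) ∂orthant =
      ENNReal.ofReal (1 / 12) := by
  have hm : Measurable fun t => ENNReal.ofReal (Real.exp (-expoForm 0 t)) :=
    ((Real.continuous_exp.comp (continuous_expoForm 0).neg).measurable).ennreal_ofReal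
  have hmi := hm.indicator (measurableSet_maxRegion 0)
  have hcons : ∀ (n : ℕ) (a : ℝ), Measurable fun y : Fin n → ℝ => (Fin.cons a y : Fin (n + 1) → ℝ) :=
    fun n a => measurable_cons.comp measurable_prodMk_left
  rw [← lintegral_indicator (measurableSet_maxRegion _), orthant, lintegral_pi_succ _ _ hmi]
  rw [← lintegral_exp_outer]
  refine setLIntegral_congr_fun measurableSet_Ioi fun a ha => ?_
  have m1 := hmi.comp (hcons 5 a)
  refine (lintegral_pi_succ _ _ m1).trans ?_
  refine setLIntegral_congr_fun measurableSet_Ioi fun b hb => ?_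
  have m2 := m1.comp (hcons 4 b)
  refine (lintegral_pi_succ _ _ m2).trans ?_
  rw [ENNReal.ofReal_mul (by positivity), ← (lintegral_exp_mul_quadArea ha hb).1,
    ← lintegral_const_mul' _ _ ENNReal.ofReal_ne_top]
  refine setLIntegral_congr_fun measurableSet_Ioi fun c hc => ?_
  have m3 := m2.comp (hcons 3 c)
  refine (lintegral_pi_succ _ _ m3).trans ?_
  rw [← lintegral_const_mul' _ _ ENNReal.ofReal_ne_top]
  refine setLIntegral_congr_fun measurableSet_Ioi fun d hd => ?_
  have m4 := m3.comp (hcons 2 d)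
  refine (lintegral_pi_succ _ _ m4).trans ?_
  have hab : 0 ≤ (a + 2 * b + (d - c)) + (2 * a + b - (d - c)) := by
    have : 0 < a := ha
    have : 0 < b := hb
    linarith
  rw [ENNReal.ofReal_mul (p := Real.exp (-c - d)) (by positivity),
    ← (lintegral_quadrilateral hab).1,
    ← mul_assoc, ← ENNReal.ofReal_mul (by positivity),
    ← lintegral_const_mul' _ _ ENNReal.ofReal_ne_top]
  refine setLIntegral_congr_fun measurableSet_Ioi fun p hp => ?_
  have m5 := m4.comp (hcons 1 p)
  refine (lintegral_pi_succ _ _ m5).trans ?_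
  rw [← lintegral_const_mul' _ _ ENNReal.ofReal_ne_top]
  refine setLIntegral_congr_fun measurableSet_Ioi fun r hr => ?_
  rw [Measure.pi_of_empty _ (fun i => i.elim0), lintegral_dirac]
  simp only [Function.comp]
  set t : Fin 6 → ℝ := Fin.cons a (Fin.cons b (Fin.cons c (Fin.cons d (Fin.cons p
    (Fin.cons r fun i => i.elim0))))) with ht
  have h0 : expoForm 0 t = 2 * a + 2 * b + c + d := by
    simp [expoForm, Fin.sum_univ_succ, ht, expo]
    ring
  have h1 : expoForm 1 t = a + 2 * c + 2 * p + r := by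
    simp [expoForm, Fin.sum_univ_succ, ht, expo]
    ring
  have h2 : expoForm 2 t = b + 2 * d + p + 2 * r := by
    simp [expoForm, Fin.sum_univ_succ, ht, expo]
    ring
  have hmem : t ∈ maxRegion 0 ↔ 2 * p + r ≤ a + 2 * b + (d - c) ∧
      p + 2 * r ≤ 2 * a + b - (d - c) := by
    simp only [maxRegion, mem_ofPred_eq, Fin.forall_fin_succ, Fin.succ_zero_eq_one,
      Fin.succ_one_eq_two, h0, h1, h2]
    constructor
    · rintro ⟨-, h1, h2, -⟩
      constructor <;> linarith
    · rintro ⟨h1, h2⟩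
      exact ⟨le_rfl, by linarith, by linarith, fun i => i.elim0⟩
  by_cases h : t ∈ maxRegion 0
  · rw [indicator_of_mem h, indicator_of_mem (by exact hmem.1 h), h0]
    simp [← Real.exp_add]
    congr 2
    ring
  · rw [indicator_of_notMem h, indicator_of_notMem (by exact fun h' => h (hmem.2 h'))]
    simp

theorem lintegral_exp_max :
    ∫⁻ t, ENNReal.ofReal (Real.exp (-(Finset.univ.sup' Finset.univ_nonempty
      fun i => expoForm i t))) ∂orthant = ENNReal.ofReal (1 / 4) := by
  have hcov : (⋃ i, maxRegion i) = univ := by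
    ext t
    simp only [mem_iUnion, mem_univ, iff_true, maxRegion, mem_ofPred_eq]
    obtain ⟨i, -, hi⟩ := Finset.exists_max_image Finset.univ (fun i => expoForm i t)
      Finset.univ_nonempty
    exact ⟨i, fun k => hi k (Finset.mem_univ k)⟩
  rw [← setLIntegral_univ, ← hcov, lintegral_iUnion₀
    (fun i => (measurableSet_maxRegion i).nullMeasurableSet) aedisjoint_maxRegion]
  have hpiece : ∀ i, ∫⁻ t in maxRegion i, ENNReal.ofReal (Real.exp (-(Finset.univ.sup'
      Finset.univ_nonempty fun i => expoForm i t))) ∂orthant =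
      ∫⁻ t in maxRegion i, ENNReal.ofReal (Real.exp (-expoForm i t)) ∂orthant := by
    intro i
    refine setLIntegral_congr_fun (measurableSet_maxRegion i) fun t ht => ?_
    rw [le_antisymm (Finset.sup'_le _ _ fun k _ => ht k)
      (Finset.le_sup' (fun i => expoForm i t) (Finset.mem_univ i))]
  have h1 := lintegral_maxRegion_succ 0
  have h2 := lintegral_maxRegion_succ 1
  rw [tsum_fintype, Fin.sum_univ_three]
  simp only [hpiece]
  rw [show (2 : Fin 3) = 1 + 1 by rfl, h2, show (1 : Fin 3) = 0 + 1 by rfl, h1,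
    lintegral_maxRegion_zero, ← ENNReal.ofReal_add (by norm_num) (by norm_num),
    ← ENNReal.ofReal_add (by norm_num) (by norm_num)]
  norm_num

theorem orthant_polytope_const {s : ℝ} (hs : 0 < s) :
    orthant (polytope fun _ => s) = ENNReal.ofReal (s ^ 6) * orthant (polytope fun _ => 1) := by
  have hO : ∀ β, orthant (polytope β) = volume (polytope β) := by
    intro β
    have hor : orthant = volume.restrict (Set.pi univ fun _ : Fin 6 => Ici (0 : ℝ)) := by
      rw [orthant_eq_restrict, volume_pi, Measure.restrict_pi_pi, Measure.restrict_pi_pi]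
      congr 1
      ext1 j
      exact Measure.restrict_congr_set Ioi_ae_eq_Ici
    rw [hor, Measure.restrict_apply (isClosed_polytope β).measurableSet, inter_eq_left.2]
    exact fun t ht j _ => ht.1 j
  have h : (polytope fun _ => s) = s • polytope fun _ => 1 := by
    ext t
    rw [mem_smul_set_iff_inv_smul_mem₀ hs.ne']
    simp only [polytope, mem_ofPred_eq, Pi.smul_apply, smul_eq_mul, expoForm_smul,
      inv_mul_le_iff₀ hs, mul_one]
    simp only [mul_nonneg_iff_of_pos_left (inv_pos.2 hs)]
  rw [hO, hO, h, Measure.addHaar_smul]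
  simp [abs_of_pos hs]

/-- Let m be the maximum of the three forms. Writing exp(-m) as the integral of exp(-s) over s ≥ m
and exchanging the integrals gives, by homogeneity of degree 6, ∫ exp(-m) = Γ(7) · vol. The left
side is 3 · 1/12 = 1/4 and Γ(7) = 720. This avoids a decomposition of the polytope itself. -/
theorem orthant_polytope_one : orthant (polytope fun _ => 1) = ENNReal.ofReal (1 / 2880) := by
  set m : (Fin 6 → ℝ) → ℝ := fun t => Finset.univ.sup' Finset.univ_nonempty fun i => expoForm i t
    with hm
  have hmc : Continuous m := by
    have : m = Finset.univ.sup' Finset.univ_nonempty expoForm := by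
      ext t
      rw [Finset.sup'_apply]
    rw [this]
    exact Continuous.finset_sup' _ fun i _ => continuous_expoForm i
  have h1 : ∀ᵐ t ∂orthant, ENNReal.ofReal (Real.exp (-m t)) =
      ∫⁻ s in Ioi (0 : ℝ), {q : (Fin 6 → ℝ) × ℝ | m q.1 ≤ q.2}.indicator
        (fun q => ENNReal.ofReal (Real.exp (-q.2))) (t, s) := by
    filter_upwards [ae_orthant_pos] with t ht
    have hm0 : 0 ≤ m t := (expoForm_nonneg 0 fun j => (ht j).le).trans
      (Finset.le_sup' (fun i => expoForm i t) (Finset.mem_univ 0))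
    have e : ∀ s, {q : (Fin 6 → ℝ) × ℝ | m q.1 ≤ q.2}.indicator
        (fun q => ENNReal.ofReal (Real.exp (-q.2))) (t, s) =
        (Ici (m t)).indicator (fun s => ENNReal.ofReal (Real.exp (-s))) s := fun s => rfl
    simp only [e]
    rw [lintegral_indicator measurableSet_Ici, Measure.restrict_restrict measurableSet_Ici,
      Measure.restrict_congr_set (t := Ioi (m t))]
    · rw [(lintegral_Ioi_of_hasDerivAt (F := fun x => -Real.exp (-x)) (fun x _ => by
        simpa using (hasDerivAt_neg x).exp.fun_neg) (fun x _ => (Real.exp_pos _).le)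
        (l := 0) (by simpa using! Real.tendsto_exp_neg_atTop_nhds_zero.neg)).1]
      simp
    · rcases hm0.eq_or_lt with h0 | h0
      · rw [← h0, inter_eq_right.2 Ioi_subset_Ici_self]
        exact ae_eq_refl _
      · rw [inter_eq_left.2 (Ici_subset_Ioi.2 h0)]
        exact Ioi_ae_eq_Ici.symm
  have h2 := lintegral_exp_max
  rw [lintegral_congr_ae h1, lintegral_lintegral_swap] at h2
  · have h3 : ∀ s ∈ Ioi (0 : ℝ), ∫⁻ t, {q : (Fin 6 → ℝ) × ℝ | m q.1 ≤ q.2}.indicator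
        (fun q => ENNReal.ofReal (Real.exp (-q.2))) (t, s) ∂orthant =
        ENNReal.ofReal (Real.exp (-s) * s ^ (7 - 1 : ℝ)) * orthant (polytope fun _ => 1) := by
      intro s hs
      have e : ∀ t, {q : (Fin 6 → ℝ) × ℝ | m q.1 ≤ q.2}.indicator
        (fun q => ENNReal.ofReal (Real.exp (-q.2))) (t, s) =
        {t | m t ≤ s}.indicator (fun _ => ENNReal.ofReal (Real.exp (-s))) t := fun t => rfl
      simp only [e]
      rw [lintegral_indicator_const (isClosed_le hmc continuous_const).measurableSet,
        measure_congr (t := polytope fun _ => s), orthant_polytope_const hs, ← mul_assoc,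
        ← ENNReal.ofReal_mul (Real.exp_pos _).le]
      · norm_num
      · filter_upwards [ae_orthant_pos] with t ht
        refine propext ⟨fun h => ⟨fun j => (ht j).le, fun i =>
          (Finset.le_sup' (fun i => expoForm i t) (Finset.mem_univ i)).trans h⟩,
          fun h => Finset.sup'_le _ _ fun i _ => h.2 i⟩
    rw [setLIntegral_congr_fun measurableSet_Ioi h3, lintegral_mul_const _ (by fun_prop),
      ← ofReal_integral_eq_lintegral_ofReal (Real.GammaIntegral_convergent (by norm_num))
        ((ae_restrict_mem measurableSet_Ioi).mono fun x hx => by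
          have : 0 < x := hx
          positivity), ← Real.Gamma_eq_integral (by norm_num)] at h2
    have hG : Real.Gamma 7 = 720 := by
      rw [show (7 : ℝ) = (6 : ℕ) + 1 by norm_num, Real.Gamma_nat_eq_factorial]
      norm_num [Nat.factorial]
    rw [hG] at h2
    have h4 : ENNReal.ofReal (1 / 4) = ENNReal.ofReal 720 * ENNReal.ofReal (1 / 2880) := by
      rw [← ENNReal.ofReal_mul (by norm_num)]
      norm_num
    rw [h4] at h2
    exact (ENNReal.mul_right_inj (by norm_num) ENNReal.ofReal_ne_top).1 h2
  · refine Measurable.aemeasurable ?_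
    have hset : MeasurableSet {q : (Fin 6 → ℝ) × ℝ | m q.1 ≤ q.2} :=
      (isClosed_le (hmc.comp continuous_fst) continuous_snd).measurableSet
    exact (by fun_prop : Measurable fun q : (Fin 6 → ℝ) × ℝ =>
      ENNReal.ofReal (Real.exp (-q.2))).indicator hset

end Volume

end ToricCubic

/-! ### Abel summation from a linear counting function -/

namespace ToricCubic

/-- A positive integer valued norm with `#{a | N a ≤ X} = κ X + O(√X)`. -/
structure HasLinearCount {A : Type*} (N : A → ℕ) (κ : ℝ) : Prop where
  pos : ∀ a, 0 < N a
  finite : ∀ X : ℝ, {a | (N a : ℝ) ≤ X}.Finite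
  density_pos : 0 < κ
  bound : ∃ C : ℝ, ∀ X : ℝ, 1 ≤ X → |({a | (N a : ℝ) ≤ X}.ncard : ℝ) - κ * X| ≤ C * √X

namespace HasLinearCount

open MeasureTheory Set
open scoped ENNReal

variable {A : Type*} {N : A → ℕ} {κ : ℝ}

/-- The finite set of elements of norm at most `X`. -/
noncomputable def ball (h : HasLinearCount N κ) (X : ℝ) : Finset A := (h.finite X).toFinset

@[simp]
theorem mem_ball (h : HasLinearCount N κ) {X : ℝ} {a : A} : a ∈ h.ball X ↔ (N a : ℝ) ≤ X := by
  simp [ball]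

theorem one_le (h : HasLinearCount N κ) (a : A) : (1 : ℝ) ≤ N a := by
  exact_mod_cast h.pos a

theorem ball_eq_empty (h : HasLinearCount N κ) {X : ℝ} (hX : X < 1) : h.ball X = ∅ := by
  rw [Finset.eq_empty_iff_forall_notMem]
  intro a ha
  have := h.one_le a
  rw [mem_ball] at ha
  linarith

theorem exists_card_bound (h : HasLinearCount N κ) :
    ∃ C : ℝ, 0 ≤ C ∧ ∀ X : ℝ, 1 ≤ X → |((h.ball X).card : ℝ) - κ * X| ≤ C * √X := by
  obtain ⟨C, hC⟩ := h.bound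
  refine ⟨max C 0, le_max_right _ _, fun X hX => ?_⟩
  have := hC X hX
  rw [Set.ncard_eq_toFinset_card _ (h.finite X)] at this
  exact this.trans (mul_le_mul_of_nonneg_right (le_max_left _ _) (Real.sqrt_nonneg _))

theorem exists_card_le (h : HasLinearCount N κ) :
    ∃ C : ℝ, 0 ≤ C ∧ ∀ X : ℝ, 1 ≤ X → ((h.ball X).card : ℝ) ≤ C * X := by
  obtain ⟨C, hC0, hC⟩ := h.exists_card_bound
  refine ⟨κ + C, add_nonneg h.density_pos.le hC0, fun X hX => ?_⟩
  have h1 := (abs_le.1 (hC X hX)).2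
  have h2 : √X ≤ X := by
    rw [Real.sqrt_le_left (by linarith)]
    nlinarith
  nlinarith

theorem measurable_card_ball (h : HasLinearCount N κ) :
    Measurable fun t : ℝ => ((h.ball t).card : ℝ) := by
  refine Monotone.measurable fun s t hst => ?_
  exact_mod_cast Finset.card_le_card fun a ha => by
    rw [mem_ball] at ha ⊢
    exact ha.trans hst

/-- Abel summation: grouping elements by the value of the norm reduces it to
`sum_mul_eq_sub_integral_mul₀` on the natural numbers. -/
theorem sum_ball_eq (h : HasLinearCount N κ) {f : ℝ → ℝ} {X : ℝ} (hX : 1 ≤ X)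
    (hf : ∀ t ∈ Icc 1 X, DifferentiableAt ℝ f t) (hfi : IntegrableOn (deriv f) (Icc 1 X)) :
    ∑ a ∈ h.ball X, f (N a) =
      f X * (h.ball X).card - ∫ t in Ioc 1 X, deriv f t * (h.ball t).card := by
  classical
  set c : ℕ → ℝ := fun k => ((h.ball k).filter fun a => N a = k).card with hc
  have hmaps : ∀ t : ℝ, 1 ≤ t → ∀ a ∈ h.ball t, N a ∈ Finset.Icc 0 ⌊t⌋₊ := by
    intro t ht a ha
    rw [mem_ball] at ha
    exact Finset.mem_Icc.2 ⟨Nat.zero_le _, Nat.le_floor ha⟩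
  have hfib : ∀ t : ℝ, 1 ≤ t → ∀ k ∈ Finset.Icc 0 ⌊t⌋₊,
      ((h.ball t).filter fun a => N a = k) = (h.ball k).filter fun a => N a = k := by
    intro t ht k hk
    ext a
    simp only [Finset.mem_filter, mem_ball]
    constructor
    · rintro ⟨h1, rfl⟩
      exact ⟨le_rfl, rfl⟩
    · rintro ⟨h1, rfl⟩
      exact ⟨(Nat.le_floor_iff (by linarith)).1 (Finset.mem_Icc.1 hk).2, rfl⟩
  have hsum : ∀ t : ℝ, 1 ≤ t → ∑ k ∈ Finset.Icc 0 ⌊t⌋₊, c k = (h.ball t).card := by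
    intro t ht
    rw [Finset.card_eq_sum_card_fiberwise (hmaps t ht)]
    push_cast
    exact Finset.sum_congr rfl fun k hk => by rw [hfib t ht k hk]
  have hc0 : c 0 = 0 := by
    simp only [hc, Nat.cast_eq_zero, Finset.card_eq_zero, Finset.filter_eq_empty_iff]
    exact fun a _ => (h.pos a).ne'
  have key := sum_mul_eq_sub_integral_mul₀ (f := f) c hc0 X hf hfi
  rw [hsum X hX] at key
  rw [← Finset.sum_fiberwise_of_maps_to (hmaps X hX)]
  have e1 : ∀ k ∈ Finset.Icc 0 ⌊X⌋₊, ∑ a ∈ (h.ball X).filter (fun a => N a = k), f (N a) =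
      f k * c k := by
    intro k hk
    rw [Finset.sum_congr rfl fun a ha => by rw [(Finset.mem_filter.1 ha).2], Finset.sum_const,
      hfib X hX k hk, nsmul_eq_mul, mul_comm]
  rw [Finset.sum_congr rfl e1, key]
  congr 1
  exact setIntegral_congr_fun measurableSet_Ioc fun t ht => by
    rw [hsum t ht.1.le]

theorem exists_sum_inv_bound (h : HasLinearCount N κ) :
    ∃ C : ℝ, 0 ≤ C ∧ ∀ X : ℝ, 1 ≤ X →
      |∑ a ∈ h.ball X, (N a : ℝ)⁻¹ - κ * Real.log X| ≤ C := by
  obtain ⟨C, hC0, hC⟩ := h.exists_card_bound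
  -- `κ + C` bounds the boundary term; `2 * C` comes from the counting error `C√t`, since the
  -- integral of `t ^ (-3/2)` over `[1, ∞)` is 2.
  refine ⟨κ + C + 2 * C, by have := h.density_pos; positivity, fun X hX => ?_⟩
  have hne : ∀ t ∈ Icc 1 X, t ≠ 0 := fun t ht => by linarith [ht.1]
  have hder : ∀ t : ℝ, deriv (fun x : ℝ => x⁻¹) t = -(t ^ 2)⁻¹ := fun t => deriv_inv
  have hci : ContinuousOn (fun t : ℝ => -(t ^ 2)⁻¹) (Icc 1 X) :=
    ((continuousOn_id.pow 2).inv₀ fun t ht => pow_ne_zero 2 (hne t ht)).neg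
  rw [h.sum_ball_eq (f := fun x => x⁻¹) hX (fun t ht => differentiableAt_inv (hne t ht))
    (by simp only [funext hder]; exact hci.integrableOn_Icc)]
  simp only [hder]
  have hX0 : 0 < X := by linarith
  have hrpow : ∫ t in Ioc 1 X, t ^ (-(3 / 2) : ℝ) ≤ 2 := by
    rw [← intervalIntegral.integral_of_le hX, integral_rpow (Or.inr ⟨by norm_num, by
      rw [uIcc_of_le hX]; exact fun h0 => by linarith [h0.1]⟩)]
    have : 0 ≤ X ^ (-(3 / 2) + 1 : ℝ) := by positivity
    rw [Real.one_rpow, div_le_iff_of_neg (by norm_num)]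
    linarith
  have hlog : ∫ t in Ioc 1 X, κ * t⁻¹ = κ * Real.log X := by
    rw [← intervalIntegral.integral_of_le hX, intervalIntegral.integral_const_mul,
      integral_inv_of_pos one_pos hX0, div_one]
  have hi1 : IntegrableOn (fun t : ℝ => κ * t⁻¹) (Ioc 1 X) :=
    ((continuousOn_const.mul (continuousOn_id.inv₀ hne)).integrableOn_Icc).mono_set
      Ioc_subset_Icc_self
  have hi2 : IntegrableOn (fun t : ℝ => t ^ (-(3 / 2) : ℝ)) (Ioc 1 X) :=
    ((continuousOn_id.rpow_const fun t ht => Or.inl (hne t ht)).integrableOn_Icc).mono_set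
      Ioc_subset_Icc_self
  have hbd : ∀ t ∈ Ioc 1 X, ‖(t ^ 2)⁻¹ * ((h.ball t).card : ℝ) - κ * t⁻¹‖ ≤
      C * t ^ (-(3 / 2) : ℝ) := by
    intro t ht
    have ht0 : 0 < t := by linarith [ht.1]
    have e : (t ^ 2)⁻¹ * ((h.ball t).card : ℝ) - κ * t⁻¹ =
        (t ^ 2)⁻¹ * (((h.ball t).card : ℝ) - κ * t) := by
      field_simp
    rw [e, norm_mul, Real.norm_eq_abs, Real.norm_eq_abs, abs_of_pos (by positivity)]
    refine (mul_le_mul_of_nonneg_left (hC t ht.1.le) (by positivity)).trans_eq ?_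
    rw [Real.sqrt_eq_rpow, ← Real.rpow_natCast, ← Real.rpow_neg ht0.le, mul_left_comm,
      ← Real.rpow_add ht0]
    norm_num
  have hm : AEStronglyMeasurable (fun t : ℝ => (t ^ 2)⁻¹ * ((h.ball t).card : ℝ) - κ * t⁻¹)
      (volume.restrict (Ioc 1 X)) := by
    have := h.measurable_card_ball
    exact (by fun_prop : Measurable fun t : ℝ =>
      (t ^ 2)⁻¹ * ((h.ball t).card : ℝ) - κ * t⁻¹).aestronglyMeasurable
  have hi3 : IntegrableOn (fun t : ℝ => (t ^ 2)⁻¹ * ((h.ball t).card : ℝ) - κ * t⁻¹) (Ioc 1 X) :=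
    (hi2.const_mul C).mono' hm ((ae_restrict_mem measurableSet_Ioc).mono hbd)
  have e1 : ∫ t in Ioc 1 X, -(t ^ 2)⁻¹ * ((h.ball t).card : ℝ) =
      -(∫ t in Ioc 1 X, ((t ^ 2)⁻¹ * ((h.ball t).card : ℝ) - κ * t⁻¹)) - κ * Real.log X := by
    rw [← hlog, ← integral_neg, ← integral_sub (f := fun t : ℝ =>
      -((t ^ 2)⁻¹ * ((h.ball t).card : ℝ) - κ * t⁻¹)) hi3.neg hi1]
    exact integral_congr_ae (Filter.Eventually.of_forall fun t => by simp)
  have e2 : |∫ t in Ioc 1 X, ((t ^ 2)⁻¹ * ((h.ball t).card : ℝ) - κ * t⁻¹)| ≤ 2 * C := by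
    rw [← Real.norm_eq_abs]
    refine (norm_integral_le_of_norm_le (hi2.const_mul C)
      ((ae_restrict_mem measurableSet_Ioc).mono hbd)).trans ?_
    rw [integral_const_mul]
    nlinarith
  have e3 : |X⁻¹ * ((h.ball X).card : ℝ)| ≤ κ + C := by
    have h1 := (abs_le.1 (hC X hX)).2
    have h2 : √X ≤ X := by
      rw [Real.sqrt_le_left (by linarith)]
      nlinarith
    rw [abs_of_nonneg (by positivity), inv_mul_le_iff₀ hX0]
    nlinarith
  rw [e1]
  have := abs_add_le (X⁻¹ * ((h.ball X).card : ℝ))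
    (∫ t in Ioc 1 X, ((t ^ 2)⁻¹ * ((h.ball t).card : ℝ) - κ * t⁻¹))
  calc _ = |X⁻¹ * ((h.ball X).card : ℝ) +
      ∫ t in Ioc 1 X, ((t ^ 2)⁻¹ * ((h.ball t).card : ℝ) - κ * t⁻¹)| := by
        congr 1
        ring
    _ ≤ _ := by linarith

theorem exists_sum_rpow_bound (h : HasLinearCount N κ) :
    ∃ C : ℝ, 0 ≤ C ∧ ∀ X : ℝ, 0 < X →
      ∑ a ∈ h.ball X, (N a : ℝ) ^ (-(2 / 3) : ℝ) ≤ C * X ^ (1 / 3 : ℝ) := by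
  obtain ⟨C, hC0, hC⟩ := h.exists_card_le
  -- The boundary term gives `C` and the integral gives `2/3 * C * 3`.
  refine ⟨3 * C, by positivity, fun X hX0 => ?_⟩
  rcases lt_or_ge X 1 with hX | hX
  · rw [h.ball_eq_empty hX]
    simp only [Finset.sum_empty]
    positivity
  have hne : ∀ t ∈ Icc 1 X, t ≠ 0 := fun t ht => by linarith [ht.1]
  have hder : ∀ t : ℝ, t ≠ 0 → deriv (fun x : ℝ => x ^ (-(2 / 3) : ℝ)) t =
      -(2 / 3) * t ^ (-(5 / 3) : ℝ) := fun t ht => by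
    rw [Real.deriv_rpow_const]
    norm_num
  have hi2 : IntegrableOn (fun t : ℝ => t ^ (-(2 / 3) : ℝ)) (Ioc 1 X) :=
    ((continuousOn_id.rpow_const fun t ht => Or.inl (hne t ht)).integrableOn_Icc).mono_set
      Ioc_subset_Icc_self
  rw [h.sum_ball_eq (f := fun x => x ^ (-(2 / 3) : ℝ)) hX
    (fun t ht => Real.differentiableAt_rpow_const_of_ne _ (hne t ht)) ?_]
  · have h1 : X ^ (-(2 / 3) : ℝ) * ((h.ball X).card : ℝ) ≤ C * X ^ (1 / 3 : ℝ) := by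
      refine (mul_le_mul_of_nonneg_left (hC X hX) (by positivity)).trans_eq ?_
      rw [mul_left_comm, ← Real.rpow_add_one hX0.ne']
      norm_num
    have hrpow : ∫ t in Ioc 1 X, t ^ (-(2 / 3) : ℝ) ≤ 3 * X ^ (1 / 3 : ℝ) := by
      rw [← intervalIntegral.integral_of_le hX, integral_rpow (Or.inl (by norm_num))]
      norm_num
      linarith
    have h2 : ‖∫ t in Ioc 1 X, deriv (fun x : ℝ => x ^ (-(2 / 3) : ℝ)) t * (h.ball t).card‖ ≤
        ∫ t in Ioc 1 X, 2 / 3 * C * t ^ (-(2 / 3) : ℝ) := by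
      refine norm_integral_le_of_norm_le (hi2.const_mul _)
        ((ae_restrict_mem measurableSet_Ioc).mono fun t ht => ?_)
      have ht0 : 0 < t := by linarith [ht.1]
      rw [hder t ht0.ne', norm_mul, norm_mul, Real.norm_eq_abs, Real.norm_eq_abs,
        Real.norm_eq_abs, abs_of_nonneg (by positivity : 0 ≤ t ^ (-(5 / 3) : ℝ)),
        abs_of_nonneg (by positivity : (0 : ℝ) ≤ (h.ball t).card)]
      refine (mul_le_mul_of_nonneg_left (hC t ht.1.le) (by positivity)).trans_eq ?_
      have : t ^ (-(5 / 3) : ℝ) * t = t ^ (-(2 / 3) : ℝ) := by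
        rw [← Real.rpow_add_one ht0.ne']
        norm_num
      rw [← this]
      norm_num
      ring
    rw [integral_const_mul] at h2
    have h3 := (abs_le.1 ((Real.norm_eq_abs _) ▸ h2)).1
    nlinarith
  · refine IntegrableOn.congr_fun (f := fun t : ℝ => -(2 / 3) * t ^ (-(5 / 3) : ℝ)) ?_
      (fun t ht => (hder t (hne t ht)).symm) measurableSet_Icc
    exact (continuousOn_const.mul (continuousOn_id.rpow_const
      fun t ht => Or.inl (hne t ht))).integrableOn_Icc

end HasLinearCount

end ToricCubic

/-! ### Weighted sums over six-tuples as measures of polytopes -/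

namespace ToricCubic

namespace HasLinearCount

open MeasureTheory Set
open scoped ENNReal

variable {A : Type*} {N : A → ℕ} {κ : ℝ}

theorem countable (h : HasLinearCount N κ) : Countable A := by
  rw [← Set.countable_univ_iff]
  have : (univ : Set A) = ⋃ n : ℕ, {a | (N a : ℝ) ≤ n} := by
    ext a
    simp only [mem_univ, mem_iUnion, true_iff]
    exact ⟨N a, le_refl (N a : ℝ)⟩
  rw [this]
  exact countable_iUnion fun n => (h.finite n).countable

/-- The measure `∑ a, δ_a / N a`. -/
noncomputable def weightMeasure (N : A → ℕ) [MeasurableSpace A] : Measure A :=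
  Measure.count.withDensity fun a => ENNReal.ofReal (N a : ℝ)⁻¹

theorem weightMeasure_coe [MeasurableSpace A] [MeasurableSingletonClass A] (s : Finset A) :
    weightMeasure N s = ENNReal.ofReal (∑ a ∈ s, (N a : ℝ)⁻¹) := by
  rw [weightMeasure, withDensity_apply _ s.measurableSet,
    ENNReal.ofReal_sum_of_nonneg fun a _ => by positivity]
  have := lintegral_finset s (fun a => ENNReal.ofReal (N a : ℝ)⁻¹) (μ := Measure.count)
  simpa using this

theorem log_le_iff (h : HasLinearCount N κ) (a : A) (t : ℝ) :
    Real.log (N a) ≤ t ↔ a ∈ h.ball (Real.exp t) := by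
  rw [mem_ball, Real.log_le_iff_le_exp (by linarith [h.one_le a])]

theorem map_weightMeasure_Icc (h : HasLinearCount N κ) [MeasurableSpace A]
    [DiscreteMeasurableSpace A] (t : ℝ) :
    (weightMeasure N).map (fun a => Real.log (N a)) (Icc 0 t) =
      ENNReal.ofReal (∑ a ∈ h.ball (Real.exp t), (N a : ℝ)⁻¹) := by
  rw [Measure.map_apply (Measurable.of_discrete) measurableSet_Icc, ← weightMeasure_coe]
  congr 1
  ext a
  simp only [mem_preimage, mem_Icc, h.log_le_iff, Finset.mem_coe, and_iff_right_iff_imp]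
  exact fun _ => Real.log_nonneg (h.one_le a)

theorem sigmaFinite_map_weightMeasure (h : HasLinearCount N κ) [MeasurableSpace A]
    [DiscreteMeasurableSpace A] :
    SigmaFinite ((weightMeasure N).map fun a => Real.log (N a)) := by
  refine ⟨⟨⟨fun n => Iic (n : ℝ), fun n => trivial, fun n => ?_, ?_⟩⟩⟩
  · have : (weightMeasure N).map (fun a => Real.log (N a)) (Iic (n : ℝ)) =
        (weightMeasure N).map (fun a => Real.log (N a)) (Icc 0 (n : ℝ)) := by
      rw [Measure.map_apply Measurable.of_discrete measurableSet_Iic,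
        Measure.map_apply Measurable.of_discrete measurableSet_Icc]
      congr 1
      ext a
      simp [Real.log_nonneg (h.one_le a)]
    rw [this, h.map_weightMeasure_Icc]
    exact ENNReal.ofReal_lt_top
  · ext x
    simpa using exists_nat_ge x

/-- Lebesgue measure on the half-line with constant density. -/
theorem pi_smul_halfLine {c : ℝ≥0∞} [SigmaFinite (c • halfLine)] (n : ℕ) :
    (Measure.pi fun _ : Fin n => c • halfLine) = c ^ n • Measure.pi fun _ : Fin n => halfLine := by
  refine Measure.pi_eq fun s _ => ?_
  simp [Measure.pi_pi, Finset.prod_mul_distrib]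

/-- The map log N carries the weights 1/N(a) to a measure on the line giving `[0, l]` the mass κl +
O(1). The sixth power of this measure is compared on `P` with that of κ times Lebesgue measure, by
applying `pi_le_pi_add` in both directions. -/
theorem exists_sum_prod_inv_bound (h : HasLinearCount N κ) :
    ∃ C : ℝ, 0 ≤ C ∧ ∀ T : ℝ, 1 ≤ T → ∀ (P : Set (Fin 6 → ℝ)) (Y : Finset (Fin 6 → A)),
      IsDownClosed T P → (∀ y, y ∈ Y ↔ (fun j => Real.log (N (y j))) ∈ P) →
      |∑ y ∈ Y, ∏ j, (N (y j) : ℝ)⁻¹ - κ ^ 6 * (orthant P).toReal| ≤ C * T ^ 5 := by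
  obtain ⟨C, hC0, hC⟩ := h.exists_sum_inv_bound
  have hκ := h.density_pos
  let _ : MeasurableSpace A := ⊤
  have := h.countable
  have : SigmaFinite (weightMeasure N) := by
    have := h.sigmaFinite_map_weightMeasure
    exact SigmaFinite.of_map (weightMeasure N) (f := fun a => Real.log (N a))
      Measurable.of_discrete.aemeasurable this
  have := h.sigmaFinite_map_weightMeasure
  set μ := (weightMeasure N).map fun a => Real.log (N a) with hμ
  have : SigmaFinite (ENNReal.ofReal κ • halfLine) := by
    change SigmaFinite (κ.toNNReal • halfLine)
    infer_instance
  set ν := ENNReal.ofReal κ • halfLine with hν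
  have hνI : ∀ l, 0 ≤ l → ν (Icc 0 l) = ENNReal.ofReal (κ * l) := by
    intro l hl
    rw [hν, Measure.smul_apply, Measure.restrict_apply measurableSet_Icc, inter_comm,
      smul_eq_mul, ENNReal.ofReal_mul hκ.le]
    congr 1
    have : Ioi (0 : ℝ) ∩ Icc 0 l = Ioc 0 l := by
      ext x
      simp only [mem_inter_iff, mem_Ioi, mem_Icc, mem_Ioc]
      exact ⟨fun h => ⟨h.1, h.2.2⟩, fun h => ⟨h.1, h.1.le, h.2⟩⟩
    rw [this, Real.volume_Ioc, sub_zero]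
  have hμI : ∀ l, μ (Icc 0 l) = ENNReal.ofReal (∑ a ∈ h.ball (Real.exp l), (N a : ℝ)⁻¹) :=
    h.map_weightMeasure_Icc
  have hb : ∀ l : ℝ, 0 ≤ l → |∑ a ∈ h.ball (Real.exp l), (N a : ℝ)⁻¹ - κ * l| ≤ C := by
    intro l hl
    simpa using hC (Real.exp l) (Real.one_le_exp hl)
  have h1 : ∀ l, 0 ≤ l → μ (Icc 0 l) ≤ ν (Icc 0 l) + ENNReal.ofReal C := by
    intro l hl
    rw [hμI, hνI l hl, ← ENNReal.ofReal_add (by positivity) hC0]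
    exact ENNReal.ofReal_le_ofReal (by linarith [(abs_le.1 (hb l hl)).2])
  have h2 : ∀ l, 0 ≤ l → ν (Icc 0 l) ≤ μ (Icc 0 l) + ENNReal.ofReal C := by
    intro l hl
    rw [hμI, hνI l hl, ← ENNReal.ofReal_add (Finset.sum_nonneg fun a _ => by positivity) hC0]
    exact ENNReal.ofReal_le_ofReal (by linarith [(abs_le.1 (hb l hl)).1])
  -- This is `n * C * L ^ (n - 1)` for `n = 6` and `L = (κ + C) * T`; `1 ≤ T` lets this `L` absorb
  -- the additive error in the mass of `[0, T]`.
  refine ⟨6 * C * (κ + C) ^ 5, by positivity, fun T hT P Y hP hY => ?_⟩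
  have hT0 : 0 ≤ T := by linarith
  have hν1 : ν (Icc 0 T) ≤ ENNReal.ofReal ((κ + C) * T) := by
    rw [hνI T hT0]
    exact ENNReal.ofReal_le_ofReal (by nlinarith)
  have hμ1 : μ (Icc 0 T) ≤ ENNReal.ofReal ((κ + C) * T) := by
    rw [hμI]
    exact ENNReal.ofReal_le_ofReal (by nlinarith [(abs_le.1 (hb T hT0)).2])
  have hμP : (Measure.pi fun _ : Fin 6 => μ) P =
      ENNReal.ofReal (∑ y ∈ Y, ∏ j, (N (y j) : ℝ)⁻¹) := by
    rw [hμ, ← Measure.pi_map_pi (fun _ => Measurable.of_discrete.aemeasurable),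
      Measure.map_apply (f := fun (y : Fin 6 → A) j => Real.log (N (y j)))
        (measurable_pi_lambda _ fun j => (Measurable.of_discrete (f := fun a : A =>
          Real.log (N a))).comp (measurable_pi_apply j)) hP.isClosed.measurableSet]
    have : (fun (y : Fin 6 → A) j => Real.log (N (y j))) ⁻¹' P = Y := by
      ext y
      simp [hY]
    rw [this, ← sum_measure_singleton, ENNReal.ofReal_sum_of_nonneg
      fun y _ => Finset.prod_nonneg fun j _ => by positivity]
    refine Finset.sum_congr rfl fun y _ => ?_
    rw [Measure.pi_singleton, ENNReal.ofReal_prod_of_nonneg fun j _ => by positivity]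
    refine Finset.prod_congr rfl fun j _ => ?_
    simpa using weightMeasure_coe (N := N) {y j}
  have hPfin : orthant P ≠ ∞ := by
    refine ne_top_of_le_ne_top ?_ (measure_mono hP.subset)
    rw [orthant, Measure.pi_pi]
    refine ENNReal.prod_ne_top fun j _ => ?_
    exact ne_top_of_le_ne_top (by simp) (Measure.restrict_apply_le (μ := volume) _ (Icc 0 T))
  have hνP : (Measure.pi fun _ : Fin 6 => ν) P = ENNReal.ofReal (κ ^ 6 * (orthant P).toReal) := by
    rw [hν, pi_smul_halfLine, Measure.smul_apply, smul_eq_mul,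
      ENNReal.ofReal_mul (by positivity), ENNReal.ofReal_toReal hPfin, ENNReal.ofReal_pow hκ.le]
  have herr : ((6 : ℕ) : ℝ≥0∞) * ENNReal.ofReal C * ENNReal.ofReal ((κ + C) * T) ^ (6 - 1) =
      ENNReal.ofReal (6 * C * (κ + C) ^ 5 * T ^ 5) := by
    rw [← ENNReal.ofReal_pow (by positivity), ← ENNReal.ofReal_natCast, ← ENNReal.ofReal_mul
      (by positivity), ← ENNReal.ofReal_mul (by positivity)]
    congr 1
    push_cast
    ring
  have k1 := pi_le_pi_add μ ν _ _ T h1 hμ1 hν1 6 P hP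
  have k2 := pi_le_pi_add ν μ _ _ T h2 hν1 hμ1 6 P hP
  have hs0 : 0 ≤ ∑ y ∈ Y, ∏ j, (N (y j) : ℝ)⁻¹ :=
    Finset.sum_nonneg fun y _ => Finset.prod_nonneg fun j _ => by positivity
  have hv0 : 0 ≤ κ ^ 6 * (orthant P).toReal := by positivity
  rw [herr, hμP, hνP, ← ENNReal.ofReal_add (by assumption) (by positivity),
    ENNReal.ofReal_le_ofReal_iff (by positivity)] at k1 k2
  rw [abs_le]
  constructor <;> linarith

end HasLinearCount

end ToricCubic

/-! ### Counting nine-tuples under three height conditions -/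

namespace ToricCubic

theorem sum_piFinset_insertNth {A : Type*} {n : ℕ} (S : Finset A) (j : Fin (n + 1))
    (F : (Fin (n + 1) → A) → ℝ) :
    ∑ y ∈ Fintype.piFinset fun _ => S, F y =
      ∑ y ∈ Fintype.piFinset fun _ : Fin n => S, ∑ a ∈ S, F (j.insertNth a y) := by
  rw [← Finset.sum_product']
  refine Finset.sum_nbij' (fun y => (fun k => y (j.succAbove k), y j))
    (fun q => j.insertNth q.2 q.1) ?_ ?_ ?_ ?_ ?_
  · intro y hy
    rw [Fintype.mem_piFinset] at hy
    simp [Fintype.mem_piFinset, hy]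
  · rintro ⟨y, a⟩ hq
    simp only [Finset.mem_product, Fintype.mem_piFinset] at hq
    rw [Fintype.mem_piFinset]
    intro k
    refine Fin.succAboveCases j ?_ (fun i => ?_) k
    · simpa using hq.2
    · simpa using hq.1 i
  · intro y _
    exact Fin.insertNth_self_removeNth j y
  · rintro ⟨y, a⟩ _
    simp
  · intro y _
    congr 1
    exact (Fin.insertNth_self_removeNth j y).symm

namespace HasLinearCount

open MeasureTheory Set

variable {A : Type*} {N : A → ℕ} {κ : ℝ}

/-- The monomial `∏ j, N (y j) ^ expo i j`. -/
noncomputable def monomial (N : A → ℕ) (i : Fin 3) (y : Fin 6 → A) : ℝ :=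
  ∏ j, (N (y j) : ℝ) ^ expo i j

theorem monomial_pos (h : HasLinearCount N κ) (i : Fin 3) (y : Fin 6 → A) : 0 < monomial N i y :=
  Finset.prod_pos fun j _ => pow_pos (by linarith [h.one_le (y j)]) _

theorem log_monomial (h : HasLinearCount N κ) (i : Fin 3) (y : Fin 6 → A) :
    Real.log (monomial N i y) = expoForm i fun j => Real.log (N (y j)) := by
  rw [monomial, Real.log_prod fun j _ => pow_ne_zero _ (by linarith [h.one_le (y j)])]
  simp [expoForm, Real.log_pow]

/-- Every column of `expo` sums to 3. This is why the cube roots of the three bounds on the xᵢ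
multiply to a product of plain reciprocals 1/N(yⱼ). -/
theorem prod_monomial (y : Fin 6 → A) :
    ∏ i, monomial N i y = (∏ j, (N (y j) : ℝ)) ^ 3 := by
  simp only [monomial]
  rw [Finset.prod_comm, ← Finset.prod_pow]
  refine Finset.prod_congr rfl fun j _ => ?_
  rw [Finset.prod_pow_eq_pow_sum]
  congr 1
  revert j
  decide

theorem exists_one_le_expo (j : Fin 6) : ∃ i, 1 ≤ expo i j := by
  revert j
  decide

theorem le_of_monomial_le (h : HasLinearCount N κ) {B : ℝ} {y : Fin 6 → A}
    (hy : ∀ i, monomial N i y ≤ B) (j : Fin 6) : (N (y j) : ℝ) ≤ B := by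
  obtain ⟨i, hi⟩ := exists_one_le_expo j
  refine le_trans ?_ (hy i)
  rw [monomial, ← Finset.mul_prod_erase _ _ (Finset.mem_univ j)]
  have h1 : (1 : ℝ) ≤ ∏ k ∈ Finset.univ.erase j, (N (y k) : ℝ) ^ expo i k :=
    Finset.one_le_prod fun k _ => one_le_pow₀ (h.one_le _)
  have h2 : (N (y j) : ℝ) ≤ (N (y j) : ℝ) ^ expo i j := le_self_pow₀ (h.one_le _) (by omega)
  have h3 := h.one_le (y j)
  nlinarith

/-- The six-tuples whose monomials satisfy `D i * monomial ≤ B`. -/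
noncomputable def admissible (h : HasLinearCount N κ) (D : Fin 3 → ℝ) (B : ℝ) :
    Finset (Fin 6 → A) :=
  open scoped Classical in
  (Fintype.piFinset fun _ => h.ball B).filter fun y => ∀ i, D i * monomial N i y ≤ B

theorem mem_admissible (h : HasLinearCount N κ) {D : Fin 3 → ℝ} (hD : ∀ i, 1 ≤ D i) {B : ℝ}
    {y : Fin 6 → A} : y ∈ h.admissible D B ↔ ∀ i, D i * monomial N i y ≤ B := by
  simp only [admissible, Finset.mem_filter, Fintype.mem_piFinset, mem_ball, and_iff_right_iff_imp]
  intro hy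
  refine h.le_of_monomial_le fun i => le_trans ?_ (hy i)
  exact le_mul_of_one_le_left (h.monomial_pos i y).le (hD i)

theorem isDownClosed_polytope {β : Fin 3 → ℝ} {T : ℝ} (hβ : ∀ i, β i ≤ T) :
    IsDownClosed T (polytope β) where
  isClosed := isClosed_polytope β
  nonneg x hx := hx.1
  le x hx j := by
    obtain ⟨i, hi⟩ := exists_one_le_expo j
    refine le_trans ?_ ((hx.2 i).trans (hβ i))
    have h1 : (expo i j : ℝ) * x j ≤ expoForm i x :=
      Finset.single_le_sum (f := fun j => (expo i j : ℝ) * x j)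
        (fun k _ => mul_nonneg (Nat.cast_nonneg _) (hx.1 k)) (Finset.mem_univ j)
    have h2 : (1 : ℝ) ≤ expo i j := by exact_mod_cast hi
    nlinarith [hx.1 j]
  down x hx y hy0 hyx := ⟨hy0, fun i => le_trans (Finset.sum_le_sum fun j _ =>
    mul_le_mul_of_nonneg_left (hyx j) (Nat.cast_nonneg _)) (hx.2 i)⟩

theorem orthant_polytope_mono {β γ : Fin 3 → ℝ} (h : ∀ i, β i ≤ γ i) :
    orthant (polytope β) ≤ orthant (polytope γ) :=
  measure_mono fun _ ht => ⟨ht.1, fun i => (ht.2 i).trans (h i)⟩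

/-- With m = ∑ δᵢ, the polytope lies between the dilates of the unit polytope by L - m and by L, and
Bernoulli's inequality bounds L⁶ - (L - m)⁶ by 6L⁵m. When m ≥ L the required lower bound is
negative. -/
theorem abs_orthant_polytope_sub_le {L : ℝ} (hL : 0 < L) {δ : Fin 3 → ℝ} (hδ : ∀ i, 0 ≤ δ i) :
    |(orthant (polytope fun i => L - δ i)).toReal - L ^ 6 / 2880| ≤ L ^ 5 * ∑ i, δ i := by
  have hc : ∀ s : ℝ, 0 < s → orthant (polytope fun _ => s) = ENNReal.ofReal (s ^ 6 / 2880) := by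
    intro s hs
    rw [orthant_polytope_const hs, orthant_polytope_one, ← ENNReal.ofReal_mul (by positivity)]
    congr 1
    ring
  set m := ∑ i, δ i with hm
  have hm0 : 0 ≤ m := Finset.sum_nonneg fun i _ => hδ i
  have hδm : ∀ i, δ i ≤ m := fun i =>
    Finset.single_le_sum (fun i _ => hδ i) (Finset.mem_univ i)
  have hup : orthant (polytope fun i => L - δ i) ≤ ENNReal.ofReal (L ^ 6 / 2880) := by
    rw [← hc L hL]
    exact orthant_polytope_mono fun i => by linarith [hδ i]
  have hup' := ENNReal.toReal_le_of_le_ofReal (by positivity) hup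
  have hlow : L ^ 6 / 2880 - L ^ 5 * m ≤ (orthant (polytope fun i => L - δ i)).toReal := by
    rcases le_or_gt L m with h | h
    · refine le_trans ?_ ENNReal.toReal_nonneg
      have : L ^ 5 * L ≤ L ^ 5 * m := mul_le_mul_of_nonneg_left h (by positivity)
      nlinarith [pow_pos hL 6]
    · have h1 : ENNReal.ofReal ((L - m) ^ 6 / 2880) ≤ orthant (polytope fun i => L - δ i) := by
        rw [← hc _ (by linarith)]
        exact orthant_polytope_mono fun i => by linarith [hδm i]
      have h2 : (L - m) ^ 6 / 2880 ≤ (orthant (polytope fun i => L - δ i)).toReal :=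
        (ENNReal.ofReal_le_iff_le_toReal (ne_top_of_le_ne_top ENNReal.ofReal_ne_top hup)).1 h1
      have hber := one_add_mul_le_pow (a := -(m / L)) (by
        have : m / L ≤ 1 := (div_le_one hL).2 h.le
        linarith) 6
      have h3 : (L - m) ^ 6 = L ^ 6 * (1 + -(m / L)) ^ 6 := by
        rw [← mul_pow]
        congr 1
        field_simp
        ring
      have h4 : L ^ 6 * (1 + ((6 : ℕ) : ℝ) * -(m / L)) = L ^ 6 - 6 * (L ^ 5 * m) := by
        field_simp
        push_cast
        ring
      have h5 := mul_le_mul_of_nonneg_left hber (by positivity : 0 ≤ L ^ 6)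
      rw [h4, ← h3] at h5
      nlinarith [mul_nonneg (pow_nonneg hL.le 5) hm0]
  rw [abs_le]
  have : 0 ≤ L ^ 5 * m := by positivity
  constructor <;> linarith

/-- In logarithmic coordinates the admissible tuples are the points of the polytope with bounds `log
B - log (D i)`. -/
theorem exists_main_sum_bound (h : HasLinearCount N κ) :
    ∃ C : ℝ, 0 ≤ C ∧ ∀ (D : Fin 3 → ℝ) (B : ℝ), (∀ i, 1 ≤ D i) → 1 ≤ Real.log B → 0 < B →
      |∑ y ∈ h.admissible D B, ∏ j, (N (y j) : ℝ)⁻¹ - κ ^ 6 * (Real.log B ^ 6 / 2880)| ≤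
        C * Real.log B ^ 5 * (1 + ∑ i, Real.log (D i)) := by
  obtain ⟨C, hC0, hC⟩ := h.exists_sum_prod_inv_bound
  have hκ := h.density_pos
  refine ⟨C + κ ^ 6, by positivity, fun D B hD hL hB => ?_⟩
  have hδ : ∀ i, 0 ≤ Real.log (D i) := fun i => Real.log_nonneg (hD i)
  have h1 := hC (Real.log B) hL (polytope fun i => Real.log B - Real.log (D i))
    (h.admissible D B) (isDownClosed_polytope fun i => by linarith [hδ i]) (fun y => by
      rw [h.mem_admissible hD]
      simp only [polytope, mem_ofPred_eq]
      rw [and_iff_right fun j => Real.log_nonneg (h.one_le _)]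
      refine forall_congr' fun i => ?_
      have hDi : 0 < D i := by linarith [hD i]
      rw [← h.log_monomial, le_sub_iff_add_le', ← Real.log_mul hDi.ne' (h.monomial_pos i y).ne',
        Real.log_le_log_iff (mul_pos hDi (h.monomial_pos i y)) hB])
  have h2 := abs_orthant_polytope_sub_le (L := Real.log B) (by linarith) hδ
  set V := (orthant (polytope fun i => Real.log B - Real.log (D i))).toReal
  set M := ∑ i, Real.log (D i)
  have hM : 0 ≤ M := Finset.sum_nonneg fun i _ => hδ i
  have h3 : |κ ^ 6 * V - κ ^ 6 * (Real.log B ^ 6 / 2880)| ≤ κ ^ 6 * (Real.log B ^ 5 * M) := by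
    rw [← mul_sub, abs_mul, abs_of_pos (by positivity)]
    exact mul_le_mul_of_nonneg_left h2 (by positivity)
  refine (abs_sub_le _ (κ ^ 6 * V) _).trans ((add_le_add h1 h3).trans ?_)
  have : 0 ≤ C * Real.log B ^ 5 * M := by positivity
  have : 0 ≤ κ ^ 6 * Real.log B ^ 5 := by positivity
  nlinarith

/-- A variable occurring with exponent two in the `i`-th monomial. -/
def doubleIndex : Fin 3 → Fin 6 := ![0, 2, 3]

theorem expo_doubleIndex (i : Fin 3) : expo i (doubleIndex i) = 2 := by
  revert i
  decide

/-- The extra factor is small except near the boundary of the region, which saves one logarithm. Fix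
all variables but one, a, of exponent 2 in the i-th monomial. With T = B/(Dᵢ r), where r is the rest
of that monomial, the condition becomes N(a) ≤ √T and the term is T^(-1/6) N(a)^(-2/3), so the sum
over a is O(1) uniformly. The other five variables each contribute O(log B). -/
theorem exists_error_sum_bound (h : HasLinearCount N κ) :
    ∃ C : ℝ, 0 ≤ C ∧ ∀ (D : Fin 3 → ℝ) (B : ℝ), (∀ i, 1 ≤ D i) → 1 ≤ Real.log B → 1 ≤ B →
      ∀ i, ∑ y ∈ h.admissible D B,
        (∏ j, (N (y j) : ℝ)⁻¹) * (D i * monomial N i y / B) ^ (1 / 6 : ℝ) ≤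
        C * Real.log B ^ 5 := by
  classical
  obtain ⟨C₁, hC₁0, hC₁⟩ := h.exists_sum_inv_bound
  obtain ⟨C₂, hC₂0, hC₂⟩ := h.exists_sum_rpow_bound
  have hκ := h.density_pos
  refine ⟨C₂ * (κ + C₁) ^ 5, by positivity, fun D B hD hL hB i => ?_⟩
  have hB0 : 0 < B := by linarith
  have hDi : 0 < D i := by linarith [hD i]
  set j₀ := doubleIndex i with hj₀
  rw [admissible, Finset.sum_filter, sum_piFinset_insertNth _ j₀]
  have hN0 : ∀ a, (0 : ℝ) < N a := fun a => by linarith [h.one_le a]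
  have hinner : ∀ y : Fin 5 → A, ∑ a ∈ h.ball B,
      (if ∀ k, D k * monomial N k (j₀.insertNth a y) ≤ B then
        (∏ j, (N ((j₀.insertNth a y : Fin 6 → A) j) : ℝ)⁻¹) *
          (D i * monomial N i (j₀.insertNth a y) / B) ^ (1 / 6 : ℝ) else 0) ≤
      C₂ * ∏ k, (N (y k) : ℝ)⁻¹ := by
    intro y
    set r := ∏ k, (N (y k) : ℝ) ^ expo i (j₀.succAbove k) with hr
    have hr0 : 0 < r := Finset.prod_pos fun k _ => pow_pos (hN0 _) _
    have hmono : ∀ a, monomial N i (j₀.insertNth a y) = (N a : ℝ) ^ 2 * r := by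
      intro a
      rw [monomial, Fin.prod_univ_succAbove _ j₀]
      simp [hr, hj₀, expo_doubleIndex]
    set T := B / (D i * r) with hT
    have hT0 : 0 < T := by positivity
    have hprod : 0 ≤ ∏ k, (N (y k) : ℝ)⁻¹ := Finset.prod_nonneg fun k _ => by positivity
    have hterm : ∀ a, (if ∀ k, D k * monomial N k (j₀.insertNth a y) ≤ B then
        (∏ j, (N ((j₀.insertNth a y : Fin 6 → A) j) : ℝ)⁻¹) *
          (D i * monomial N i (j₀.insertNth a y) / B) ^ (1 / 6 : ℝ) else 0) ≤
        if a ∈ h.ball √T then (∏ k, (N (y k) : ℝ)⁻¹) *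
          (T ^ (-(1 / 6) : ℝ) * (N a : ℝ) ^ (-(2 / 3) : ℝ)) else 0 := by
      intro a
      have e : D i * monomial N i (j₀.insertNth a y) / B = (N a : ℝ) ^ 2 / T := by
        rw [hmono, hT]
        field_simp
      split_ifs with h1 h2 h2
      · rw [e, Fin.prod_univ_succAbove _ j₀]
        simp only [Fin.insertNth_apply_same, Fin.insertNth_apply_succAbove]
        refine le_of_eq ?_
        rw [Real.div_rpow (by positivity) hT0.le, Real.rpow_neg hT0.le, ← Real.rpow_natCast,
          ← Real.rpow_mul (hN0 a).le, show (-(2 / 3) : ℝ) = -1 + (2 : ℕ) * (1 / 6) by norm_num,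
          Real.rpow_add (hN0 a), Real.rpow_neg_one]
        ring
      · exfalso
        refine h2 ?_
        rw [mem_ball]
        refine Real.le_sqrt_of_sq_le ?_
        have := h1 i
        rw [hmono] at this
        rw [hT, le_div_iff₀ (by positivity)]
        linarith
      · exact mul_nonneg hprod (by positivity)
      · exact le_rfl
    refine (Finset.sum_le_sum fun a _ => hterm a).trans ?_
    calc _ ≤ ∑ a ∈ h.ball √T, (∏ k, (N (y k) : ℝ)⁻¹) *
          (T ^ (-(1 / 6) : ℝ) * (N a : ℝ) ^ (-(2 / 3) : ℝ)) := by
          rw [← Finset.sum_filter]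
          refine Finset.sum_le_sum_of_subset_of_nonneg
            (fun a ha => (Finset.mem_filter.1 ha).2) fun a _ _ => mul_nonneg hprod (by positivity)
      _ = (∏ k, (N (y k) : ℝ)⁻¹) * (T ^ (-(1 / 6) : ℝ) *
          ∑ a ∈ h.ball √T, (N a : ℝ) ^ (-(2 / 3) : ℝ)) := by
          rw [Finset.mul_sum, Finset.mul_sum]
      _ ≤ (∏ k, (N (y k) : ℝ)⁻¹) * (T ^ (-(1 / 6) : ℝ) * (C₂ * √T ^ (1 / 3 : ℝ))) := by
          have := hC₂ √T (by positivity)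
          gcongr
      _ = _ := by
          rw [Real.sqrt_eq_rpow, ← Real.rpow_mul hT0.le, mul_left_comm (T ^ _),
            ← Real.rpow_add hT0]
          norm_num
          ring
  refine (Finset.sum_le_sum fun y _ => hinner y).trans ?_
  rw [← Finset.mul_sum, mul_assoc]
  refine mul_le_mul_of_nonneg_left ?_ hC₂0
  have hpi := Finset.prod_univ_sum (fun _ : Fin 5 => h.ball B) fun _ a => (N a : ℝ)⁻¹
  rw [← hpi, Finset.prod_const, Finset.card_univ, Fintype.card_fin, ← mul_pow]
  refine pow_le_pow_left₀ (Finset.sum_nonneg fun a _ => by positivity) ?_ 5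
  have := (abs_le.1 (hC₁ B hB)).2
  nlinarith

/-- The nine-tuples satisfying the three height conditions. -/
def solutionSet (N : A → ℕ) (D : Fin 3 → ℝ) (B : ℝ) : Set ((Fin 3 → A) × (Fin 6 → A)) :=
  {z | ∀ i, D i * ((N (z.1 i) : ℝ) ^ 3 * monomial N i z.2) ≤ B}

theorem solutionSet_finite_ncard (h : HasLinearCount N κ) {D : Fin 3 → ℝ} (hD : ∀ i, 1 ≤ D i)
    {B : ℝ} (hB : 0 ≤ B) : (solutionSet N D B).Finite ∧ (solutionSet N D B).ncard =
      ∑ y ∈ h.admissible D B,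
        ∏ i, (h.ball ((B / (D i * monomial N i y)) ^ (1 / 3 : ℝ))).card := by
  classical
  have hD0 : ∀ i, 0 < D i := fun i => by linarith [hD i]
  have he : solutionSet N D B = (((h.admissible D B).sigma fun y =>
      Fintype.piFinset fun i => h.ball ((B / (D i * monomial N i y)) ^ (1 / 3 : ℝ))).image
        fun q => (q.2, q.1) : Finset ((Fin 3 → A) × (Fin 6 → A))) := by
    ext ⟨x, y⟩
    simp only [solutionSet, mem_ofPred_eq, Finset.coe_image, mem_image, Finset.mem_coe,
      Finset.mem_sigma, Fintype.mem_piFinset, mem_ball, Prod.mk.injEq, Sigma.exists,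
      h.mem_admissible hD]
    have hiff : ∀ i, (N (x i) : ℝ) ≤ (B / (D i * monomial N i y)) ^ (1 / 3 : ℝ) ↔
        D i * ((N (x i) : ℝ) ^ 3 * monomial N i y) ≤ B := by
      intro i
      have hm := mul_pos (hD0 i) (h.monomial_pos i y)
      rw [one_div, Real.le_rpow_inv_iff_of_pos (Nat.cast_nonneg _) (by positivity) (by norm_num),
        le_div_iff₀ hm, mul_left_comm]
      norm_num
    constructor
    · intro hz
      refine ⟨y, x, ⟨fun i => le_trans ?_ (hz i), fun i => (hiff i).2 (hz i)⟩, rfl, rfl⟩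
      refine mul_le_mul_of_nonneg_left ?_ (hD0 i).le
      exact le_mul_of_one_le_left (h.monomial_pos i y).le (one_le_pow₀ (h.one_le _))
    · rintro ⟨y', x', ⟨-, h2⟩, rfl, rfl⟩ i
      exact (hiff i).1 (h2 i)
  refine ⟨he ▸ Finset.finite_toSet _, ?_⟩
  rw [he, Set.ncard_coe_finset, Finset.card_image_of_injective, Finset.card_sigma]
  · simp only [Fintype.card_piFinset]
  · rintro ⟨y, x⟩ ⟨y', x'⟩ hq
    simp only [Prod.mk.injEq] at hq
    obtain ⟨rfl, rfl⟩ := hq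
    rfl

theorem abs_mul_mul_sub_le {a b c a' b' c' : ℝ} (hb : 0 ≤ b) (hc : 0 ≤ c) (ha' : 0 ≤ a')
    (hb' : 0 ≤ b') : |a * b * c - a' * b' * c'| ≤
      |a - a'| * b * c + a' * |b - b'| * c + a' * b' * |c - c'| := by
  calc _ = |(a - a') * b * c + a' * (b - b') * c + a' * b' * (c - c')| := by
        congr 1; ring
    _ ≤ |(a - a') * b * c| + |a' * (b - b') * c| + |a' * b' * (c - c')| := abs_add_three _ _ _
    _ = _ := by
        simp only [abs_mul, abs_of_nonneg hb, abs_of_nonneg hc, abs_of_nonneg ha',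
          abs_of_nonneg hb']

/-- For X = R^(1/3) the relative error √X/X of one count is R^(-1/6), and the error of a product of
three counts telescopes. The hypothesis `1 ≤ R i` makes the counting estimates applicable. -/
theorem exists_prod_card_bound (h : HasLinearCount N κ) :
    ∃ C : ℝ, 0 ≤ C ∧ ∀ R : Fin 3 → ℝ, (∀ i, 1 ≤ R i) →
      |((∏ i, (h.ball (R i ^ (1 / 3 : ℝ))).card : ℕ) : ℝ) - κ ^ 3 * (∏ i, R i) ^ (1 / 3 : ℝ)| ≤
        C * (∏ i, R i) ^ (1 / 3 : ℝ) * ∑ i, (R i)⁻¹ ^ (1 / 6 : ℝ) := by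
  obtain ⟨C₁, hC₁0, hC₁⟩ := h.exists_card_bound
  obtain ⟨C₂, hC₂0, hC₂⟩ := h.exists_card_le
  have hκ := h.density_pos
  refine ⟨C₁ * (C₂ + κ) ^ 2, by positivity, fun R hR => ?_⟩
  have hR0 : ∀ i, 0 < R i := fun i => by linarith [hR i]
  set X : Fin 3 → ℝ := fun i => R i ^ (1 / 3 : ℝ) with hX
  have hX1 : ∀ i, 1 ≤ X i := fun i => Real.one_le_rpow (hR i) (by norm_num)
  have hX0 : ∀ i, 0 < X i := fun i => by linarith [hX1 i]
  set e : Fin 3 → ℝ := fun i => (R i)⁻¹ ^ (1 / 6 : ℝ) with he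
  have he0 : ∀ i, 0 < e i := fun i => Real.rpow_pos_of_pos (inv_pos.2 (hR0 i)) _
  have hsq : ∀ i, √(X i) = X i * e i := by
    intro i
    simp only [hX, he]
    rw [Real.sqrt_eq_rpow, ← Real.rpow_mul (hR0 i).le, Real.inv_rpow (hR0 i).le,
      ← Real.rpow_neg (hR0 i).le, ← Real.rpow_add (hR0 i)]
    norm_num
  have hprod : (∏ i, R i) ^ (1 / 3 : ℝ) = X 0 * X 1 * X 2 := by
    rw [Fin.prod_univ_three, Real.mul_rpow (mul_pos (hR0 0) (hR0 1)).le (hR0 2).le,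
      Real.mul_rpow (hR0 0).le (hR0 1).le]
  rw [hprod, Fin.sum_univ_three, Fin.prod_univ_three]
  push_cast
  set n : Fin 3 → ℝ := fun i => ((h.ball (X i)).card : ℝ) with hn
  have hn0 : ∀ i, 0 ≤ n i := fun i => Nat.cast_nonneg _
  have hn1 : ∀ i, n i ≤ (C₂ + κ) * X i := fun i =>
    (hC₂ _ (hX1 i)).trans (mul_le_mul_of_nonneg_right (by linarith) (hX0 i).le)
  have hn2 : ∀ i, |n i - κ * X i| ≤ C₁ * (X i * e i) := fun i => hsq i ▸ hC₁ _ (hX1 i)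
  have hk0 : ∀ i, 0 ≤ κ * X i := fun i => mul_nonneg hκ.le (hX0 i).le
  have hk1 : ∀ i, κ * X i ≤ (C₂ + κ) * X i := fun i =>
    mul_le_mul_of_nonneg_right (by linarith) (hX0 i).le
  have key := abs_mul_mul_sub_le (a := n 0) (a' := κ * X 0) (c' := κ * X 2) (hn0 1) (hn0 2)
    (hk0 0) (hk0 1)
  have hW : 0 ≤ C₂ + κ := by positivity
  calc _ = |n 0 * n 1 * n 2 - κ * X 0 * (κ * X 1) * (κ * X 2)| := by
        congr 1
        ring
    _ ≤ _ := key
    _ ≤ C₁ * (X 0 * e 0) * ((C₂ + κ) * X 1) * ((C₂ + κ) * X 2) +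
        (C₂ + κ) * X 0 * (C₁ * (X 1 * e 1)) * ((C₂ + κ) * X 2) +
        (C₂ + κ) * X 0 * ((C₂ + κ) * X 1) * (C₁ * (X 2 * e 2)) := by
        have := hX0 0
        have := hX0 1
        have := hX0 2
        have := he0 0
        have := he0 1
        have := he0 2
        gcongr
        · exact hn2 0
        · exact hn1 1
        · exact hn1 2
        · linarith
        · exact hn2 1
        · exact hn1 2
        · linarith
        · linarith
        · exact hn2 2
    _ = _ := by ring

/-- Asymptotic count of nine-tuples, uniform in the divisors `D`. -/
theorem exists_solutionSet_bound (h : HasLinearCount N κ) :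
    ∃ C : ℝ, 0 ≤ C ∧ ∀ (D : Fin 3 → ℝ) (B : ℝ), (∀ i, 1 ≤ D i) → 1 ≤ Real.log B → 1 ≤ B →
      |((solutionSet N D B).ncard : ℝ) -
        κ ^ 9 / 2880 * (B / (∏ i, D i) ^ (1 / 3 : ℝ)) * Real.log B ^ 6| ≤
        C * (B / (∏ i, D i) ^ (1 / 3 : ℝ)) * Real.log B ^ 5 * (1 + ∑ i, Real.log (D i)) := by
  obtain ⟨C₁, hC₁0, hC₁⟩ := h.exists_main_sum_bound
  obtain ⟨C₂, hC₂0, hC₂⟩ := h.exists_error_sum_bound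
  obtain ⟨C₃, hC₃0, hC₃⟩ := h.exists_prod_card_bound
  have hκ := h.density_pos
  -- The first summand is the error of the main sum over `y`; the second comes from the three error
  -- sums, one for each height condition.
  refine ⟨κ ^ 3 * C₁ + C₃ * (3 * C₂), by positivity, fun D B hD hL hB => ?_⟩
  have hB0 : 0 < B := by linarith
  have hD0 : ∀ i, 0 < D i := fun i => by linarith [hD i]
  set Q := B / (∏ i, D i) ^ (1 / 3 : ℝ) with hQ
  have hPD : 0 < ∏ i, D i := Finset.prod_pos fun i _ => hD0 i
  have hQ0 : 0 < Q := by positivity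
  set L := Real.log B with hLdef
  set M := ∑ i, Real.log (D i) with hM
  have hM0 : 0 ≤ M := Finset.sum_nonneg fun i _ => Real.log_nonneg (hD i)
  have hprod : ∀ y : Fin 6 → A, (∏ i, B / (D i * monomial N i y)) ^ (1 / 3 : ℝ) =
      Q * ∏ j, (N (y j) : ℝ)⁻¹ := by
    intro y
    have hN : 0 < ∏ j, (N (y j) : ℝ) := Finset.prod_pos fun j _ => by linarith [h.one_le (y j)]
    have hcube : ∀ x : ℝ, 0 ≤ x → (x ^ 3) ^ (1 / 3 : ℝ) = x := fun x hx => by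
      rw [← Real.rpow_natCast, ← Real.rpow_mul hx]
      norm_num
    rw [Finset.prod_div_distrib, Finset.prod_mul_distrib, prod_monomial, Finset.prod_const,
      Finset.card_univ, Fintype.card_fin, Real.div_rpow (by positivity) (by positivity),
      Real.mul_rpow hPD.le (by positivity), hcube B hB0.le, hcube _ hN.le, Finset.prod_inv_distrib,
      hQ]
    field_simp
  rw [(h.solutionSet_finite_ncard hD hB0.le).2]
  push_cast
  set S := ∑ y ∈ h.admissible D B, ∏ j, (N (y j) : ℝ)⁻¹ with hS
  have h1 : |∑ y ∈ h.admissible D B, ∏ i,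
      ((h.ball ((B / (D i * monomial N i y)) ^ (1 / 3 : ℝ))).card : ℝ) - κ ^ 3 * (Q * S)| ≤
      C₃ * Q * (3 * (C₂ * L ^ 5)) := by
    rw [hS, Finset.mul_sum, Finset.mul_sum, ← Finset.sum_sub_distrib]
    refine (Finset.abs_sum_le_sum_abs _ _).trans ?_
    calc _ ≤ ∑ y ∈ h.admissible D B, C₃ * Q * ∑ i, (∏ j, (N (y j) : ℝ)⁻¹) *
          (D i * monomial N i y / B) ^ (1 / 6 : ℝ) := by
          refine Finset.sum_le_sum fun y hy => ?_
          have hy' := (h.mem_admissible hD).1 hy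
          have := hC₃ (fun i => B / (D i * monomial N i y)) fun i => by
            rw [one_le_div (mul_pos (hD0 i) (h.monomial_pos i y))]
            exact hy' i
          rw [hprod] at this
          push_cast at this
          refine this.trans_eq ?_
          simp only [inv_div, ← Finset.mul_sum]
          ring
      _ = C₃ * Q * ∑ i, ∑ y ∈ h.admissible D B, (∏ j, (N (y j) : ℝ)⁻¹) *
          (D i * monomial N i y / B) ^ (1 / 6 : ℝ) := by
          rw [← Finset.mul_sum, Finset.sum_comm]
      _ ≤ C₃ * Q * ∑ _i : Fin 3, C₂ * L ^ 5 := by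
          refine mul_le_mul_of_nonneg_left (Finset.sum_le_sum fun i _ => hC₂ D B hD hL hB i) ?_
          positivity
      _ = _ := by simp
  have h2 := hC₁ D B hD hL hB0
  have h3 : |κ ^ 3 * (Q * S) - κ ^ 9 / 2880 * Q * L ^ 6| ≤
      κ ^ 3 * Q * (C₁ * L ^ 5 * (1 + M)) := by
    have : κ ^ 3 * (Q * S) - κ ^ 9 / 2880 * Q * L ^ 6 =
        κ ^ 3 * Q * (S - κ ^ 6 * (L ^ 6 / 2880)) := by ring
    rw [this, abs_mul, abs_of_pos (by positivity)]
    exact mul_le_mul_of_nonneg_left h2 (by positivity)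
  refine (abs_sub_le _ (κ ^ 3 * (Q * S)) _).trans ((add_le_add h1 h3).trans ?_)
  have : 0 ≤ C₃ * Q * (3 * (C₂ * L ^ 5)) * M := by positivity
  nlinarith

end HasLinearCount

end ToricCubic

/-! ### The fan with nine rays and its Möbius function -/

namespace ToricCubic

/-- The nine rays of the fan of the minimal desingularization of the surface. -/
abbrev Ray := Fin 3 ⊕ Fin 6

/-- The rays in cyclic order. -/
def ray : Fin 9 → Ray :=
  ![.inl 0, .inr 0, .inr 2, .inl 1, .inr 4, .inr 5, .inl 2, .inr 3, .inr 1]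

/-- Sets of rays contained in a cone of the fan. -/
def IsCone (I : Finset Ray) : Prop := ∃ k : Fin 9, ∀ i ∈ I, i = ray k ∨ i = ray (k + 1)

instance : DecidablePred IsCone := fun I => by
  unfold IsCone
  infer_instance

/-- The exponent vector of the monomials in the nine variables. -/
def exponent (v : Ray → ℕ) (i : Fin 3) : ℕ := 3 * v (.inl i) + ∑ j, expo i j * v (.inr j)

theorem exponent_zero (v : Ray → ℕ) : exponent v 0 =
    3 * v (.inl 0) + 2 * v (.inr 0) + 2 * v (.inr 1) + v (.inr 2) + v (.inr 3) := by
  simp [exponent, expo, Fin.sum_univ_succ]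
  ring

theorem exponent_one (v : Ray → ℕ) : exponent v 1 =
    3 * v (.inl 1) + v (.inr 0) + 2 * v (.inr 2) + 2 * v (.inr 4) + v (.inr 5) := by
  simp [exponent, expo, Fin.sum_univ_succ]
  ring

theorem exponent_two (v : Ray → ℕ) : exponent v 2 =
    3 * v (.inl 2) + v (.inr 1) + 2 * v (.inr 3) + v (.inr 4) + 2 * v (.inr 5) := by
  simp [exponent, expo, Fin.sum_univ_succ]
  ring

/-- The support of an exponent vector. -/
def raySupport (v : Ray → ℕ) : Finset Ray := Finset.univ.filter fun i => v i ≠ 0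

theorem mem_raySupport {v : Ray → ℕ} {i : Ray} : i ∈ raySupport v ↔ v i ≠ 0 := by
  simp [raySupport]

/-- The rays (3,0), (2,1), (1,2), (0,3) cut the quadrant into three cones, each spanned by a basis
of the lattice 3 ∣ m + n. Comparing `m` with `2 * n` and `n` with `2 * m` selects the cone. -/
theorem exists_eq_two_of_three_dvd (m n : ℕ) (h : 3 ∣ m + n) :
    ∃ k l, (m = 3 * k + 2 * l ∧ n = l) ∨ (m = 2 * k + l ∧ n = k + 2 * l) ∨
      (m = l ∧ n = 3 * k + 2 * l) := by
  rcases le_total (2 * n) m with h1 | h1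
  · exact ⟨(m - 2 * n) / 3, n, Or.inl ⟨by omega, rfl⟩⟩
  rcases le_total (2 * m) n with h2 | h2
  · exact ⟨(n - 2 * m) / 3, m, Or.inr (Or.inr ⟨rfl, by omega⟩)⟩
  · exact ⟨(2 * m - n) / 3, (2 * n - m) / 3, Or.inr (Or.inl ⟨by omega, by omega⟩)⟩

theorem exists_isCone_exponent_eq (w : Fin 3 → ℕ) (h0 : ∃ i, w i = 0) (h3 : 3 ∣ ∑ i, w i) :
    ∃ v : Ray → ℕ, IsCone (raySupport v) ∧ ∀ i, exponent v i = w i := by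
  have key : ∀ (s : Fin 9) (v : Ray → ℕ), (∀ i, i ≠ ray s → i ≠ ray (s + 1) → v i = 0) →
      IsCone (raySupport v) := by
    intro s v hv
    refine ⟨s, fun i hi => ?_⟩
    rw [mem_raySupport] at hi
    by_contra hcon
    push Not at hcon
    exact hi (hv i hcon.1 hcon.2)
  have fin : ∀ (s : Fin 9) (k l : ℕ),
      (∀ i, exponent (fun r => if r = ray s then k else if r = ray (s + 1) then l else 0) i = w i) →
      ∃ v : Ray → ℕ, IsCone (raySupport v) ∧ ∀ i, exponent v i = w i := by
    intro s k l h
    exact ⟨_, key s _ fun i h1 h2 => by rw [if_neg h1, if_neg h2], h⟩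
  rw [Fin.sum_univ_three] at h3
  have fin' : ∀ (s : Fin 9) (k l : ℕ),
      (exponent (fun r => if r = ray s then k else if r = ray (s + 1) then l else 0) 0 = w 0 ∧
       exponent (fun r => if r = ray s then k else if r = ray (s + 1) then l else 0) 1 = w 1 ∧
       exponent (fun r => if r = ray s then k else if r = ray (s + 1) then l else 0) 2 = w 2) →
      ∃ v : Ray → ℕ, IsCone (raySupport v) ∧ ∀ i, exponent v i = w i := by
    intro s k l h
    refine fin s k l fun i => ?_
    fin_cases i
    · exact h.1
    · exact h.2.1
    · exact h.2.2
  simp only [exponent_zero, exponent_one, exponent_two] at fin'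
  obtain ⟨i, hi⟩ := h0
  fin_cases i <;> simp only [Fin.zero_eta, Fin.mk_one, Fin.reduceFinMk] at hi
  · obtain ⟨k, l, ⟨h1, h2⟩ | ⟨h1, h2⟩ | ⟨h1, h2⟩⟩ :=
      exists_eq_two_of_three_dvd (w 1) (w 2) (by omega)
    · refine fin' 3 k l ?_
      simp [ray, hi, h1, h2]
    · refine fin' 4 k l ?_
      simp [ray, hi, h1, h2]
    -- Here `l` belongs to the ray that comes first in the cyclic order, hence the swap.
    · refine fin' 5 l k ?_
      simp [ray, hi, h1, h2]
  · obtain ⟨k, l, ⟨h1, h2⟩ | ⟨h1, h2⟩ | ⟨h1, h2⟩⟩ :=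
      exists_eq_two_of_three_dvd (w 2) (w 0) (by omega)
    · refine fin' 6 k l ?_
      simp [ray, hi, h1, h2]
    · refine fin' 7 k l ?_
      simp [ray, hi, h1, h2]
      omega
    · refine fin' 8 l k ?_
      simp [ray, hi, h1, h2]
  · obtain ⟨k, l, ⟨h1, h2⟩ | ⟨h1, h2⟩ | ⟨h1, h2⟩⟩ :=
      exists_eq_two_of_three_dvd (w 0) (w 1) (by omega)
    · refine fin' 0 k l ?_
      simp [ray, hi, h1, h2]
    · refine fin' 1 k l ?_
      simp [ray, hi, h1, h2]
    · refine fin' 2 l k ?_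
      simp [ray, hi, h1, h2]

/-- Recovers the exponent vector of a cone from its monomials. -/
def recover (a b c : ℕ) : Ray → ℕ :=
  Sum.elim ![(a - 2 * b - 2 * c) / 3, (b - 2 * a - 2 * c) / 3, (c - 2 * a - 2 * b) / 3]
    ![min b ((2 * a - b) / 3), min c ((2 * a - c) / 3), min a ((2 * b - a) / 3),
      min a ((2 * c - a) / 3), min c ((2 * b - c) / 3), min b ((2 * c - b) / 3)]

theorem IsCone.exists_zero {v : Ray → ℕ} (h : IsCone (raySupport v)) :
    ∃ s : Fin 9, ∀ i, i ≠ ray s → i ≠ ray (s + 1) → v i = 0 := by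
  obtain ⟨s, hs⟩ := h
  refine ⟨s, fun i h1 h2 => ?_⟩
  by_contra h
  exact (hs i (mem_raySupport.2 h)).elim h1 h2

theorem recover_apply (a b c : ℕ) :
    recover a b c (.inl 0) = (a - 2 * b - 2 * c) / 3 ∧
    recover a b c (.inl 1) = (b - 2 * a - 2 * c) / 3 ∧
    recover a b c (.inl 2) = (c - 2 * a - 2 * b) / 3 ∧
    recover a b c (.inr 0) = min b ((2 * a - b) / 3) ∧
    recover a b c (.inr 1) = min c ((2 * a - c) / 3) ∧
    recover a b c (.inr 2) = min a ((2 * b - a) / 3) ∧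
    recover a b c (.inr 3) = min a ((2 * c - a) / 3) ∧
    recover a b c (.inr 4) = min c ((2 * b - c) / 3) ∧
    recover a b c (.inr 5) = min b ((2 * c - b) / 3) := ⟨rfl, rfl, rfl, rfl, rfl, rfl, rfl, rfl, rfl⟩

theorem ray_ext {f g : Ray → ℕ} (h : f (.inl 0) = g (.inl 0) ∧ f (.inl 1) = g (.inl 1) ∧
    f (.inl 2) = g (.inl 2) ∧ f (.inr 0) = g (.inr 0) ∧ f (.inr 1) = g (.inr 1) ∧
    f (.inr 2) = g (.inr 2) ∧ f (.inr 3) = g (.inr 3) ∧ f (.inr 4) = g (.inr 4) ∧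
    f (.inr 5) = g (.inr 5)) : f = g := by
  obtain ⟨h0, h1, h2, h3, h4, h5, h6, h7, h8⟩ := h
  ext (i | i) <;> fin_cases i <;> assumption

/-- Uniqueness of the decomposition: truncated subtraction and minima combine the coefficient
formulas of all nine cones into the single expression `recover`. -/
theorem IsCone.eq_recover {v : Ray → ℕ} (h : IsCone (raySupport v)) :
    v = recover (exponent v 0) (exponent v 1) (exponent v 2) := by
  obtain ⟨s, hs⟩ := h.exists_zero
  have hv : v = fun r => if r = ray s then v (ray s) else
      if r = ray (s + 1) then v (ray (s + 1)) else 0 := by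
    ext r
    split_ifs with h1 h2
    · rw [h1]
    · rw [h2]
    · exact hs r h1 h2
  generalize v (ray s) = k at hv
  generalize v (ray (s + 1)) = l at hv
  subst hv
  clear hs h
  refine ray_ext ?_
  rw [exponent_zero, exponent_one, exponent_two]
  obtain ⟨e0, e1, e2, e3, e4, e5, e6, e7, e8⟩ := recover_apply
    (exponent (fun r => if r = ray s then k else if r = ray (s + 1) then l else 0) 0)
    (exponent (fun r => if r = ray s then k else if r = ray (s + 1) then l else 0) 1)
    (exponent (fun r => if r = ray s then k else if r = ray (s + 1) then l else 0) 2)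
  rw [exponent_zero, exponent_one, exponent_two] at e0 e1 e2 e3 e4 e5 e6 e7 e8
  rw [e0, e1, e2, e3, e4, e5, e6, e7, e8]
  clear e0 e1 e2 e3 e4 e5 e6 e7 e8
  fin_cases s <;> simp [ray] <;> omega

theorem exists_zero_and_dvd_of_isCone {v : Ray → ℕ} (h : IsCone (raySupport v)) :
    (∃ i, exponent v i = 0) ∧ 3 ∣ ∑ i, exponent v i := by
  constructor
  · obtain ⟨s, hs⟩ := h.exists_zero
    have hdec : ∀ s : Fin 9, ∃ i : Fin 3, (.inl i : Ray) ≠ ray s ∧ (.inl i : Ray) ≠ ray (s + 1) ∧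
        ∀ j : Fin 6, expo i j ≠ 0 → (.inr j : Ray) ≠ ray s ∧ (.inr j : Ray) ≠ ray (s + 1) := by
      decide
    obtain ⟨i, h1, h2, h3⟩ := hdec s
    refine ⟨i, ?_⟩
    simp only [exponent, Nat.add_eq_zero_iff, Finset.sum_eq_zero_iff, Finset.mem_univ, true_imp_iff]
    refine ⟨by rw [hs _ h1 h2], fun j => ?_⟩
    by_cases hj : expo i j = 0
    · rw [hj, zero_mul]
    · rw [hs _ (h3 j hj).1 (h3 j hj).2, mul_zero]
  · rw [Fin.sum_univ_three, exponent_zero, exponent_one, exponent_two]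
    omega

/-- The Möbius transform of the indicator function of the cones. -/
def coneMoebius (J : Finset Ray) : ℝ :=
  ∑ I ∈ J.powerset, (-1) ^ (J \ I).card * if IsCone I then 1 else 0

-- Expand the product over `Iᶜ` as a sum over subsets `T` and put `J = I ∪ T`. With indicator
-- weights the identity is Möbius inversion; with constant weights it produces the Euler factor.
set_option linter.constructorNameAsVariable false in
theorem sum_coneMoebius_mul_prod (w : Ray → ℝ) :
    ∑ J, coneMoebius J * ∏ i ∈ J, w i =
      ∑ I : Finset Ray, (if IsCone I then 1 else 0) * ((∏ i ∈ I, w i) * ∏ i ∈ Iᶜ, (1 - w i)) := by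
  have h1 : ∀ I : Finset Ray, ∏ i ∈ Iᶜ, (1 - w i) =
      ∑ T ∈ Iᶜ.powerset, (-1) ^ T.card * ∏ i ∈ T, w i := by
    intro I
    have := Finset.prod_add (fun i => -w i) (fun _ => (1 : ℝ)) Iᶜ
    simp only [Finset.prod_const_one, mul_one, Finset.prod_neg] at this
    rw [← this]
    exact Finset.prod_congr rfl fun i _ => by ring
  simp only [h1, coneMoebius, Finset.sum_mul, Finset.mul_sum]
  rw [Finset.sum_sigma', Finset.sum_sigma']
  refine Finset.sum_bij' (fun q _ => ⟨q.2, q.1 \ q.2⟩) (fun q _ => ⟨q.1 ∪ q.2, q.1⟩) ?_ ?_ ?_ ?_ ?_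
  · rintro ⟨J, I⟩ hq
    simp only [Finset.mem_sigma, Finset.mem_univ, Finset.mem_powerset, true_and] at hq ⊢
    intro i hi
    simp only [Finset.mem_sdiff, Finset.mem_compl] at hi ⊢
    exact hi.2
  · rintro ⟨I, T⟩ hq
    simp only [Finset.mem_sigma, Finset.mem_univ, Finset.mem_powerset, true_and]
    exact Finset.subset_union_left
  · rintro ⟨J, I⟩ hq
    simp only [Finset.mem_sigma, Finset.mem_univ, Finset.mem_powerset, true_and] at hq
    simp [Finset.union_sdiff_of_subset hq]
  · rintro ⟨I, T⟩ hq
    simp only [Finset.mem_sigma, Finset.mem_univ, Finset.mem_powerset, true_and] at hq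
    have : Disjoint T I := by
      rw [Finset.disjoint_left]
      exact fun i hi => Finset.mem_compl.1 (hq hi)
    simp [Finset.union_sdiff_cancel_left this.symm]
  · rintro ⟨J, I⟩ hq
    simp only [Finset.mem_sigma, Finset.mem_univ, Finset.mem_powerset, true_and] at hq
    simp only
    rw [← Finset.prod_sdiff hq]
    ring

theorem sum_coneMoebius_subset (S : Finset Ray) :
    ∑ J, coneMoebius J * (if J ⊆ S then 1 else 0) = if IsCone S then 1 else 0 := by
  have h := sum_coneMoebius_mul_prod fun i => if i ∈ S then 1 else 0
  have h1 : ∀ J : Finset Ray, ∏ i ∈ J, (if i ∈ S then (1 : ℝ) else 0) = if J ⊆ S then 1 else 0 := by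
    intro J
    rw [Finset.prod_ite_zero]
    simp [Finset.subset_iff]
  simp only [h1] at h
  rw [h, Finset.sum_eq_single S]
  · rw [if_pos (Finset.Subset.refl S), Finset.prod_congr rfl fun i hi => by
      rw [if_neg (Finset.mem_compl.1 hi), sub_zero]]
    simp
  · intro I _ hI
    by_cases hs : I ⊆ S
    · obtain ⟨i, hiS, hiI⟩ : ∃ i ∈ S, i ∉ I := by
        by_contra hcon
        push Not at hcon
        exact hI (Finset.Subset.antisymm hs hcon)
      rw [Finset.prod_eq_zero (i := i) (Finset.mem_compl.2 hiI) (by simp [hiS])]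
      simp
    · simp [hs]
  · simp

/-- The fan has one cone of dimension 0, nine rays and nine plane cones, so the sum is (1-x)⁹ +
9x(1-x)⁸ + 9x²(1-x)⁷. -/
theorem sum_coneMoebius_mul_pow (x : ℝ) :
    ∑ J, coneMoebius J * x ^ J.card = (1 - x) ^ 7 * (1 + 7 * x + x ^ 2) := by
  have h := sum_coneMoebius_mul_prod fun _ => x
  simp only [Finset.prod_const] at h
  rw [h]
  have hcard : ∀ I : Finset Ray, Iᶜ.card = 9 - I.card := fun I => by
    rw [Finset.card_compl]
    rfl
  simp only [hcard, ite_mul, one_mul, zero_mul]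
  rw [← Finset.sum_filter]
  have hmaps : ∀ I ∈ Finset.univ.filter IsCone, I.card ∈ Finset.range 3 := by
    intro I hI
    obtain ⟨k, hk⟩ := (Finset.mem_filter.1 hI).2
    have : I ⊆ {ray k, ray (k + 1)} := fun i hi => by simpa using hk i hi
    exact Finset.mem_range.2 (by
      have := (Finset.card_le_card this).trans Finset.card_le_two
      omega)
  rw [← Finset.sum_fiberwise_of_maps_to hmaps]
  have hfib : ∀ n, ∑ I ∈ (Finset.univ.filter IsCone).filter (fun I => I.card = n),
      x ^ I.card * (1 - x) ^ (9 - I.card) =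
      (((Finset.univ.powersetCard n : Finset (Finset Ray)).filter IsCone).card : ℝ) *
        (x ^ n * (1 - x) ^ (9 - n)) := by
    intro n
    have : (Finset.univ.filter IsCone).filter (fun I : Finset Ray => I.card = n) =
        (Finset.univ.powersetCard n : Finset (Finset Ray)).filter IsCone := by
      ext I
      simp [and_comm]
    rw [this, Finset.sum_congr rfl fun I hI => by
      rw [(Finset.mem_powersetCard.1 (Finset.mem_filter.1 hI).1).2], Finset.sum_const,
      nsmul_eq_mul]
  simp only [hfib, Finset.sum_range_succ, Finset.sum_range_zero]
  have c0 : ((Finset.univ.powersetCard 0 : Finset (Finset Ray)).filter IsCone).card = 1 := by decide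
  have c1 : ((Finset.univ.powersetCard 1 : Finset (Finset Ray)).filter IsCone).card = 9 := by decide
  have c2 : ((Finset.univ.powersetCard 2 : Finset (Finset Ray)).filter IsCone).card = 9 := by
    decide +kernel
  rw [c0, c1, c2]
  push_cast
  ring

theorem coneMoebius_empty : coneMoebius ∅ = 1 := by
  have : IsCone ∅ := ⟨0, by simp⟩
  rw [coneMoebius, Finset.powerset_empty, Finset.sum_singleton, if_pos this]
  simp

/-- Every single ray spans a cone, so the inversion has no linear term. All later convergence over
primes rests on this vanishing. -/
theorem coneMoebius_singleton (i : Ray) : coneMoebius {i} = 0 := by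
  have h0 : IsCone ∅ := ⟨0, by simp⟩
  have h1 : IsCone {i} := by
    have : ∀ i, ∃ k, i = ray k := by decide
    obtain ⟨k, rfl⟩ := this i
    exact ⟨k, by simp⟩
  have hp : ({i} : Finset Ray).powerset = {∅, {i}} := by
    ext I
    simp [Finset.subset_singleton_iff]
  rw [coneMoebius, hp, Finset.sum_pair (Finset.singleton_ne_empty i).symm, if_pos h0, if_pos h1]
  simp

theorem abs_coneMoebius_le (J : Finset Ray) : |coneMoebius J| ≤ 2 ^ 9 := by
  refine (Finset.abs_sum_le_sum_abs _ _).trans ?_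
  calc _ ≤ ∑ I ∈ J.powerset, (1 : ℝ) := by
        refine Finset.sum_le_sum fun I _ => ?_
        split_ifs <;> simp
    _ = 2 ^ J.card := by simp
    _ ≤ 2 ^ 9 := pow_le_pow_right₀ one_le_two (Finset.card_le_univ J)

/-- `2 ^ 18` is the number `2 ^ 9` of subsets times the bound `2 ^ 9` of `abs_coneMoebius_le`;
subsets with one element contribute nothing. -/
theorem sum_abs_coneMoebius_le {x : ℝ} (hx0 : 0 ≤ x) (hx1 : x ≤ 1) :
    ∑ J, |coneMoebius J| * x ^ J.card ≤ 1 + 2 ^ 18 * x ^ 2 := by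
  have h : ∀ J, |coneMoebius J| * x ^ J.card ≤ (if J = ∅ then 1 else 0) + 2 ^ 9 * x ^ 2 := by
    intro J
    rcases Nat.lt_or_ge J.card 2 with hJ | hJ
    · rcases Nat.lt_or_ge J.card 1 with hJ0 | hJ1
      · have : J = ∅ := Finset.card_eq_zero.1 (by omega)
        subst this
        simp only [coneMoebius_empty, Finset.card_empty, pow_zero, if_true, abs_one, mul_one]
        have : 0 ≤ 2 ^ 9 * x ^ 2 := by positivity
        linarith
      · obtain ⟨i, rfl⟩ := Finset.card_eq_one.1 (by omega : J.card = 1)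
        rw [coneMoebius_singleton]
        simp
        positivity
    · have h1 : x ^ J.card ≤ x ^ 2 := pow_le_pow_of_le_one hx0 hx1 hJ
      have h2 := mul_le_mul (abs_coneMoebius_le J) h1 (by positivity) (by positivity)
      have : (0 : ℝ) ≤ if J = ∅ then 1 else 0 := by split_ifs <;> norm_num
      linarith
  refine (Finset.sum_le_sum fun J _ => h J).trans ?_
  rw [Finset.sum_add_distrib, Finset.sum_ite_eq' Finset.univ ∅, if_pos (Finset.mem_univ _),
    Finset.sum_const, Finset.card_univ]
  have : Fintype.card (Finset Ray) = 2 ^ 9 := by simp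
  rw [this, nsmul_eq_mul]
  push_cast
  exact le_of_eq (by ring)

end ToricCubic

namespace ToricCubic

/-! ### Coprime cubic triples, nine-tuples and Möbius inversion -/

section Sieve

open Set

variable {P : Type*} (q : P → ℕ)

/-- The norm `∏ p, q p ^ a p` on the free commutative monoid with basis `P`. -/
def freeNorm (a : P →₀ ℕ) : ℕ := a.prod fun p k => q p ^ k

theorem freeNorm_zero : freeNorm q 0 = 1 := Finsupp.prod_zero_index

theorem freeNorm_add (a b : P →₀ ℕ) : freeNorm q (a + b) = freeNorm q a * freeNorm q b :=
  Finsupp.prod_add_index' (fun _ => pow_zero _) fun _ _ _ => pow_add _ _ _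

theorem freeNorm_nsmul (n : ℕ) (a : P →₀ ℕ) : freeNorm q (n • a) = freeNorm q a ^ n := by
  induction n with
  | zero => simp [freeNorm_zero]
  | succ n ih => rw [succ_nsmul, freeNorm_add, ih, pow_succ]

theorem freeNorm_sum {ι : Type*} (s : Finset ι) (f : ι → P →₀ ℕ) :
    freeNorm q (∑ i ∈ s, f i) = ∏ i ∈ s, freeNorm q (f i) := by
  classical
  induction s using Finset.induction_on with
  | empty => simp [freeNorm_zero]
  | insert i s hi ih => rw [Finset.sum_insert hi, Finset.prod_insert hi, freeNorm_add, ih]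

theorem freeNorm_single (p : P) (n : ℕ) : freeNorm q (Finsupp.single p n) = q p ^ n := by
  simp [freeNorm]

variable {q}

theorem le_freeNorm {κ : ℝ} (h : HasLinearCount (freeNorm q) κ) {a : P →₀ ℕ} {p : P}
    (hp : a p ≠ 0) : q p ≤ freeNorm q a := by
  have : a = Finsupp.single p 1 + (a - Finsupp.single p 1) := by
    ext p'
    rcases eq_or_ne p p' with rfl | h'
    · simp
      omega
    · simp [Finsupp.single_eq_of_ne' h']
  rw [this, freeNorm_add, freeNorm_single, pow_one]
  exact Nat.le_mul_of_pos_right _ (h.pos _)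

/-- The three monomials in nine elements of the free monoid. -/
noncomputable def rayMonomial (z : Ray → P →₀ ℕ) (i : Fin 3) : P →₀ ℕ :=
  3 • z (.inl i) + ∑ j, expo i j • z (.inr j)

theorem rayMonomial_apply (z : Ray → P →₀ ℕ) (i : Fin 3) (p : P) :
    rayMonomial z i p = exponent (fun r => z r p) i := by
  simp [rayMonomial, exponent]

theorem rayMonomial_add (z w : Ray → P →₀ ℕ) (i : Fin 3) :
    rayMonomial (z + w) i = rayMonomial z i + rayMonomial w i := by
  simp only [rayMonomial, Pi.add_apply, smul_add, Finset.sum_add_distrib]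
  abel

theorem freeNorm_rayMonomial (z : Ray → P →₀ ℕ) (i : Fin 3) :
    (freeNorm q (rayMonomial z i) : ℝ) = (freeNorm q (z (.inl i)) : ℝ) ^ 3 *
      HasLinearCount.monomial (freeNorm q) i fun j => z (.inr j) := by
  rw [rayMonomial, freeNorm_add, freeNorm_nsmul, freeNorm_sum, HasLinearCount.monomial]
  simp [freeNorm_nsmul]

theorem prod_freeNorm_rayMonomial (z : Ray → P →₀ ℕ) :
    ∏ i, (freeNorm q (rayMonomial z i) : ℝ) = (∏ r, (freeNorm q (z r) : ℝ)) ^ 3 := by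
  simp only [freeNorm_rayMonomial]
  rw [Finset.prod_mul_distrib, HasLinearCount.prod_monomial, Fintype.prod_sum_type, mul_pow,
    Finset.prod_pow]

variable (q) in
/-- Coprime triples whose product is a cube, of bounded norm. -/
def cubicTriples (B : ℝ) : Set (Fin 3 → P →₀ ℕ) :=
  {a | (∀ p, (∃ i, a i p = 0) ∧ 3 ∣ ∑ i, a i p) ∧ ∀ i, (freeNorm q (a i) : ℝ) ≤ B}

variable (q) in
/-- Nine-tuples supported on the cones of the fan, with monomials of bounded norm. -/
def coneTuples (B : ℝ) : Set (Ray → P →₀ ℕ) :=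
  {z | (∀ p, IsCone (raySupport fun r => z r p)) ∧ ∀ i, (freeNorm q (rayMonomial z i) : ℝ) ≤ B}

/-- The correspondence is decided prime by prime: each admissible exponent vector lies on the fan
and has exactly one expression along it. -/
theorem bijOn_rayMonomial (B : ℝ) :
    BijOn rayMonomial (coneTuples q B) (cubicTriples q B) := by
  refine ⟨?_, ?_, ?_⟩
  · intro z hz
    refine ⟨fun p => ?_, hz.2⟩
    simp only [rayMonomial_apply]
    exact exists_zero_and_dvd_of_isCone (hz.1 p)
  · intro z hz w hw hzw
    have h : ∀ p, (fun r => z r p) = fun r => w r p := by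
      intro p
      rw [(hz.1 p).eq_recover, (hw.1 p).eq_recover]
      simp only [← rayMonomial_apply, hzw]
    ext r p
    exact congrFun (h p) r
  · intro a ha
    choose v hv hva using fun p => exists_isCone_exponent_eq (fun i => a i p) (ha.1 p).1 (ha.1 p).2
    -- The vectors chosen prime by prime vanish wherever all three `a i` do, so they assemble to
    -- finitely supported functions.
    have hsupp : ∀ r, {p | v p r ≠ 0} ⊆ ⋃ i, ((a i).support : Set P) := by
      intro r p hp
      by_contra hcon
      simp only [mem_iUnion, Finset.mem_coe, Finsupp.mem_support_iff, not_exists, not_not] at hcon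
      have h0 : v p = 0 := by
        rw [(hv p).eq_recover]
        simp only [hva, hcon]
        ext (i | i) <;> fin_cases i <;> rfl
      exact hp (by rw [h0]; rfl)
    have hfin : ∀ r, {p | v p r ≠ 0}.Finite := fun r =>
      (finite_iUnion fun i => (a i).support.finite_toSet).subset (hsupp r)
    set z : Ray → P →₀ ℕ := fun r => Finsupp.ofSupportFinite (fun p => v p r) (hfin r) with hz
    have hzp : ∀ p, (fun r => z r p) = v p := fun p => rfl
    have hza : rayMonomial z = a := by
      ext i p
      rw [rayMonomial_apply, hzp, hva]
    refine ⟨z, ⟨fun p => by rw [hzp]; exact hv p, ?_⟩, hza⟩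
    rw [hza]
    exact ha.2

/-- Dividing by `e` turns the divisibility condition into a rescaling of the height conditions by
the norms of the monomials of `e`. -/
theorem finite_ncard_multiples {κ : ℝ} (h : HasLinearCount (freeNorm q) κ) {B : ℝ} (hB : 0 ≤ B)
    (e : Ray → P →₀ ℕ) :
    {z : Ray → P →₀ ℕ | e ≤ z ∧ ∀ i, (freeNorm q (rayMonomial z i) : ℝ) ≤ B}.Finite ∧
    {z : Ray → P →₀ ℕ | e ≤ z ∧ ∀ i, (freeNorm q (rayMonomial z i) : ℝ) ≤ B}.ncard =
      (HasLinearCount.solutionSet (freeNorm q)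
        (fun i => freeNorm q (rayMonomial e i)) B).ncard := by
  have himg : {z : Ray → P →₀ ℕ | e ≤ z ∧ ∀ i, (freeNorm q (rayMonomial z i) : ℝ) ≤ B} =
      (fun x : (Fin 3 → P →₀ ℕ) × (Fin 6 → P →₀ ℕ) => Sum.elim x.1 x.2 + e) ''
        HasLinearCount.solutionSet (freeNorm q) (fun i => freeNorm q (rayMonomial e i)) B := by
    have hkey : ∀ (x : (Fin 3 → P →₀ ℕ) × (Fin 6 → P →₀ ℕ)) (i : Fin 3),
        (freeNorm q (rayMonomial (Sum.elim x.1 x.2 + e) i) : ℝ) =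
          freeNorm q (rayMonomial e i) * ((freeNorm q (x.1 i) : ℝ) ^ 3 *
            HasLinearCount.monomial (freeNorm q) i x.2) := by
      intro x i
      rw [rayMonomial_add, freeNorm_add, Nat.cast_mul, freeNorm_rayMonomial, mul_comm]
      simp
    ext z
    constructor
    · rintro ⟨hez, hz⟩
      have hsub : Sum.elim (fun i => (z - e) (.inl i)) (fun j => (z - e) (.inr j)) + e = z := by
        exact (congrArg (· + e) (Sum.elim_comp_inl_inr (z - e))).trans (tsub_add_cancel_of_le hez)
      refine ⟨(fun i => (z - e) (.inl i), fun j => (z - e) (.inr j)), fun i => ?_, hsub⟩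
      rw [← hkey]
      simp only [hsub]
      exact hz i
    · rintro ⟨x, hx, rfl⟩
      refine ⟨le_add_self, fun i => ?_⟩
      rw [hkey]
      exact hx i
  have hinj : Function.Injective
      fun x : (Fin 3 → P →₀ ℕ) × (Fin 6 → P →₀ ℕ) => Sum.elim x.1 x.2 + e := by
    intro x y hxy
    have := add_right_cancel hxy
    refine Prod.ext ?_ ?_
    · simpa using congrArg (fun f => f ∘ Sum.inl) this
    · simpa using congrArg (fun f => f ∘ Sum.inr) this
  rw [himg]
  exact ⟨((h.solutionSet_finite_ncard (fun i => h.one_le _) hB).1).image _,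
    ncard_image_of_injective _ hinj⟩

/-- The squarefree nine-tuple with prescribed supports. -/
noncomputable def squarefreeTuple {Q : Finset P} (J : Q → Finset Ray) (r : Ray) : P →₀ ℕ :=
  ∑ p : Q, if r ∈ J p then Finsupp.single (p : P) 1 else 0

theorem squarefreeTuple_apply {Q : Finset P} (J : Q → Finset Ray) (r : Ray) (p : Q) :
    squarefreeTuple J r p = if r ∈ J p then 1 else 0 := by
  classical
  rw [squarefreeTuple, Finsupp.finsetSum_apply, Finset.sum_eq_single p]
  · split_ifs <;> simp
  · intro p' _ hp'
    have : (p' : P) ≠ p := fun h => hp' (Subtype.ext h)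
    split_ifs <;> simp [this]
  · simp

theorem squarefreeTuple_apply_of_notMem {Q : Finset P} (J : Q → Finset Ray) (r : Ray) {p : P}
    (hp : p ∉ Q) : squarefreeTuple J r p = 0 := by
  classical
  rw [squarefreeTuple, Finsupp.finsetSum_apply]
  refine Finset.sum_eq_zero fun p' _ => ?_
  have : (p' : P) ≠ p := fun h => hp (h ▸ p'.2)
  split_ifs <;> simp [this]

theorem squarefreeTuple_le_iff {Q : Finset P} (J : Q → Finset Ray) (z : Ray → P →₀ ℕ) :
    squarefreeTuple J ≤ z ↔ ∀ p : Q, J p ⊆ raySupport fun r => z r p := by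
  constructor
  · intro h p r hr
    rw [mem_raySupport]
    have := h r p
    rw [squarefreeTuple_apply, if_pos hr] at this
    omega
  · intro h r p
    by_cases hp : p ∈ Q
    · rw [squarefreeTuple_apply J r ⟨p, hp⟩]
      split_ifs with hr
      · have := mem_raySupport.1 (h ⟨p, hp⟩ hr)
        simp only at this
        omega
      · exact Nat.zero_le _
    · rw [squarefreeTuple_apply_of_notMem J r hp]
      exact Nat.zero_le _

theorem prod_freeNorm_squarefreeTuple {Q : Finset P} (J : Q → Finset Ray) :
    ∏ r, (freeNorm q (squarefreeTuple J r) : ℝ) = ∏ p : Q, (q p : ℝ) ^ (J p).card := by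
  have h : ∀ r, (freeNorm q (squarefreeTuple J r) : ℝ) =
      ∏ p : Q, if r ∈ J p then (q p : ℝ) else 1 := by
    intro r
    rw [squarefreeTuple, freeNorm_sum, Nat.cast_prod]
    refine Finset.prod_congr rfl fun p _ => ?_
    split_ifs
    · rw [freeNorm_single, pow_one]
    · rw [freeNorm_zero, Nat.cast_one]
  simp only [h]
  rw [Finset.prod_comm]
  refine Finset.prod_congr rfl fun p _ => ?_
  rw [Finset.prod_ite_mem, Finset.univ_inter, Finset.prod_const]

-- Primes of norm above `B` cannot divide a tuple in question, so the cone condition matters only on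
-- `Q`. The product over `Q` of the local indicators is expanded by `sum_coneMoebius_subset`;
-- requiring `J p` to lie in the support at every `p` is divisibility by `squarefreeTuple J`.
open scoped Classical in
theorem ncard_coneTuples {κ : ℝ} (h : HasLinearCount (freeNorm q) κ) {B : ℝ} (hB : 0 ≤ B)
    (Q : Finset P) (hQ : ∀ p, (q p : ℝ) ≤ B → p ∈ Q) :
    (coneTuples q B).Finite ∧ ((coneTuples q B).ncard : ℝ) =
      ∑ J : Q → Finset Ray, (∏ p, coneMoebius (J p)) *
        (HasLinearCount.solutionSet (freeNorm q)
          (fun i => freeNorm q (rayMonomial (squarefreeTuple J) i)) B).ncard := by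
  classical
  set Z : Set (Ray → P →₀ ℕ) := {z | ∀ i, (freeNorm q (rayMonomial z i) : ℝ) ≤ B} with hZ
  have hZfin : Z.Finite := by
    have := (finite_ncard_multiples h hB 0).1
    refine this.subset fun z hz => ⟨fun r p => Nat.zero_le _, hz⟩
  set Zf := hZfin.toFinset with hZf
  have hmemZ : ∀ z, z ∈ Zf ↔ ∀ i, (freeNorm q (rayMonomial z i) : ℝ) ≤ B := fun z => by
    simp [hZf, hZ]
  have hsub : coneTuples q B ⊆ Z := fun z hz => hz.2
  refine ⟨hZfin.subset hsub, ?_⟩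
  have hsuppQ : ∀ z ∈ Zf, ∀ p, p ∉ Q → raySupport (fun r => z r p) = ∅ := by
    intro z hz p hp
    rw [hmemZ] at hz
    rw [Finset.eq_empty_iff_forall_notMem]
    intro r hr
    rw [mem_raySupport] at hr
    have hmon : ∃ i, rayMonomial z i p ≠ 0 := by
      rcases r with i | j
      · refine ⟨i, ?_⟩
        rw [rayMonomial_apply, exponent]
        omega
      · obtain ⟨i, hi⟩ := HasLinearCount.exists_one_le_expo j
        refine ⟨i, ?_⟩
        rw [rayMonomial_apply, exponent]
        have := Finset.single_le_sum (f := fun j => expo i j * z (.inr j) p)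
          (fun _ _ => Nat.zero_le _) (Finset.mem_univ j)
        have h2 : 0 < expo i j * z (.inr j) p := Nat.mul_pos hi (Nat.pos_of_ne_zero hr)
        omega
    obtain ⟨i, hi⟩ := hmon
    refine hp (hQ p (le_trans ?_ (hz i)))
    exact_mod_cast le_freeNorm h hi
  have hcone : coneTuples q B =
      (Zf.filter fun z => ∀ p : Q, IsCone (raySupport fun r => z r p) : Finset _) := by
    ext z
    simp only [coneTuples, mem_ofPred_eq, Finset.coe_filter, hmemZ]
    constructor
    · rintro ⟨h1, h2⟩
      exact ⟨h2, fun p => h1 p⟩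
    · rintro ⟨h1, h2⟩
      refine ⟨fun p => ?_, h1⟩
      by_cases hp : p ∈ Q
      · exact h2 ⟨p, hp⟩
      · rw [hsuppQ z ((hmemZ z).2 h1) p hp]
        exact ⟨0, by simp⟩
  have hterm : ∀ z, (if ∀ p : Q, IsCone (raySupport fun r => z r p) then (1 : ℝ) else 0) =
      ∑ J : Q → Finset Ray, (∏ p, coneMoebius (J p)) *
        if squarefreeTuple J ≤ z then 1 else 0 := by
    intro z
    rw [← Fintype.prod_boole]
    simp only [← sum_coneMoebius_subset]
    rw [Finset.prod_univ_sum, Fintype.piFinset_univ]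
    refine Finset.sum_congr rfl fun J _ => ?_
    rw [Finset.prod_mul_distrib, Fintype.prod_boole]
    simp only [squarefreeTuple_le_iff]
  rw [hcone, ncard_coe_finset, Finset.card_filter]
  push_cast
  simp only [hterm]
  rw [Finset.sum_comm]
  refine Finset.sum_congr rfl fun J _ => ?_
  rw [← Finset.mul_sum, ← (finite_ncard_multiples h hB (squarefreeTuple J)).2, Finset.sum_boole]
  congr 2
  rw [← ncard_coe_finset]
  congr 1
  ext z
  simp [hmemZ, and_comm]

end Sieve

end ToricCubic

/-! ### Convergence of a power sum over all elements -/

namespace ToricCubic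

namespace HasLinearCount

open MeasureTheory Set

variable {A : Type*} {N : A → ℕ} {κ : ℝ}

/-- The exponent `3/2` is twice the `3/4` that survives in the sieve error. Boundedness of the
partial sums needs only the upper bound O(X) for the counting function. -/
theorem exists_sum_rpow_neg_three_halves_le (h : HasLinearCount N κ) :
    ∃ C : ℝ, ∀ X : ℝ, 1 ≤ X → ∑ a ∈ h.ball X, (N a : ℝ) ^ (-(3 / 2) : ℝ) ≤ C := by
  obtain ⟨C, hC0, hC⟩ := h.exists_card_le
  -- The boundary term gives `C` and the integral gives `3/2 * C * 2`.
  refine ⟨4 * C, fun X hX => ?_⟩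
  have hX0 : 0 < X := by linarith
  have hne : ∀ t ∈ Icc 1 X, t ≠ 0 := fun t ht => by linarith [ht.1]
  have hder : ∀ t : ℝ, t ≠ 0 → deriv (fun x : ℝ => x ^ (-(3 / 2) : ℝ)) t =
      -(3 / 2) * t ^ (-(5 / 2) : ℝ) := fun t ht => by
    rw [Real.deriv_rpow_const]
    norm_num
  have hi2 : IntegrableOn (fun t : ℝ => t ^ (-(3 / 2) : ℝ)) (Ioc 1 X) :=
    ((continuousOn_id.rpow_const fun t ht => Or.inl (hne t ht)).integrableOn_Icc).mono_set
      Ioc_subset_Icc_self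
  rw [h.sum_ball_eq (f := fun x => x ^ (-(3 / 2) : ℝ)) hX
    (fun t ht => Real.differentiableAt_rpow_const_of_ne _ (hne t ht)) ?_]
  · have h1 : X ^ (-(3 / 2) : ℝ) * ((h.ball X).card : ℝ) ≤ C := by
      refine (mul_le_mul_of_nonneg_left (hC X hX) (by positivity)).trans ?_
      rw [mul_left_comm, ← Real.rpow_add_one hX0.ne']
      exact mul_le_of_le_one_right hC0 (Real.rpow_le_one_of_one_le_of_nonpos hX (by norm_num))
    have hrpow : ∫ t in Ioc 1 X, t ^ (-(3 / 2) : ℝ) ≤ 2 := by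
      rw [← intervalIntegral.integral_of_le hX, integral_rpow (Or.inr ⟨by norm_num, by
        rw [uIcc_of_le hX]; exact fun h0 => by linarith [h0.1]⟩)]
      have : 0 ≤ X ^ (-(3 / 2) + 1 : ℝ) := by positivity
      rw [Real.one_rpow, div_le_iff_of_neg (by norm_num)]
      linarith
    have h2 : ‖∫ t in Ioc 1 X, deriv (fun x : ℝ => x ^ (-(3 / 2) : ℝ)) t * (h.ball t).card‖ ≤
        ∫ t in Ioc 1 X, 3 / 2 * C * t ^ (-(3 / 2) : ℝ) := by
      refine norm_integral_le_of_norm_le (hi2.const_mul _)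
        ((ae_restrict_mem measurableSet_Ioc).mono fun t ht => ?_)
      have ht0 : 0 < t := by linarith [ht.1]
      rw [hder t ht0.ne', norm_mul, norm_mul, Real.norm_eq_abs, Real.norm_eq_abs,
        Real.norm_eq_abs, abs_of_nonneg (by positivity : 0 ≤ t ^ (-(5 / 2) : ℝ)),
        abs_of_nonneg (by positivity : (0 : ℝ) ≤ (h.ball t).card)]
      refine (mul_le_mul_of_nonneg_left (hC t ht.1.le) (by positivity)).trans_eq ?_
      have : t ^ (-(5 / 2) : ℝ) * t = t ^ (-(3 / 2) : ℝ) := by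
        rw [← Real.rpow_add_one ht0.ne']
        norm_num
      rw [← this]
      norm_num
      ring
    rw [integral_const_mul] at h2
    have h3 := (abs_le.1 ((Real.norm_eq_abs _) ▸ h2)).1
    nlinarith
  · refine IntegrableOn.congr_fun (f := fun t : ℝ => -(3 / 2) * t ^ (-(5 / 2) : ℝ)) ?_
      (fun t ht => (hder t (hne t ht)).symm) measurableSet_Icc
    exact (continuousOn_const.mul (continuousOn_id.rpow_const
      fun t ht => Or.inl (hne t ht))).integrableOn_Icc

theorem summable_rpow (h : HasLinearCount N κ) :
    Summable fun a => (N a : ℝ) ^ (-(3 / 2) : ℝ) := by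
  obtain ⟨C, hC⟩ := h.exists_sum_rpow_neg_three_halves_le
  refine summable_of_sum_le (c := C) (fun a => by positivity) fun s => ?_
  have hs : s ⊆ h.ball (1 + ∑ a ∈ s, (N a : ℝ)) := by
    intro a ha
    rw [mem_ball]
    have := Finset.single_le_sum (f := fun a => (N a : ℝ)) (fun _ _ => by positivity) ha
    linarith
  refine (Finset.sum_le_sum_of_subset_of_nonneg hs fun _ _ _ => by positivity).trans (hC _ ?_)
  have : 0 ≤ ∑ a ∈ s, (N a : ℝ) := by positivity
  linarith

end HasLinearCount

/-! ### The Euler product and the number of cubic triples -/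

section EulerProduct

open Set Filter

variable {P : Type*} {q : P → ℕ} {κ : ℝ}

/-- Primes are among the elements of the free monoid, so no information on their distribution is
needed. -/
theorem summable_prime_rpow (h : HasLinearCount (freeNorm q) κ) :
    Summable fun p => (q p : ℝ) ^ (-(3 / 2) : ℝ) := by
  have hinj : Function.Injective fun p : P => (Finsupp.single p 1 : P →₀ ℕ) :=
    Finsupp.single_left_injective one_ne_zero
  have := h.summable_rpow.comp_injective hinj
  refine this.congr fun p => ?_
  simp [freeNorm_single]

theorem abs_local_factor_sub_one_le {x : ℝ} (hx0 : 0 ≤ x) (hx1 : x ≤ 1) :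
    |(1 - x) ^ 7 * (1 + 7 * x + x ^ 2) - 1| ≤ 2 ^ 18 * x ^ 2 := by
  rw [← sum_coneMoebius_mul_pow, ← Finset.add_sum_erase _ _ (Finset.mem_univ ∅)]
  have h2 := sum_abs_coneMoebius_le hx0 hx1
  rw [← Finset.add_sum_erase _ _ (Finset.mem_univ ∅)] at h2
  simp only [coneMoebius_empty, Finset.card_empty, pow_zero, mul_one, abs_one] at h2 ⊢
  rw [add_sub_cancel_left]
  refine (Finset.abs_sum_le_sum_abs _ _).trans ?_
  simp only [abs_mul, abs_of_nonneg (pow_nonneg hx0 _)]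
  linarith

variable (q) in
/-- The Euler factor `(1 - 1/q)⁷ (1 + 7/q + 1/q²)`. -/
noncomputable def localFactor (p : P) : ℝ :=
  (1 - 1 / (q p : ℝ)) ^ 7 * (1 + 7 / (q p : ℝ) + 1 / (q p : ℝ) ^ 2)

theorem localFactor_eq (p : P) : localFactor q p =
    (1 - (q p : ℝ)⁻¹) ^ 7 * (1 + 7 * (q p : ℝ)⁻¹ + (q p : ℝ)⁻¹ ^ 2) := by
  rw [localFactor]
  ring

theorem localFactor_pos (hq : ∀ p, 2 ≤ q p) (p : P) : 0 < localFactor q p := by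
  have h2 : (2 : ℝ) ≤ q p := by exact_mod_cast hq p
  have h1 : (q p : ℝ)⁻¹ ≤ 2⁻¹ := inv_anti₀ (by norm_num) h2
  have h0 : 0 < (q p : ℝ)⁻¹ := by positivity
  rw [localFactor_eq]
  have : 0 < 1 - (q p : ℝ)⁻¹ := by linarith
  positivity

theorem summable_localFactor_sub_one (h : HasLinearCount (freeNorm q) κ) (hq : ∀ p, 2 ≤ q p) :
    Summable fun p => localFactor q p - 1 := by
  refine Summable.of_norm_bounded ((summable_prime_rpow h).mul_left (2 ^ 18)) fun p => ?_
  have h1 : (1 : ℝ) ≤ q p := by exact_mod_cast (by norm_num : 1 ≤ 2).trans (hq p)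
  rw [localFactor_eq, Real.norm_eq_abs]
  refine (abs_local_factor_sub_one_le (by positivity) (inv_le_one_of_one_le₀ h1)).trans ?_
  refine mul_le_mul_of_nonneg_left ?_ (by norm_num)
  rw [inv_pow, ← Real.rpow_natCast, ← Real.rpow_neg (by positivity)]
  exact Real.rpow_le_rpow_of_exponent_le h1 (by norm_num)

theorem multipliable_localFactor (h : HasLinearCount (freeNorm q) κ) (hq : ∀ p, 2 ≤ q p) :
    Multipliable (localFactor q) := by
  have := Real.multipliable_one_add_of_summable (summable_localFactor_sub_one h hq)
  simpa using this

theorem tprod_localFactor_pos (h : HasLinearCount (freeNorm q) κ) (hq : ∀ p, 2 ≤ q p) :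
    0 < ∏' p, localFactor q p := by
  have hs := Real.summable_log_one_add_of_summable (summable_localFactor_sub_one h hq)
  simp only [add_sub_cancel] at hs
  rw [← Real.rexp_tsum_eq_tprod (localFactor_pos hq) hs]
  exact Real.exp_pos _

theorem prod_one_add_le_exp_tsum {f : P → ℝ} (hf : Summable f) (h0 : ∀ p, 0 ≤ f p)
    (Q : Finset P) : ∏ p : Q, (1 + f p) ≤ Real.exp (∑' p, f p) := by
  calc _ ≤ ∏ p : Q, Real.exp (f p) := by
        refine Finset.prod_le_prod (fun p _ => by linarith [h0 p]) fun p _ => ?_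
        rw [add_comm]
        exact Real.add_one_le_exp _
    _ = Real.exp (∑ p ∈ Q, f p) := by
        rw [← Real.exp_sum, Finset.sum_coe_sort Q f]
    _ ≤ _ := Real.exp_le_exp.2 (hf.sum_le_tsum _ fun p _ => h0 p)

open scoped Classical in
theorem sum_prod_coneMoebius_div (Q : Finset P) :
    ∑ J : Q → Finset Ray, (∏ p, coneMoebius (J p)) * (∏ p : Q, (q p : ℝ) ^ (J p).card)⁻¹ =
      ∏ p ∈ Q, localFactor q p := by
  classical
  rw [← Finset.prod_coe_sort Q (localFactor q)]
  simp only [localFactor_eq, ← sum_coneMoebius_mul_pow]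
  rw [Finset.prod_univ_sum, Fintype.piFinset_univ]
  refine Finset.sum_congr rfl fun J _ => ?_
  rw [Finset.prod_mul_distrib, ← Finset.prod_inv_distrib]
  simp only [inv_pow]

/-- From log E ≤ 4E^(1/4). Giving up E^(1/4) for the logarithms leaves E^(-3/4) of the factor E⁻¹ in
the error term. -/
theorem one_add_three_mul_log_le {E : ℝ} (hE : 1 ≤ E) :
    1 + 3 * Real.log E ≤ 13 * E ^ (1 / 4 : ℝ) := by
  have h1 := Real.log_le_rpow_div (by linarith : 0 ≤ E) (by norm_num : (0 : ℝ) < 1 / 4)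
  have h2 : 1 ≤ E ^ (1 / 4 : ℝ) := Real.one_le_rpow hE (by norm_num)
  linarith

-- The sum factors over the primes of `Q`. With x = q^(-3/4), each factor is at most 1 + 2¹⁸
-- q^(-3/2) by the missing linear term, which gives a bound independent of `Q`.
open scoped Classical in
theorem sum_prod_abs_coneMoebius_le (h : HasLinearCount (freeNorm q) κ) (hq : ∀ p, 2 ≤ q p)
    (Q : Finset P) :
    ∑ J : Q → Finset Ray, (∏ p, |coneMoebius (J p)|) *
      (∏ p : Q, (q p : ℝ) ^ (J p).card) ^ (-(3 / 4) : ℝ) ≤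
      Real.exp (∑' p, 2 ^ 18 * (q p : ℝ) ^ (-(3 / 2) : ℝ)) := by
  classical
  refine le_trans (le_of_eq_of_le ?_ (Finset.prod_le_prod (s := (Finset.univ : Finset Q))
    (f := fun p : Q => ∑ J, |coneMoebius J| * ((q p : ℝ) ^ (-(3 / 4) : ℝ)) ^ J.card)
    (g := fun p : Q => 1 + 2 ^ 18 * (q p : ℝ) ^ (-(3 / 2) : ℝ)) (fun p _ => by positivity) ?_))
    (prod_one_add_le_exp_tsum ((summable_prime_rpow h).mul_left (2 ^ 18))
      (fun p => by positivity) Q)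
  · rw [Finset.prod_univ_sum, Fintype.piFinset_univ]
    refine Finset.sum_congr rfl fun J _ => ?_
    rw [Finset.prod_mul_distrib, ← Real.finsetProd_rpow _ _ fun _ _ => by positivity]
    congr 1
    refine Finset.prod_congr rfl fun p _ => ?_
    rw [← Real.rpow_natCast, ← Real.rpow_natCast, ← Real.rpow_mul (by positivity),
      ← Real.rpow_mul (by positivity), mul_comm]
  · intro p _
    have h1 : (1 : ℝ) ≤ q p := by exact_mod_cast (by norm_num : 1 ≤ 2).trans (hq p)
    refine (sum_abs_coneMoebius_le (by positivity)
      (Real.rpow_le_one_of_one_le_of_nonpos h1 (by norm_num))).trans_eq ?_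
    rw [← Real.rpow_natCast _ 2, ← Real.rpow_mul (by positivity)]
    norm_num

theorem cubicTriples_finite (h : HasLinearCount (freeNorm q) κ) (B : ℝ) :
    (cubicTriples q B).Finite := by
  refine (Set.Finite.pi' fun _ : Fin 3 => h.finite B).subset fun a ha => ha.2

theorem ncard_cubicTriples (B : ℝ) : (cubicTriples q B).ncard = (coneTuples q B).ncard := by
  have := bijOn_rayMonomial (q := q) B
  rw [← this.image_eq, this.injOn.ncard_image]

theorem ncard_cubicTriples_bound_of_finset (h : HasLinearCount (freeNorm q) κ)
    (hq : ∀ p, 2 ≤ q p) : ∃ C : ℝ, ∀ B : ℝ, 1 ≤ Real.log B → 1 ≤ B → ∀ Q : Finset P,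
      (∀ p, (q p : ℝ) ≤ B → p ∈ Q) →
      |((cubicTriples q B).ncard : ℝ) -
        κ ^ 9 / 2880 * (∏ p ∈ Q, localFactor q p) * B * Real.log B ^ 6| ≤
        C * (B * Real.log B ^ 5) := by
  classical
  obtain ⟨C, hC0, hC⟩ := h.exists_solutionSet_bound
  set S := Real.exp (∑' p, 2 ^ 18 * (q p : ℝ) ^ (-(3 / 2) : ℝ)) with hS
  refine ⟨13 * C * S, fun B hL hB Q hQ => ?_⟩
  set L := Real.log B with hLdef
  rw [ncard_cubicTriples, (ncard_coneTuples h (by linarith) Q hQ).2, ← sum_prod_coneMoebius_div]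
  have hE : ∀ J : Q → Finset Ray, 1 ≤ ∏ p : Q, (q p : ℝ) ^ (J p).card := by
    intro J
    rw [← Finset.prod_const_one (s := (Finset.univ : Finset Q))]
    refine Finset.prod_le_prod (fun _ _ => zero_le_one) fun p _ => one_le_pow₀ ?_
    exact_mod_cast (by norm_num : 1 ≤ 2).trans (hq p)
  have hterm : ∀ J : Q → Finset Ray, |((HasLinearCount.solutionSet (freeNorm q)
          (fun i => freeNorm q (rayMonomial (squarefreeTuple J) i)) B).ncard : ℝ) -
        κ ^ 9 / 2880 * B * L ^ 6 * (∏ p : Q, (q p : ℝ) ^ (J p).card)⁻¹| ≤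
        13 * C * (B * L ^ 5) * (∏ p : Q, (q p : ℝ) ^ (J p).card) ^ (-(3 / 4) : ℝ) := by
    intro J
    set E := ∏ p : Q, (q p : ℝ) ^ (J p).card with hEdef
    have hE1 : 1 ≤ E := hE J
    have hE0 : 0 < E := by linarith
    set D : Fin 3 → ℝ := fun i => freeNorm q (rayMonomial (squarefreeTuple J) i) with hD
    -- Each of the nine rays has coordinate sum 3, so the cube root in the uniform estimate is
    -- exactly `E`.
    have hprod : ∏ i, D i = E ^ 3 := by
      rw [hD, prod_freeNorm_rayMonomial, prod_freeNorm_squarefreeTuple]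
    have hroot : (∏ i, D i) ^ (1 / 3 : ℝ) = E := by
      rw [hprod, ← Real.rpow_natCast, ← Real.rpow_mul hE0.le]
      norm_num
    have hlog : ∑ i, Real.log (D i) = 3 * Real.log E := by
      rw [← Real.log_prod fun i _ => by have := h.one_le (rayMonomial (squarefreeTuple J) i); positivity,
        hprod, Real.log_pow]
      norm_num
    have key := hC D B (fun i => h.one_le _) hL hB
    rw [hroot, hlog] at key
    have e1 : κ ^ 9 / 2880 * (B / E) * L ^ 6 = κ ^ 9 / 2880 * B * L ^ 6 * E⁻¹ := by ring
    rw [← hLdef, e1] at key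
    refine key.trans ?_
    calc _ ≤ C * (B / E) * L ^ 5 * (13 * E ^ (1 / 4 : ℝ)) :=
          mul_le_mul_of_nonneg_left (one_add_three_mul_log_le hE1) (by positivity)
      _ = 13 * C * (B * L ^ 5) * (E ^ (1 / 4 : ℝ) * E⁻¹) := by ring
      _ = _ := by
          rw [← Real.rpow_neg_one E, ← Real.rpow_add hE0]
          norm_num
  have e2 : ∀ J : Q → Finset Ray, ∀ n : ℝ, (∏ p, coneMoebius (J p)) * n -
      κ ^ 9 / 2880 * B * L ^ 6 * ((∏ p, coneMoebius (J p)) * (∏ p : Q, (q p : ℝ) ^ (J p).card)⁻¹) =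
      (∏ p, coneMoebius (J p)) * (n - κ ^ 9 / 2880 * B * L ^ 6 *
        (∏ p : Q, (q p : ℝ) ^ (J p).card)⁻¹) := fun J n => by ring
  rw [show ∀ T : ℝ, κ ^ 9 / 2880 * T * B * L ^ 6 = κ ^ 9 / 2880 * B * L ^ 6 * T from
    fun T => by ring, Finset.mul_sum, ← Finset.sum_sub_distrib]
  simp only [e2]
  refine (Finset.abs_sum_le_sum_abs _ _).trans ?_
  calc _ ≤ ∑ J : Q → Finset Ray, 13 * C * (B * L ^ 5) * ((∏ p, |coneMoebius (J p)|) *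
      (∏ p : Q, (q p : ℝ) ^ (J p).card) ^ (-(3 / 4) : ℝ)) := by
        refine Finset.sum_le_sum fun J _ => ?_
        rw [abs_mul, Finset.abs_prod]
        refine (mul_le_mul_of_nonneg_left (hterm J) (by positivity)).trans_eq ?_
        ring
    _ ≤ 13 * C * (B * L ^ 5) * S := by
        rw [← Finset.mul_sum]
        exact mul_le_mul_of_nonneg_left (sum_prod_abs_coneMoebius_le h hq Q) (by positivity)
    _ = _ := by ring

/-- The count and the error bound do not depend on `Q`, so the finite product may be replaced by its
limit. -/
theorem ncard_cubicTriples_bound (h : HasLinearCount (freeNorm q) κ) (hq : ∀ p, 2 ≤ q p) :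
    ∃ C : ℝ, ∀ B : ℝ, 1 ≤ Real.log B → 1 ≤ B →
      |((cubicTriples q B).ncard : ℝ) -
        κ ^ 9 / 2880 * (∏' p, localFactor q p) * B * Real.log B ^ 6| ≤
        C * (B * Real.log B ^ 5) := by
  classical
  obtain ⟨C, hC⟩ := ncard_cubicTriples_bound_of_finset h hq
  refine ⟨C, fun B hL hB => ?_⟩
  have hfin : {p : P | (q p : ℝ) ≤ B}.Finite := by
    refine Finite.of_finite_image ((h.finite B).subset ?_)
      ((Finsupp.single_left_injective (M := ℕ) one_ne_zero).injOn)
    rintro _ ⟨p, hp, rfl⟩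
    simpa [freeNorm_single] using hp
  have hprod := (multipliable_localFactor h hq).hasProd
  have hlim : Tendsto (fun Q : Finset P => |((cubicTriples q B).ncard : ℝ) -
        κ ^ 9 / 2880 * (∏ p ∈ Q, localFactor q p) * B * Real.log B ^ 6|) atTop
      (nhds |((cubicTriples q B).ncard : ℝ) -
        κ ^ 9 / 2880 * (∏' p, localFactor q p) * B * Real.log B ^ 6|) :=
    (tendsto_const_nhds.sub (((hprod.const_mul _).mul_const _).mul_const _)).abs
  refine le_of_tendsto hlim ?_
  filter_upwards [eventually_ge_atTop hfin.toFinset] with Q hQ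
  exact hC B hL hB Q fun p hp => hQ (by simpa using hp)

end EulerProduct

end ToricCubic

namespace ToricCubic

/-! ### Lattice points in a disc -/

section LatticePoints

open MeasureTheory Set Metric Module

variable {E ι : Type*} [NormedAddCommGroup E] [NormedSpace ℝ E] [FiniteDimensional ℝ E]
  [Finite ι]

theorem lattice_closedBall_finite (b : Basis ι ℝ E) (r : ℝ) :
    (closedBall (0 : E) r ∩ Submodule.span ℤ (range b)).Finite :=
  have := FiniteDimensional.proper ℝ E
  ZSpan.setFinite_inter b isBounded_closedBall

variable [MeasurableSpace E] [BorelSpace E]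

/-- The translates of the fundamental domain by the lattice points of norm at most r are disjoint,
lie in the ball of radius r + D and cover the ball of radius r - D, where D bounds the norm on the
domain. -/
theorem exists_abs_ncard_lattice_sub_le (b : Basis ι ℝ E) (μ : Measure E) [μ.IsAddHaarMeasure]
    (hE : finrank ℝ E = 2) : ∃ C : ℝ, ∀ r : ℝ, 1 ≤ r →
      |((closedBall (0 : E) r ∩ Submodule.span ℤ (range b)).ncard : ℝ) -
        μ.real (ball 0 1) / μ.real (ZSpan.fundamentalDomain b) * r ^ 2| ≤ C * r := by
  cases nonempty_fintype ι
  set L := Submodule.span ℤ (range b) with hL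
  set F := ZSpan.fundamentalDomain b with hF
  set D := ∑ i, ‖b i‖ with hD
  have hD0 : 0 ≤ D := by positivity
  set c := μ.real (ball (0 : E) 1) with hc
  have hc0 : 0 ≤ c := measureReal_nonneg
  have hFb : Bornology.IsBounded F := ZSpan.fundamentalDomain_isBounded b
  have hFm : MeasurableSet F := ZSpan.fundamentalDomain_measurableSet b
  have hF0 : 0 < μ.real F := by
    rw [measureReal_def]
    exact ENNReal.toReal_pos (ZSpan.measure_fundamentalDomain_ne_zero b) hFb.measure_lt_top.ne
  have hFD : ∀ x ∈ F, ‖x‖ ≤ D := by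
    intro x hx
    rw [← ZSpan.fract_eq_self.2 hx]
    exact ZSpan.norm_fract_le b x
  have hball : ∀ r : ℝ, 0 ≤ r → μ.real (closedBall (0 : E) r) = r ^ 2 * c := by
    intro r hr
    rw [measureReal_def, Measure.addHaar_closedBall μ 0 hr, hE, ENNReal.toReal_mul,
      ENNReal.toReal_ofReal (by positivity), hc, measureReal_def]
  -- (r + D)² - r² = 2rD + D² is at most (2D + D²)r because 1 ≤ r.
  refine ⟨c * (2 * D + D ^ 2) / μ.real F, fun r hr => ?_⟩
  have hfin := lattice_closedBall_finite b r
  set A := hfin.toFinset with hA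
  have hmemA : ∀ v, v ∈ A ↔ ‖v‖ ≤ r ∧ v ∈ L := fun v => by simp [hA, hL]
  have hn : (closedBall (0 : E) r ∩ L).ncard = A.card := ncard_eq_toFinset_card _ hfin
  set U : Set E := ⋃ v ∈ A, (fun x => -v + x) ⁻¹' F with hU
  have hmeas : μ.real U = A.card * μ.real F := by
    rw [hU, measureReal_biUnion_finset (h := fun v _ => by
      rw [measure_preimage_add]
      exact hFb.measure_lt_top.ne)]
    · simp only [measureReal_def, measure_preimage_add]
      simp
    · intro v hv w hw hvw
      refine disjoint_left.2 fun x hx hx' => hvw ?_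
      have hv' := ((hmemA v).1 hv).2
      have hw' := ((hmemA w).1 hw).2
      have e1 := ZSpan.fract_eq_self.2 hx
      have e2 := ZSpan.fract_eq_self.2 hx'
      rw [ZSpan.fract_zSpan_add b x (neg_mem hv')] at e1
      rw [ZSpan.fract_zSpan_add b x (neg_mem hw')] at e2
      exact neg_injective (add_right_cancel (e1.symm.trans e2))
    · exact fun v _ => hFm.preimage (measurable_const_add _)
  have hup : A.card * μ.real F ≤ (r + D) ^ 2 * c := by
    rw [← hmeas, ← hball _ (by positivity)]
    refine measureReal_mono (iUnion₂_subset fun v hv x hx => ?_)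
      isBounded_closedBall.measure_lt_top.ne
    rw [mem_closedBall_zero_iff]
    have h1 := hFD _ hx
    have h2 := ((hmemA v).1 hv).1
    calc ‖x‖ = ‖v + (-v + x)‖ := by simp
      _ ≤ _ := (norm_add_le _ _).trans (add_le_add h2 h1)
  -- For `r < D` there is no inner ball, but then the left side is not positive.
  have hlow : (r ^ 2 - 2 * r * D) * c ≤ A.card * μ.real F := by
    rcases lt_or_ge r D with hrD | hrD
    · have : (r ^ 2 - 2 * r * D) * c ≤ 0 := mul_nonpos_of_nonpos_of_nonneg (by nlinarith) hc0
      exact this.trans (by positivity)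
    · have hle : (r - D) ^ 2 * c ≤ A.card * μ.real F := by
        rw [← hmeas, ← hball _ (by linarith)]
        refine measureReal_mono (fun x hx => ?_) ?_
        · rw [mem_closedBall_zero_iff] at hx
          refine mem_iUnion₂.2 ⟨(ZSpan.floor b x : E), ?_, ?_⟩
          · refine (hmemA _).2 ⟨?_, (ZSpan.floor b x).2⟩
            have h1 := ZSpan.norm_fract_le b x
            calc ‖(ZSpan.floor b x : E)‖ = ‖x - ZSpan.fract b x‖ := by simp [ZSpan.fract_apply]
              _ ≤ ‖x‖ + ‖ZSpan.fract b x‖ := norm_sub_le _ _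
              _ ≤ r := by linarith
          · have := ZSpan.fract_mem_fundamentalDomain b x
            rwa [ZSpan.fract_apply, sub_eq_neg_add] at this
        · intro htop
          have h0 := hmeas
          rw [measureReal_def, htop] at h0
          refine (measure_biUnion_lt_top A.finite_toSet fun v _ => ?_).ne htop
          rw [measure_preimage_add]
          exact hFb.measure_lt_top
      nlinarith [mul_nonneg (sq_nonneg D) hc0]
  rw [hn]
  have e : (A.card : ℝ) - c / μ.real F * r ^ 2 = (A.card * μ.real F - c * r ^ 2) / μ.real F := by
    field_simp
  rw [e, abs_div, abs_of_pos hF0, div_mul_eq_mul_div, div_le_div_iff_of_pos_right hF0, abs_le]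
  have h3 : 0 ≤ c * D ^ 2 := by positivity
  have h4 : 0 ≤ c * D ^ 2 * (r - 1) := mul_nonneg h3 (by linarith)
  constructor <;> nlinarith

end LatticePoints

end ToricCubic

namespace ToricCubic

/-! ### Integers of bounded norm in an imaginary quadratic field -/

section RingOfIntegers

open scoped Classical
open MeasureTheory Set Metric Module NumberField NumberField.InfinitePlace

variable (K : Type*) [Field K] [NumberField K]

theorem nrComplexPlaces_eq_one (hquad : finrank ℚ K = 2) (himag : IsTotallyComplex K) :
    nrComplexPlaces K = 1 := by
  have h1 := card_add_two_mul_card_eq_rank K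
  have h2 := nrRealPlaces_eq_zero_iff.2 himag
  omega

theorem card_infinitePlace_eq_one (hquad : finrank ℚ K = 2) (himag : IsTotallyComplex K) :
    Fintype.card (InfinitePlace K) = 1 := by
  rw [card_eq_nrRealPlaces_add_nrComplexPlaces, nrRealPlaces_eq_zero_iff.2 himag,
    nrComplexPlaces_eq_one K hquad himag]

variable {K}

theorem infinitePlace_sq (hquad : finrank ℚ K = 2) (himag : IsTotallyComplex K)
    (w : InfinitePlace K) (x : 𝓞 K) :
    w (x : K) ^ 2 = (Ideal.absNorm (Ideal.span {x}) : ℝ) := by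
  obtain ⟨hu⟩ := Fintype.card_eq_one_iff_nonempty_unique.1 (card_infinitePlace_eq_one K hquad himag)
  have h1 := prod_eq_abs_norm (x : K)
  rw [Fintype.prod_unique, Subsingleton.elim default w, mult_isComplex ⟨w, himag.isComplex w⟩] at h1
  rw [h1, Ideal.absNorm_span_singleton, ← Algebra.coe_norm_int, Nat.cast_natAbs]
  simp

/-- With one complex place and no real one, the sup norm of the mixed space is the absolute value at
that place, so norm conditions are discs. -/
theorem norm_mixedEmbedding_sq (hquad : finrank ℚ K = 2) (himag : IsTotallyComplex K)
    (x : 𝓞 K) : ‖mixedEmbedding K (x : K)‖ ^ 2 = (Ideal.absNorm (Ideal.span {x}) : ℝ) := by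
  obtain ⟨hu⟩ := Fintype.card_eq_one_iff_nonempty_unique.1 (card_infinitePlace_eq_one K hquad himag)
  rw [← infinitePlace_sq hquad himag default x, mixedEmbedding.norm_eq_sup'_normAtPlace]
  simp [mixedEmbedding.normAtPlace_apply]

variable (K)

theorem volume_real_ball_mixedSpace (hquad : finrank ℚ K = 2) (himag : IsTotallyComplex K) :
    volume.real (ball (0 : mixedEmbedding.mixedSpace K) 1) = Real.pi := by
  have h : ball (0 : mixedEmbedding.mixedSpace K) 1 =
      mixedEmbedding.convexBodyLT K fun _ => 1 := by
    rw [mixedEmbedding.convexBodyLT, ← ball_pi _ (by simp), ← ball_pi _ (by simp)]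
    exact (ball_prod_same _ _ _).symm
  rw [measureReal_def, h, mixedEmbedding.convexBodyLT_volume]
  simp [mixedEmbedding.convexBodyLTFactor, nrRealPlaces_eq_zero_iff.2 himag,
    nrComplexPlaces_eq_one K hquad himag]

theorem volume_real_fundamentalDomain (hquad : finrank ℚ K = 2) (himag : IsTotallyComplex K) :
    volume.real (ZSpan.fundamentalDomain (mixedEmbedding.latticeBasis K)) = sqrtDisc K / 2 := by
  rw [measureReal_def, mixedEmbedding.volume_fundamentalDomain_latticeBasis,
    nrComplexPlaces_eq_one K hquad himag, sqrtDisc]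
  simp [Int.norm_eq_abs, inv_mul_eq_div]

theorem image_mixedEmbedding (hquad : finrank ℚ K = 2) (himag : IsTotallyComplex K) {r : ℝ}
    (hr : 0 ≤ r) :
    (fun x : 𝓞 K => mixedEmbedding K (x : K)) ''
      {x | (Ideal.absNorm (Ideal.span {x}) : ℝ) ≤ r ^ 2} =
    closedBall 0 r ∩ Submodule.span ℤ (range (mixedEmbedding.latticeBasis K)) := by
  ext y
  simp only [mem_image, mem_ofPred_eq, mem_inter_iff, mem_closedBall_zero_iff, SetLike.mem_coe,
    mixedEmbedding.mem_span_latticeBasis]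
  constructor
  · rintro ⟨x, hx, rfl⟩
    rw [← norm_mixedEmbedding_sq hquad himag, sq_le_sq₀ (norm_nonneg _) hr] at hx
    exact ⟨hx, x, rfl⟩
  · rintro ⟨hy, x, rfl⟩
    refine ⟨x, ?_, rfl⟩
    rw [← norm_mixedEmbedding_sq hquad himag, sq_le_sq₀ (norm_nonneg _) hr]
    exact hy

theorem injective_mixedEmbedding_coe :
    Function.Injective fun x : 𝓞 K => mixedEmbedding K (x : K) :=
  (mixedEmbedding_injective K).comp RingOfIntegers.coe_injective

theorem absNorm_le_finite (hquad : finrank ℚ K = 2) (himag : IsTotallyComplex K) (X : ℝ) :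
    {x : 𝓞 K | (Ideal.absNorm (Ideal.span {x}) : ℝ) ≤ X}.Finite := by
  have h := lattice_closedBall_finite (mixedEmbedding.latticeBasis K) √(max X 0)
  rw [← image_mixedEmbedding K hquad himag (Real.sqrt_nonneg _),
    Real.sq_sqrt (le_max_right _ _)] at h
  refine (h.of_finite_image (injective_mixedEmbedding_coe K).injOn).subset fun x hx => ?_
  rw [mem_ofPred_eq] at hx ⊢
  exact hx.trans (le_max_left _ _)

theorem exists_abs_ncard_absNorm_le_sub_le (hquad : finrank ℚ K = 2) (himag : IsTotallyComplex K) :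
    ∃ C : ℝ, ∀ X : ℝ, 1 ≤ X →
      |({x : 𝓞 K | x ≠ 0 ∧ (Ideal.absNorm (Ideal.span {x}) : ℝ) ≤ X}.ncard : ℝ) -
        2 * Real.pi / sqrtDisc K * X| ≤ C * √X := by
  obtain ⟨C, hC⟩ := exists_abs_ncard_lattice_sub_le (mixedEmbedding.latticeBasis K) volume
    (by rw [mixedEmbedding.finrank, hquad])
  -- The additional 1 pays for removing the zero element, as `1 ≤ √X`.
  refine ⟨C + 1, fun X hX => ?_⟩
  have h1 : 1 ≤ √X := Real.one_le_sqrt.2 hX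
  have key := hC √X h1
  rw [← image_mixedEmbedding K hquad himag (Real.sqrt_nonneg _), Real.sq_sqrt (by linarith),
    ncard_image_of_injective _ (injective_mixedEmbedding_coe K),
    volume_real_ball_mixedSpace K hquad himag, volume_real_fundamentalDomain K hquad himag] at key
  have hd : {x : 𝓞 K | x ≠ 0 ∧ (Ideal.absNorm (Ideal.span {x}) : ℝ) ≤ X} =
      {x : 𝓞 K | (Ideal.absNorm (Ideal.span {x}) : ℝ) ≤ X} \ {0} := by
    ext x
    simp [and_comm]
  have h0 : (0 : 𝓞 K) ∈ {x : 𝓞 K | (Ideal.absNorm (Ideal.span {x}) : ℝ) ≤ X} := by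
    simp
    linarith
  have hcard := ncard_sdiff_singleton_add_one h0 (absNorm_le_finite K hquad himag X)
  rw [← hd] at hcard
  rw [← hcard] at key
  push_cast at key
  have e : Real.pi / (sqrtDisc K / 2) * X = 2 * Real.pi / sqrtDisc K * X := by ring
  rw [e, abs_le] at key
  rw [abs_le]
  constructor <;> linarith [key.1, key.2]

end RingOfIntegers

end ToricCubic

namespace ToricCubic

/-! ### Unique factorization with chosen prime generators -/

section Factorization

open Set IsDedekindDomain

variable {R : Type*} [CommRing R] [IsPrincipalIdealRing R]

/-- A generator of a height one prime ideal of a principal ideal domain. -/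
noncomputable def primeGen (p : HeightOneSpectrum R) : R := Submodule.IsPrincipal.generator p.asIdeal

theorem span_primeGen (p : HeightOneSpectrum R) : Ideal.span {primeGen p} = p.asIdeal :=
  Ideal.span_singleton_generator _

theorem prime_primeGen (p : HeightOneSpectrum R) : Prime (primeGen p) :=
  have := p.isPrime
  Submodule.IsPrincipal.prime_generator_of_isPrime _ p.ne_bot

/-- The product of powers of the chosen prime elements. -/
noncomputable def primeProd (a : HeightOneSpectrum R →₀ ℕ) : R := a.prod fun p k => primeGen p ^ k

theorem primeProd_zero : primeProd (0 : HeightOneSpectrum R →₀ ℕ) = 1 := Finsupp.prod_zero_index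

theorem primeProd_single (p : HeightOneSpectrum R) (n : ℕ) :
    primeProd (Finsupp.single p n) = primeGen p ^ n := by
  simp [primeProd]

theorem primeProd_add (a b : HeightOneSpectrum R →₀ ℕ) :
    primeProd (a + b) = primeProd a * primeProd b :=
  Finsupp.prod_add_index' (fun _ => pow_zero _) fun _ _ _ => pow_add _ _ _

theorem primeProd_nsmul (n : ℕ) (a : HeightOneSpectrum R →₀ ℕ) :
    primeProd (n • a) = primeProd a ^ n := by
  induction n with
  | zero => simp [primeProd_zero]
  | succ n ih => rw [succ_nsmul, primeProd_add, ih, pow_succ]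

variable [IsDomain R]

theorem primeGen_dvd_primeGen_iff {p p' : HeightOneSpectrum R} :
    primeGen p ∣ primeGen p' ↔ p = p' := by
  rw [(prime_primeGen p).dvd_prime_iff_associated (prime_primeGen p'),
    ← Ideal.span_singleton_eq_span_singleton, span_primeGen, span_primeGen, HeightOneSpectrum.ext_iff]

theorem exists_associated_primeGen {x : R} (hx : Prime x) :
    ∃ p : HeightOneSpectrum R, Associated (primeGen p) x := by
  refine ⟨⟨Ideal.span {x}, (Ideal.span_singleton_prime hx.ne_zero).2 hx,
    by simpa using hx.ne_zero⟩, ?_⟩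
  rw [← Ideal.span_singleton_eq_span_singleton, span_primeGen]

theorem primeProd_ne_zero (a : HeightOneSpectrum R →₀ ℕ) : primeProd a ≠ 0 :=
  Finset.prod_ne_zero_iff.2 fun p _ => pow_ne_zero _ (prime_primeGen p).ne_zero

theorem emultiplicity_primeProd (p : HeightOneSpectrum R) (a : HeightOneSpectrum R →₀ ℕ) :
    emultiplicity (primeGen p) (primeProd a) = a p := by
  have hp := prime_primeGen p
  induction a using Finsupp.induction_linear with
  | zero =>
    rw [primeProd_zero, emultiplicity_of_isUnit_right hp.not_isUnit isUnit_one]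
    simp
  | add a b ha hb =>
    rw [primeProd_add, emultiplicity_mul hp, ha, hb]
    simp
  | single p' n =>
    rw [primeProd_single, emultiplicity_pow hp]
    rcases eq_or_ne p p' with rfl | h
    · rw [(FiniteMultiplicity.of_prime_left hp hp.ne_zero).emultiplicity_self]
      simp
    · rw [emultiplicity_eq_zero.2 (mt primeGen_dvd_primeGen_iff.1 h),
        Finsupp.single_eq_of_ne h]
      simp

theorem unit_mul_primeProd_injective :
    Function.Injective fun x : Rˣ × (HeightOneSpectrum R →₀ ℕ) => (x.1 : R) * primeProd x.2 := by
  rintro ⟨u, a⟩ ⟨v, b⟩ h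
  simp only at h
  have hab : a = b := by
    ext p
    have h1 := congrArg (emultiplicity (primeGen p)) h
    rw [emultiplicity_mul (prime_primeGen p), emultiplicity_mul (prime_primeGen p),
      emultiplicity_of_isUnit_right (prime_primeGen p).not_isUnit u.isUnit,
      emultiplicity_of_isUnit_right (prime_primeGen p).not_isUnit v.isUnit,
      emultiplicity_primeProd, emultiplicity_primeProd, zero_add, zero_add] at h1
    exact_mod_cast h1
  subst hab
  rw [Prod.mk.injEq]
  exact ⟨Units.ext (mul_right_cancel₀ (primeProd_ne_zero a) h), rfl⟩

theorem exists_eq_unit_mul_primeProd {x : R} (hx : x ≠ 0) :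
    ∃ (u : Rˣ) (a : HeightOneSpectrum R →₀ ℕ), x = u * primeProd a := by
  induction x using UniqueFactorizationMonoid.induction_on_prime with
  | h₁ => exact absurd rfl hx
  | h₂ x hu => exact ⟨hu.unit, 0, by rw [primeProd_zero, mul_one, IsUnit.unit_spec]⟩
  | h₃ y p hy hp ih =>
    obtain ⟨u, a, rfl⟩ := ih hy
    obtain ⟨P, v, rfl⟩ := exists_associated_primeGen hp
    refine ⟨v * u, Finsupp.single P 1 + a, ?_⟩
    rw [primeProd_add, primeProd_single, Units.val_mul]
    ring

theorem primeGen_dvd_unit_mul_primeProd_iff {p : HeightOneSpectrum R} {u : Rˣ}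
    {a : HeightOneSpectrum R →₀ ℕ} : primeGen p ∣ u * primeProd a ↔ a p ≠ 0 := by
  rw [Units.dvd_mul_left, ← emultiplicity_ne_zero, emultiplicity_primeProd]
  simp

end Factorization

/-! ### Counting ideals by norm -/

section RingOfIntegers

open Set NumberField IsDedekindDomain

variable (K : Type*) [Field K] [NumberField K]

/-- The absolute norm of a nonzero prime ideal. -/
noncomputable def primeNorm (p : HeightOneSpectrum (𝓞 K)) : ℕ := Ideal.absNorm p.asIdeal

theorem two_le_primeNorm (p : HeightOneSpectrum (𝓞 K)) : 2 ≤ primeNorm K p := by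
  have h0 : Ideal.absNorm p.asIdeal ≠ 0 := fun h => p.ne_bot (Ideal.absNorm_eq_zero_iff.1 h)
  have h1 : Ideal.absNorm p.asIdeal ≠ 1 := fun h => p.isPrime.ne_top (Ideal.absNorm_eq_one_iff.1 h)
  rw [primeNorm]
  omega

theorem freeNorm_pos (a : HeightOneSpectrum (𝓞 K) →₀ ℕ) : 0 < freeNorm (primeNorm K) a :=
  Finset.prod_pos fun p _ => pow_pos (by linarith [two_le_primeNorm K p]) _

variable [IsPrincipalIdealRing (𝓞 K)]

theorem absNorm_unit_mul_primeProd (u : (𝓞 K)ˣ) (a : HeightOneSpectrum (𝓞 K) →₀ ℕ) :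
    Ideal.absNorm (Ideal.span {(u : 𝓞 K) * primeProd a}) = freeNorm (primeNorm K) a := by
  rw [← Ideal.span_singleton_mul_span_singleton, Ideal.span_singleton_eq_top.2 u.isUnit,
    Ideal.top_mul]
  induction a using Finsupp.induction_linear with
  | zero => rw [primeProd_zero, freeNorm_zero]; simp
  | add a b ha hb =>
    rw [primeProd_add, ← Ideal.span_singleton_mul_span_singleton, map_mul, ha, hb, freeNorm_add]
  | single p n =>
    rw [primeProd_single, ← Ideal.span_singleton_pow, map_pow, span_primeGen, freeNorm_single,
      primeNorm]

theorem image_unit_mul_primeProd (X : ℝ) :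
    (fun x : (𝓞 K)ˣ × (HeightOneSpectrum (𝓞 K) →₀ ℕ) => (x.1 : 𝓞 K) * primeProd x.2) ''
      (univ ×ˢ {a | (freeNorm (primeNorm K) a : ℝ) ≤ X}) =
    {x : 𝓞 K | x ≠ 0 ∧ (Ideal.absNorm (Ideal.span {x}) : ℝ) ≤ X} := by
  ext x
  constructor
  · rintro ⟨⟨u, a⟩, ⟨-, ha⟩, rfl⟩
    refine ⟨mul_ne_zero u.ne_zero (primeProd_ne_zero a), ?_⟩
    simp only
    rw [absNorm_unit_mul_primeProd]
    exact ha
  · rintro ⟨hx, hX⟩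
    obtain ⟨u, a, rfl⟩ := exists_eq_unit_mul_primeProd hx
    rw [absNorm_unit_mul_primeProd] at hX
    exact ⟨(u, a), ⟨mem_univ _, hX⟩, rfl⟩

/-- Nonzero elements of bounded norm are pairs of a unit and an exponent vector, so the
lattice-point asymptotic is divided by the number of units. Finiteness of the unit group comes from
the same pairing, since only finitely many elements have norm at most 1. -/
theorem hasLinearCount_freeNorm (hquad : Module.finrank ℚ K = 2) (himag : IsTotallyComplex K) :
    Finite (𝓞 K)ˣ ∧ HasLinearCount (freeNorm (primeNorm K))
      (2 * Real.pi / ((numUnits K : ℝ) * sqrtDisc K)) := by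
  have hfin : ∀ X : ℝ, ((univ : Set (𝓞 K)ˣ) ×ˢ
      {a | (freeNorm (primeNorm K) a : ℝ) ≤ X}).Finite := by
    intro X
    have h : {x : 𝓞 K | x ≠ 0 ∧ (Ideal.absNorm (Ideal.span {x}) : ℝ) ≤ X}.Finite :=
      (absNorm_le_finite K hquad himag X).subset fun x hx => hx.2
    rw [← image_unit_mul_primeProd] at h
    exact h.of_finite_image unit_mul_primeProd_injective.injOn
  have hunits : Finite (𝓞 K)ˣ := by
    have h := (hfin 1).image Prod.fst
    rw [fst_image_prod _ ⟨0, by simp [freeNorm_zero]⟩] at h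
    exact finite_univ_iff.1 h
  have hfin' : ∀ X : ℝ, {a | (freeNorm (primeNorm K) a : ℝ) ≤ X}.Finite := by
    intro X
    have h := (hfin X).image Prod.snd
    rwa [snd_image_prod univ_nonempty] at h
  have hw : 0 < (numUnits K : ℝ) := by
    exact_mod_cast Nat.card_pos
  have hd : 0 < sqrtDisc K := by
    refine Real.sqrt_pos.2 (abs_pos.2 ?_)
    exact_mod_cast NumberField.discr_ne_zero K
  refine ⟨hunits, freeNorm_pos K, hfin', by positivity, ?_⟩
  obtain ⟨C, hC⟩ := exists_abs_ncard_absNorm_le_sub_le K hquad himag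
  refine ⟨C / numUnits K, fun X hX => ?_⟩
  have key := hC X hX
  rw [← image_unit_mul_primeProd, ncard_image_of_injective _ unit_mul_primeProd_injective,
    ncard_prod, ncard_univ, ← numUnits] at key
  set n := ({a | (freeNorm (primeNorm K) a : ℝ) ≤ X}.ncard : ℝ)
  have e : n - 2 * Real.pi / ((numUnits K : ℝ) * sqrtDisc K) * X =
      ((numUnits K : ℝ) * n - 2 * Real.pi / sqrtDisc K * X) / numUnits K := by
    field_simp
  rw [e, abs_div, abs_of_pos hw, div_mul_eq_mul_div C, div_le_div_iff_of_pos_right hw]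
  push_cast at key
  exact key

end RingOfIntegers

end ToricCubic

namespace ToricCubic

/-! ### Primitive representatives -/

section Primitive

open Set

variable {R K : Type*} [CommRing R] [Field K] [Algebra R K] {n : ℕ}

theorem exists_sum_mul_eq_one {y : Fin n → R} (hy : Ideal.span (range y) = ⊤) :
    ∃ c : Fin n → R, ∑ i, c i * y i = 1 :=
  Ideal.mem_span_range_iff_exists_fun.1 (hy ▸ Submodule.mem_top)

theorem exists_primitive_representative [IsDomain R] [IsPrincipalIdealRing R] [IsFractionRing R K]
    {x : Fin n → K} (hx : x ≠ 0) :
    ∃ (y : Fin n → R) (t : K), t ≠ 0 ∧ Ideal.span (range y) = ⊤ ∧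
      ∀ i, x i = t * algebraMap R K (y i) := by
  obtain ⟨b, hb⟩ := IsLocalization.exist_integer_multiples_of_finite (nonZeroDivisors R) x
  choose z hz using hb
  have hb0 : algebraMap R K b ≠ 0 := by simp
  set d := Submodule.IsPrincipal.generator (Ideal.span (range z)) with hd
  have hspan : Ideal.span {d} = Ideal.span (range z) := Ideal.span_singleton_generator _
  have hdvd : ∀ i, d ∣ z i := fun i => by
    rw [← Ideal.mem_span_singleton, hspan]
    exact Ideal.subset_span (mem_range_self i)
  choose y hy using hdvd
  have hd0 : d ≠ 0 := by
    intro h0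
    refine hx (funext fun i => ?_)
    have h1 : algebraMap R K b * x i = 0 := by
      rw [← Algebra.smul_def, ← hz, hy, h0]
      simp
    exact (mul_eq_zero.1 h1).resolve_left hb0
  have hd0' : algebraMap R K d ≠ 0 := by simpa using hd0
  refine ⟨y, algebraMap R K d / algebraMap R K b, div_ne_zero hd0' hb0, ?_, fun i => ?_⟩
  · obtain ⟨c, hc⟩ := Ideal.mem_span_range_iff_exists_fun.1
      (hspan ▸ Ideal.mem_span_singleton_self d)
    rw [Ideal.eq_top_iff_one]
    refine Ideal.mem_span_range_iff_exists_fun.2 ⟨c, mul_left_cancel₀ hd0 ?_⟩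
    rw [Finset.mul_sum, mul_one]
    refine Eq.trans (Finset.sum_congr rfl fun i _ => ?_) hc
    rw [hy i]
    ring
  · rw [div_mul_eq_mul_div, eq_div_iff hb0, ← map_mul, ← hy, hz, Algebra.smul_def, mul_comm]

/-- Bézout relations for `y` and for `z` show that `t` and its inverse both come from `R`. -/
theorem exists_unit_of_primitive [FaithfulSMul R K] {y z : Fin n → R}
    (hy : Ideal.span (range y) = ⊤) (hz : Ideal.span (range z) = ⊤) {t : K}
    (h : ∀ i, algebraMap R K (z i) = t * algebraMap R K (y i)) :
    ∃ u : Rˣ, ∀ i, z i = u * y i := by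
  obtain ⟨c, hc⟩ := exists_sum_mul_eq_one hy
  obtain ⟨e, he⟩ := exists_sum_mul_eq_one hz
  have h1 : algebraMap R K (∑ i, c i * z i) = t := by
    calc _ = t * algebraMap R K (∑ i, c i * y i) := by
          simp only [map_sum, map_mul, Finset.mul_sum, h]
          exact Finset.sum_congr rfl fun i _ => by ring
      _ = t := by rw [hc, map_one, mul_one]
  have h2 : t * algebraMap R K (∑ i, e i * y i) = 1 := by
    calc _ = algebraMap R K (∑ i, e i * z i) := by
          simp only [map_sum, map_mul, Finset.mul_sum, h]
          exact Finset.sum_congr rfl fun i _ => by ring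
      _ = 1 := by rw [he, map_one]
  have hinj := FaithfulSMul.algebraMap_injective R K
  have h3 : (∑ i, c i * z i) * (∑ i, e i * y i) = 1 := hinj (by rw [map_mul, h1, h2, map_one])
  refine ⟨⟨_, _, h3, by rw [mul_comm]; exact h3⟩, fun i => hinj ?_⟩
  rw [map_mul, h1, h]

end Primitive

/-! ### The height of a primitive tuple -/

section Height

open Set NumberField

variable {K : Type*} [Field K] [NumberField K]

/-- The finite places contribute the inverse norm of the ideal generated by the coordinates, here 1.
Only the complex place is left, and the square is its multiplicity. -/
theorem mulHeight_primitive (hquad : Module.finrank ℚ K = 2) (himag : IsTotallyComplex K)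
    {n : ℕ} {y : Fin n → 𝓞 K} (hy : Ideal.span (range y) = ⊤) (hy0 : (fun i => (y i : K)) ≠ 0)
    (w : InfinitePlace K) : Height.mulHeight (fun i => (y i : K)) = (⨆ i, w (y i : K)) ^ 2 := by
  obtain ⟨hu⟩ := Fintype.card_eq_one_iff_nonempty_unique.1 (card_infinitePlace_eq_one K hquad himag)
  have h0 : y ≠ 0 := fun h => hy0 (by simp [h]; rfl)
  have h1 := absNorm_mul_finprod_finitePlace_eq_one h0
  rw [hy, Ideal.absNorm_top, Nat.cast_one, one_mul] at h1
  rw [mulHeight_eq hy0, h1, mul_one, Fintype.prod_unique, Subsingleton.elim default w,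
    InfinitePlace.mult_isComplex ⟨w, himag.isComplex w⟩]

theorem mulHeight_primitive_le_iff (hquad : Module.finrank ℚ K = 2) (himag : IsTotallyComplex K)
    {n : ℕ} [NeZero n] {y : Fin n → 𝓞 K} (hy : Ideal.span (range y) = ⊤)
    (hy0 : (fun i => (y i : K)) ≠ 0) (B : ℝ) : Height.mulHeight (fun i => (y i : K)) ≤ B ↔
      ∀ i, (Ideal.absNorm (Ideal.span {y i}) : ℝ) ≤ B := by
  obtain ⟨hu⟩ := Fintype.card_eq_one_iff_nonempty_unique.1 (card_infinitePlace_eq_one K hquad himag)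
  rw [mulHeight_primitive hquad himag hy hy0 default]
  simp only [← infinitePlace_sq hquad himag default]
  have hbdd : BddAbove (range fun i => (default : InfinitePlace K) (y i : K)) :=
    (finite_range _).bddAbove
  constructor
  · intro h i
    exact (pow_le_pow_left₀ (apply_nonneg _ _) (le_ciSup hbdd i) 2).trans h
  · intro h
    have hB : 0 ≤ B := (sq_nonneg _).trans (h 0)
    rw [← Real.sq_sqrt hB]
    refine pow_le_pow_left₀ (Real.iSup_nonneg fun i => apply_nonneg _ _) (ciSup_le fun i => ?_) 2
    exact Real.le_sqrt_of_sq_le (h i)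

end Height

/-! ### Integral coordinates of points of the surface -/

section Points

open Set NumberField IsDedekindDomain

/-- A third of the sum of three exponent vectors. -/
noncomputable def thirdSum {P : Type*} (a : Fin 3 → P →₀ ℕ) : P →₀ ℕ :=
  (∑ i, a i).mapRange (· / 3) rfl

theorem three_nsmul_thirdSum {P : Type*} {a : Fin 3 → P →₀ ℕ} (h : ∀ p, 3 ∣ ∑ i, a i p) :
    3 • thirdSum a = a 0 + a 1 + a 2 := by
  ext p
  have := h p
  rw [Fin.sum_univ_three] at this
  simp [thirdSum, Fin.sum_univ_three]
  omega

variable {R : Type*} [CommRing R] [IsPrincipalIdealRing R]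

/-- The coordinates of the point of the cubic surface attached to a coprime triple and two
units. -/
noncomputable def pointCoords (z : (Fin 3 → HeightOneSpectrum R →₀ ℕ) × Rˣ × Rˣ) : Fin 4 → R :=
  ![primeProd (thirdSum z.1), z.2.1 * primeProd (z.1 0), z.2.2 * primeProd (z.1 1),
    ((z.2.1 * z.2.2)⁻¹ : Rˣ) * primeProd (z.1 2)]

theorem pointCoords_relation {z : (Fin 3 → HeightOneSpectrum R →₀ ℕ) × Rˣ × Rˣ}
    (h : ∀ p, 3 ∣ ∑ i, z.1 i p) :
    pointCoords z 0 ^ 3 = pointCoords z 1 * pointCoords z 2 * pointCoords z 3 := by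
  simp only [pointCoords, Matrix.cons_val]
  rw [← primeProd_nsmul, three_nsmul_thirdSum h, primeProd_add, primeProd_add]
  have : ((z.2.1 : R) * z.2.2) * ((z.2.1 * z.2.2)⁻¹ : Rˣ) = 1 := by
    rw [← Units.val_mul, Units.mul_inv]
  linear_combination -(primeProd (z.1 0) * primeProd (z.1 1) * primeProd (z.1 2)) * this

theorem span_range_eq_top_of_not_dvd {n : ℕ} {y : Fin n → R} (i₀ : Fin n) (h0 : y i₀ ≠ 0)
    (h : ∀ p : HeightOneSpectrum R, ∃ i, ¬ primeGen p ∣ y i) : Ideal.span (range y) = ⊤ := by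
  by_contra hne
  obtain ⟨M, hM, hle⟩ := Ideal.exists_le_maximal _ hne
  have hmem : ∀ i, y i ∈ M := fun i => hle (Ideal.subset_span (mem_range_self i))
  obtain ⟨i, hi⟩ := h ⟨M, hM.isPrime, fun h => h0 (by simpa [h] using hmem i₀)⟩
  refine hi ?_
  rw [← Ideal.mem_span_singleton, span_primeGen]
  exact hmem i

variable [IsDomain R]

theorem span_pointCoords {z : (Fin 3 → HeightOneSpectrum R →₀ ℕ) × Rˣ × Rˣ}
    (h : ∀ p, ∃ i, z.1 i p = 0) : Ideal.span (range (pointCoords z)) = ⊤ := by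
  refine span_range_eq_top_of_not_dvd 0 (primeProd_ne_zero _) fun p => ?_
  obtain ⟨i, hi⟩ := h p
  refine ⟨i.succ, fun hdvd => ?_⟩
  fin_cases i
  · exact primeGen_dvd_unit_mul_primeProd_iff.1 hdvd hi
  · exact primeGen_dvd_unit_mul_primeProd_iff.1 hdvd hi
  · exact primeGen_dvd_unit_mul_primeProd_iff.1 hdvd hi

/-- The zeroth coordinate has unit part 1 by construction, which forces `e = 1`; the other
coordinates then return the exponents and the two units. -/
theorem pointCoords_injective_of_unit {z z' : (Fin 3 → HeightOneSpectrum R →₀ ℕ) × Rˣ × Rˣ}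
    {e : Rˣ} (h : ∀ i, pointCoords z' i = e * pointCoords z i) : z' = z := by
  obtain ⟨a, u, v⟩ := z
  obtain ⟨a', u', v'⟩ := z'
  have key : ∀ {x x' : Rˣ} {b b' : HeightOneSpectrum R →₀ ℕ},
      (x' : R) * primeProd b' = e * (x * primeProd b) → x' = e * x ∧ b' = b := by
    intro x x' b b' h
    rw [← mul_assoc, ← Units.val_mul] at h
    have := unit_mul_primeProd_injective (a₁ := (x', b')) (a₂ := (e * x, b)) h
    exact ⟨congrArg Prod.fst this, congrArg Prod.snd this⟩
  have h1 := key (h 1)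
  have h2 := key (h 2)
  have h3 := key (h 3)
  have ha : a' = a := by
    ext i : 1
    fin_cases i
    · exact h1.2
    · exact h2.2
    · exact h3.2
  subst ha
  have h0 : (1 : Rˣ) = e * 1 := by
    refine (key (x := 1) (x' := 1) (b := thirdSum a') (b' := thirdSum a') ?_).1
    simpa [pointCoords] using h 0
  rw [mul_one] at h0
  subst h0
  simp only [one_mul] at h1 h2
  rw [h1.1, h2.1]

theorem exists_pointCoords_of_relation {y : Fin 4 → R} (hy : Ideal.span (range y) = ⊤)
    (hrel : y 0 ^ 3 = y 1 * y 2 * y 3) (h0 : y 0 ≠ 0) :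
    ∃ (z : (Fin 3 → HeightOneSpectrum R →₀ ℕ) × Rˣ × Rˣ) (e : Rˣ),
      (∀ p, (∃ i, z.1 i p = 0) ∧ 3 ∣ ∑ i, z.1 i p) ∧ ∀ i, y i = e * pointCoords z i := by
  have hne : y 1 * y 2 * y 3 ≠ 0 := hrel ▸ pow_ne_zero 3 h0
  obtain ⟨u₀, b, hb⟩ := exists_eq_unit_mul_primeProd h0
  obtain ⟨u₁, a₁, h1⟩ := exists_eq_unit_mul_primeProd
    (left_ne_zero_of_mul (left_ne_zero_of_mul hne))
  obtain ⟨u₂, a₂, h2⟩ := exists_eq_unit_mul_primeProd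
    (right_ne_zero_of_mul (left_ne_zero_of_mul hne))
  obtain ⟨u₃, a₃, h3⟩ := exists_eq_unit_mul_primeProd (right_ne_zero_of_mul hne)
  have heq : ((u₀ ^ 3 : Rˣ) : R) * primeProd (3 • b) =
      ((u₁ * u₂ * u₃ : Rˣ) : R) * primeProd (a₁ + a₂ + a₃) := by
    rw [hb, h1, h2, h3] at hrel
    rw [primeProd_nsmul, primeProd_add, primeProd_add]
    push_cast
    linear_combination hrel
  have hpair := unit_mul_primeProd_injective (a₁ := (u₀ ^ 3, 3 • b))
    (a₂ := (u₁ * u₂ * u₃, a₁ + a₂ + a₃)) heq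
  have hu : u₀ ^ 3 = u₁ * u₂ * u₃ := congrArg Prod.fst hpair
  have hsum : 3 • b = a₁ + a₂ + a₃ := congrArg Prod.snd hpair
  have hsum' : ∀ p, 3 * b p = a₁ p + a₂ p + a₃ p := fun p => by
    simpa using DFunLike.congr_fun hsum p
  have hthird : thirdSum ![a₁, a₂, a₃] = b := by
    ext p
    have := hsum' p
    simp [thirdSum, Fin.sum_univ_three]
    omega
  -- Scaling by `u₀` normalizes the zeroth coordinate; the relation `u₀ ^ 3 = u₁ * u₂ * u₃` then
  -- determines the last unit from the first two.
  refine ⟨(![a₁, a₂, a₃], u₁ / u₀, u₂ / u₀), u₀, fun p => ⟨?_, ?_⟩, fun i => ?_⟩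
  · by_contra hcon
    push Not at hcon
    have hp : ∀ i, primeGen p ∣ y i := by
      have e1 : primeGen p ∣ y 1 := by
        rw [h1]
        exact primeGen_dvd_unit_mul_primeProd_iff.2 (hcon 0)
      intro i
      fin_cases i
      · refine (prime_primeGen p).dvd_of_dvd_pow (n := 3) ?_
        simp only [Fin.zero_eta, hrel, mul_assoc]
        exact e1.mul_right _
      · exact e1
      · simp only [Fin.reduceFinMk, h2]
        exact primeGen_dvd_unit_mul_primeProd_iff.2 (hcon 1)
      · simp only [Fin.reduceFinMk, h3]
        exact primeGen_dvd_unit_mul_primeProd_iff.2 (hcon 2)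
    obtain ⟨c, hc⟩ := exists_sum_mul_eq_one hy
    refine (prime_primeGen p).not_isUnit (isUnit_of_dvd_one ?_)
    rw [← hc]
    exact Finset.dvd_sum fun i _ => (hp i).mul_left _
  · have := hsum' p
    simp only [Fin.sum_univ_three, Matrix.cons_val]
    omega
  · have hu3 : u₀ * (u₁ / u₀ * (u₂ / u₀))⁻¹ = u₃ := by
      have : u₃ = u₀ ^ 3 / (u₁ * u₂) := by rw [hu, mul_div_cancel_left]
      rw [this, div_mul_div_comm, inv_div, ← mul_div_assoc, pow_three]
    fin_cases i
    · simp [pointCoords, hthird, hb]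
    · simp only [pointCoords, Fin.mk_one, Matrix.cons_val, h1]
      rw [← mul_assoc, ← Units.val_mul, mul_div_cancel]
    · simp only [pointCoords, Fin.reduceFinMk, Matrix.cons_val, h2]
      rw [← mul_assoc, ← Units.val_mul, mul_div_cancel]
    · simp only [pointCoords, Fin.reduceFinMk, Matrix.cons_val, h3]
      rw [← mul_assoc, ← Units.val_mul, hu3]

end Points

end ToricCubic

namespace ToricCubic

/-! ### Points of bounded height as cubic triples with two units -/

section Parametrization

open Set NumberField IsDedekindDomain

theorem pointCoords_ne_zero (K : Type*) [Field K] [IsPrincipalIdealRing (𝓞 K)]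
    (z : (Fin 3 → HeightOneSpectrum (𝓞 K) →₀ ℕ) × (𝓞 K)ˣ × (𝓞 K)ˣ) :
    (fun i => ((pointCoords z i : 𝓞 K) : K)) ≠ 0 := by
  intro h
  have := congrFun h 0
  simp only [Pi.zero_apply, RingOfIntegers.coe_eq_zero_iff] at this
  exact primeProd_ne_zero (thirdSum z.1) this

variable (K : Type*) [Field K] [NumberField K]

/-- The factor w² counts the units, the ninth power is κ⁹, and 2⁹/2880 = 2⁷/6!. -/
theorem leadingConstant_eq : leadingConstant K = (numUnits K : ℝ) ^ 2 *
    ((2 * Real.pi / ((numUnits K : ℝ) * sqrtDisc K)) ^ 9 / 2880 *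
      ∏' p, localFactor (primeNorm K) p) := by
  have h : localFactor (primeNorm K) = eulerFactor K := rfl
  rw [leadingConstant, h]
  rcases eq_or_ne (numUnits K : ℝ) 0 with h0 | h0
  · simp [h0]
  · rw [div_pow, mul_pow, mul_pow]
    norm_num [Nat.factorial]
    field_simp
    ring

variable [IsPrincipalIdealRing (𝓞 K)]

/-- The point of the cubic surface attached to a coprime triple and two units. -/
noncomputable def pointOf (z : (Fin 3 → HeightOneSpectrum (𝓞 K) →₀ ℕ) × (𝓞 K)ˣ × (𝓞 K)ˣ) :
    ℙ K (Fin 4 → K) :=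
  Projectivization.mk K (fun i => ((pointCoords z i : 𝓞 K) : K)) (pointCoords_ne_zero K z)

/-- On the surface, x₀ = 0 forces another coordinate to vanish, so the three lines together are the
locus x₀ = 0. -/
theorem mk_mem_openPart_iff {K : Type*} [Field K] (v : Fin 4 → K) (hv : v ≠ 0) :
    Projectivization.mk K v hv ∈ openPart K ↔ v 0 ^ 3 = v 1 * v 2 * v 3 ∧ v 0 ≠ 0 := by
  simp only [openPart, mem_sdiff, mem_union, mk_mem_surface_iff, mk_mem_line_iff]
  refine and_congr_right fun h => ?_
  constructor
  · rintro h' h0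
    rw [h0, zero_pow three_ne_zero] at h
    have := h.symm
    simp only [mul_eq_zero] at this
    exact h' (by simpa [h0] using this)
  · rintro h0 ((h' | h') | h')
    · exact h0 h'.1
    · exact h0 h'.1
    · exact h0 h'.1

theorem bijOn_pointOf (hquad : Module.finrank ℚ K = 2) (himag : IsTotallyComplex K) (B : ℝ) :
    BijOn (pointOf K) (cubicTriples (primeNorm K) B ×ˢ univ) (pointsOfHeightLE K B) := by
  have hheight : ∀ z : (Fin 3 → HeightOneSpectrum (𝓞 K) →₀ ℕ) × (𝓞 K)ˣ × (𝓞 K)ˣ,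
      (∀ p, (∃ i, z.1 i p = 0) ∧ 3 ∣ ∑ i, z.1 i p) →
      ((pointOf K z).mulHeight ≤ B ↔ ∀ i, (freeNorm (primeNorm K) (z.1 i) : ℝ) ≤ B) := by
    intro z hz
    rw [pointOf, Projectivization.mulHeight_mk, mulHeight_primitive_le_iff hquad himag
      (span_pointCoords fun p => (hz p).1) (pointCoords_ne_zero K z),
      Fin.forall_fin_succ (n := 3), Fin.forall_fin_succ (n := 2),
      Fin.forall_fin_two, Fin.forall_fin_succ (n := 2), Fin.forall_fin_two]
    have e1 : Ideal.absNorm (Ideal.span {pointCoords z 1}) = freeNorm (primeNorm K) (z.1 0) :=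
      absNorm_unit_mul_primeProd K _ _
    have e2 : Ideal.absNorm (Ideal.span {pointCoords z 2}) = freeNorm (primeNorm K) (z.1 1) :=
      absNorm_unit_mul_primeProd K _ _
    have e3 : Ideal.absNorm (Ideal.span {pointCoords z 3}) = freeNorm (primeNorm K) (z.1 2) :=
      absNorm_unit_mul_primeProd K _ _
    have e0 : Ideal.absNorm (Ideal.span {pointCoords z 0}) ^ 3 =
        freeNorm (primeNorm K) (z.1 0) * freeNorm (primeNorm K) (z.1 1) *
          freeNorm (primeNorm K) (z.1 2) := by
      rw [← e1, ← e2, ← e3, ← map_pow, ← map_mul, ← map_mul, Ideal.span_singleton_pow,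
        Ideal.span_singleton_mul_span_singleton, Ideal.span_singleton_mul_span_singleton,
        pointCoords_relation fun p => (hz p).2]
    simp only [Fin.succ_zero_eq_one, Fin.succ_one_eq_two, Fin.reduceSucc, e1, e2, e3]
    -- The zeroth coordinate imposes no condition of its own: the cube of its norm is the product of
    -- the other three norms.
    refine and_iff_right_of_imp fun h => ?_
    have h0 : ((Ideal.absNorm (Ideal.span {pointCoords z 0}) : ℕ) : ℝ) ^ 3 =
        freeNorm (primeNorm K) (z.1 0) * freeNorm (primeNorm K) (z.1 1) *
          freeNorm (primeNorm K) (z.1 2) := by exact_mod_cast e0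
    have hB : 0 ≤ B := (Nat.cast_nonneg _).trans h.1
    refine le_of_pow_le_pow_left₀ three_ne_zero hB ?_
    rw [h0, pow_three, ← mul_assoc]
    gcongr
    · exact h.1
    · exact h.2.1
    · exact h.2.2
  refine ⟨?_, ?_, ?_⟩
  · rintro z ⟨hz, -⟩
    refine ⟨?_, (hheight z hz.1).2 hz.2⟩
    rw [pointOf, mk_mem_openPart_iff]
    refine ⟨?_, ?_⟩
    · exact_mod_cast congrArg (algebraMap (𝓞 K) K) (pointCoords_relation fun p => (hz.1 p).2)
    · rw [ne_eq, RingOfIntegers.coe_eq_zero_iff]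
      exact primeProd_ne_zero _
  · rintro z ⟨hz, -⟩ z' ⟨hz', -⟩ h
    obtain ⟨t, ht⟩ := (Projectivization.mk_eq_mk_iff' K _ _ _ _).1 h
    obtain ⟨e, he⟩ := exists_unit_of_primitive (K := K) (span_pointCoords fun p => (hz'.1 p).1)
      (span_pointCoords fun p => (hz.1 p).1) (t := t) fun i => (congrFun ht i).symm
    exact pointCoords_injective_of_unit he
  · rintro x ⟨hx, hxB⟩
    obtain ⟨v, hv, rfl⟩ : ∃ (v : Fin 4 → K) (hv : v ≠ 0), Projectivization.mk K v hv = x :=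
      ⟨x.rep, x.rep_nonzero, x.mk_rep⟩
    obtain ⟨y, t, ht, hy, hvy⟩ := exists_primitive_representative (R := 𝓞 K) hv
    rw [mk_mem_openPart_iff] at hx
    have hy0 : y 0 ≠ 0 := fun h => hx.2 (by rw [hvy, h]; simp)
    have hrel : y 0 ^ 3 = y 1 * y 2 * y 3 := by
      refine RingOfIntegers.coe_injective (mul_left_cancel₀ (pow_ne_zero 3 ht) ?_)
      have h := hx.1
      rw [hvy 0, hvy 1, hvy 2, hvy 3] at h
      simp only [map_pow, map_mul]
      linear_combination h
    obtain ⟨z, e, hz, hze⟩ := exists_pointCoords_of_relation hy hrel hy0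
    have hpt : pointOf K z = Projectivization.mk K v hv := by
      rw [pointOf, Projectivization.mk_eq_mk_iff']
      refine ⟨(t * ((e : 𝓞 K) : K))⁻¹, funext fun i => ?_⟩
      have he0 : ((e : 𝓞 K) : K) ≠ 0 := by
        rw [ne_eq, RingOfIntegers.coe_eq_zero_iff]
        exact e.ne_zero
      rw [Pi.smul_apply, hvy, hze, map_mul, smul_eq_mul]
      field_simp
    rw [← hpt] at hxB
    exact ⟨z, ⟨⟨hz, (hheight z hz).1 hxB⟩, mem_univ _⟩, hpt⟩

theorem pointCount_eq (hquad : Module.finrank ℚ K = 2) (himag : IsTotallyComplex K) (B : ℝ) :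
    (pointsOfHeightLE K B).Finite ∧
      pointCount K B = (cubicTriples (primeNorm K) B).ncard * numUnits K ^ 2 := by
  have hbij := bijOn_pointOf K hquad himag B
  obtain ⟨hfin, h⟩ := hasLinearCount_freeNorm K hquad himag
  rw [pointCount, ← hbij.image_eq, hbij.injOn.ncard_image, ncard_prod, ncard_univ, Nat.card_prod,
    ← numUnits, sq]
  exact ⟨((cubicTriples_finite h B).prod finite_univ).image _, rfl⟩

end Parametrization

end ToricCubic

/-! ### Assembly of the asymptotic formula -/

theorem theorem1 (K : Type*) [Field K] [NumberField K]
    (hquad : Module.finrank ℚ K = 2) (himag : NumberField.IsTotallyComplex K)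
    (hclass : NumberField.classNumber K = 1) :
    Multipliable (ToricCubic.eulerFactor K) ∧
    0 < ToricCubic.leadingConstant K ∧
    (∀ B : ℝ, (ToricCubic.pointsOfHeightLE K B).Finite) ∧
    (fun B : ℝ => (ToricCubic.pointCount K B : ℝ) -
        ToricCubic.leadingConstant K * B * Real.log B ^ 6)
      =O[Filter.atTop] (fun B : ℝ => B * Real.log B ^ 5) := by
  have _ := NumberField.classNumber_eq_one_iff.1 hclass
  obtain ⟨hunits, h⟩ := ToricCubic.hasLinearCount_freeNorm K hquad himag
  have hq := ToricCubic.two_le_primeNorm K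
  have hw : 0 < (ToricCubic.numUnits K : ℝ) := by
    exact_mod_cast Nat.card_pos
  refine ⟨ToricCubic.multipliable_localFactor h hq, ?_,
    fun B => (ToricCubic.pointCount_eq K hquad himag B).1, ?_⟩
  · rw [ToricCubic.leadingConstant_eq]
    have h1 := ToricCubic.tprod_localFactor_pos h hq
    have h2 := h.density_pos
    positivity
  · obtain ⟨C, hC⟩ := ToricCubic.ncard_cubicTriples_bound h hq
    refine Asymptotics.IsBigO.of_bound ((ToricCubic.numUnits K : ℝ) ^ 2 * C) ?_
    -- `exp 1 ≤ B` gives `1 ≤ log B`, the range in which the count of triples is uniform.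
    filter_upwards [Filter.eventually_ge_atTop (Real.exp 1), Filter.eventually_ge_atTop 1]
      with B hB1 hB
    have hlog : 1 ≤ Real.log B := (Real.le_log_iff_exp_le (by linarith)).2 hB1
    rw [(ToricCubic.pointCount_eq K hquad himag B).2, ToricCubic.leadingConstant_eq,
      Real.norm_eq_abs, Real.norm_eq_abs,
      abs_of_nonneg (a := B * Real.log B ^ 5) (by positivity)]
    have key := mul_le_mul_of_nonneg_left (hC B hlog hB)
      (sq_nonneg (ToricCubic.numUnits K : ℝ))
    rw [← abs_of_nonneg (sq_nonneg (ToricCubic.numUnits K : ℝ)), ← abs_mul,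
      abs_of_nonneg (sq_nonneg (ToricCubic.numUnits K : ℝ)), ← mul_assoc] at key
    refine le_trans (le_of_eq ?_) key
    congr 1
    push_cast
    ring
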